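/- Let $k$ be a field, $G$ a finite group, $H\subseteq G$ a subgroup, and let $\alpha:G\times G\times G\to k^*$ be a normalised 3-cocycle: $\alpha(g,h,l)\,\alpha(f,gh,l)\,\alpha(f,g,h)=\alpha(fg,h,l)\,\alpha(f,g,hl)$, and $\alpha(f,g,h)=1$ as soon as one of $f,g,h$ is the identity. Put $$\alpha(f,g|h)=\alpha(f,g,h)^{-1}\,\alpha(f,ghg^{-1},g)\,\alpha(fghg^{-1}f^{-1},f,g)^{-1},$$ $$\alpha(f|g,h)=\alpha(f,g,h)\,\alpha(fgf^{-1},f,h)^{-1}\,\alpha(fgf^{-1},fhf^{-1},f).$$ Let $\mathcal C(G,H,\alpha)$ be the monoidal category of finite-dimensional $G$-graded $k$-vector spaces $V=\bigoplus_{g\in G}V_g$ with an $\alpha$-projective $H$-action, i.e. linear automorphisms $v\mapsto f.v$ ($f\in H$) with $f.V_g=V_{fgf^{-1}}$ and $(fg).v=\alpha(f,g|x)\,f.(g.v)$ for $v\in V_x$; morphisms are linear maps preserving grading and action. The tensor product is that of graded vector spaces with $f.(u\otimes v)=\alpha(f|x,y)\,(f.u\otimes f.v)$ for $u\in U_x$,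 $v\in V_y$; the associativity constraint is $u\otimes(v\otimes w)\mapsto\alpha(x,y,z)\,(u\otimes v)\otimes w$ for $u\in U_x$, $v\in V_y$, $w\in W_z$; the unit is $k$ in degree $e$ with trivial action. Let $\mathcal Z(G,\alpha)=\mathcal C(G,G,\alpha)$, which is braided by $c(u\otimes v)=x.v\otimes u$ for $u\in U_x$. Likewise $\mathcal Z(H,\alpha|_H)$ is defined by the group $H$ and the restricted cocycle $\alpha|_H$; extending gradings by zero from $H$ to $G$ gives a monoidal inclusion $\iota:\mathcal Z(H,\alpha|_H)\to\mathcal C(G,H,\alpha)$. Let $A=k(G/H)$ be the algebra of functions on $G/H$ with pointwise multiplication, placed in degree $e$, with the action $(g.a)(x)=a(g^{-1}x)$; it is a commutative algebra in $\mathcal Z(G,\alpha)$. Let $\mathcal Z(G,\alpha)_A$ be the monoidal category of right $A$-modules in $\mathcal Z(G,\alpha)$ with the relative tensor product $M\otimes_A N$, the coequalizer of the two maps $M\otimes A\otimes N\to M\otimes N$ given by the action on $M$ and by the left action $A\otimes N\xrightarrow{c_{A,N}}N\otimes A\to N$. Call a right $A$-module $M$ with action $\mu:M\otimes A\to M$ local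 if $\mu\circ c_{A,M}\circ c_{M,A}=\mu$. Local modules form a full monoidal subcategory $\mathcal Z(G,\alpha)_A^{\mathrm{loc}}$, which is braided by the maps $M\otimes_A N\to N\otimes_A M$ induced by $c_{M,N}$. Then there are 1. a monoidal equivalence of categories $D:\mathcal Z(G,\alpha)_{k(G/H)}\to\mathcal C(G,H,\alpha)$; 2. a braided monoidal equivalence of categories $L:\mathcal Z(G,\alpha)_{k(G/H)}^{\mathrm{loc}}\to\mathcal Z(H,\alpha|_H)$, such that the restriction of $D$ to local modules is isomorphic, as a monoidal functor, to $\iota\circ L$. -/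

import Mathlib

universe v u

set_option linter.unusedSectionVars false
set_option linter.unusedSimpArgs false
set_option linter.style.longLine false

section RightModules

open CategoryTheory Limits MonoidalCategory MonObj

variable {C : Type u} [Category.{v} C] [MonoidalCategory C]

/-- A (unital) right module over an algebra `A` in a monoidal category. -/
structure RightMod (A : Mon C) where
  /-- the underlying object -/
  X : C
  /-- the action map -/
  act : X ⊗ A.X ⟶ X
  act_one : X ◁ η ≫ act = (ρ_ X).hom
  act_assoc : X ◁ μ ≫ act = (α_ X A.X A.X).inv ≫ act ▷ A.X ≫ act

namespace RightMod



variable {A : Mon C}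

/-- A morphism of right modules. -/
@[ext]
structure Hom (M N : RightMod A) where
  /-- the underlying morphism -/
  hom : M.X ⟶ N.X
  act_hom : M.act ≫ hom = hom ▷ A.X ≫ N.act

instance : Category (RightMod A) where
  Hom M N := Hom M N
  id M := ⟨𝟙 M.X, by simp⟩
  comp f g := ⟨f.hom ≫ g.hom, by
    rw [← Category.assoc, f.act_hom, Category.assoc, g.act_hom]; simp⟩

@[ext]
lemma hom_ext {M N : RightMod A} (f g : M ⟶ N) (h : f.hom = g.hom) : f = g := Hom.ext h

@[simp] lemma id_hom (M : RightMod A) : (𝟙 M : Hom M M).hom = 𝟙 M.X := rfl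
@[simp] lemma comp_hom {M N P : RightMod A} (f : M ⟶ N) (g : N ⟶ P) :
    (f ≫ g : Hom M P).hom = f.hom ≫ g.hom := rfl

variable [BraidedCategory C] [IsCommMonObj A.X]

/-- A right module over a commutative algebra is a bimodule,
with left action `A ⊗ M ⟶ M ⊗ A ⟶ M`. -/
def toBimod (M : RightMod A) : Bimod A A where
  X := M.X
  actLeft := (β_ A.X M.X).hom ≫ M.act
  actRight := M.act
  one_actLeft := by
    rw [BraidedCategory.braiding_naturality_left_assoc, M.act_one]; simp
  left_assoc := by
    rw [BraidedCategory.braiding_naturality_left_assoc]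
    have h := IsCommMonObj.mul_comm A.X
    conv_lhs => rw [← h]
    rw [MonoidalCategory.whiskerLeft_comp, Category.assoc, M.act_assoc]
    simp only [MonoidalCategory.whiskerLeft_comp, Category.assoc,
      BraidedCategory.braiding_naturality_right_assoc, BraidedCategory.braiding_tensor_left_hom,
      BraidedCategory.braiding_tensor_right_hom]
  actRight_one := M.act_one
  right_assoc := M.act_assoc
  middle_assoc := by
    have h := IsCommMonObj.mul_comm A.X
    simp only [MonoidalCategory.comp_whiskerRight, Category.assoc,
      BraidedCategory.braiding_naturality_right_assoc,
      BraidedCategory.braiding_tensor_right_hom, Iso.hom_inv_id_assoc]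
    rw [← M.act_assoc, ← MonoidalCategory.whiskerLeft_comp_assoc, h, M.act_assoc]
    simp

/-- Right modules over a commutative algebra form a full subcategory of bimodules. -/
def toBimodFunctor (A : Mon C) [IsCommMonObj A.X] : RightMod A ⥤ Bimod A A where
  obj M := M.toBimod
  map f :=
    { hom := f.hom
      left_act_hom := by
        simp only [toBimod, Category.assoc, BraidedCategory.braiding_naturality_right_assoc]
        rw [f.act_hom]
      right_act_hom := f.act_hom }

def toBimodFullyFaithful (A : Mon C) [IsCommMonObj A.X] :
    (toBimodFunctor A).FullyFaithful where
  preimage f := ⟨f.hom, f.right_act_hom⟩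

instance (A : Mon C) [IsCommMonObj A.X] : (toBimodFunctor A).Faithful :=
  (toBimodFullyFaithful A).faithful

variable [HasCoequalizers C]
  [∀ X : C, PreservesColimitsOfSize.{0, 0} (tensorLeft X)]
  [∀ X : C, PreservesColimitsOfSize.{0, 0} (tensorRight X)]


/-- The lawful monoidal structure on bimodules coming from the bicategory of bimodules. -/
@[reducible] noncomputable def bimodMonoidalAux (A : Mon C) : MonoidalCategory (Bimod A A) :=
  letI : Bicategory (Mon C) := Bimod.monBicategory
  @CategoryTheory.instMonoidalCategoryHom _ Bimod.monBicategory A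

open Bimod in
/-- Bimodules over an algebra form a monoidal category under the relative tensor product. -/
noncomputable instance bimodMonoidal (A : Mon C) : MonoidalCategory (Bimod A A) where
  tensorObj M N := M.tensorBimod N
  whiskerLeft M _ _ f := whiskerLeft M f
  whiskerRight f N := whiskerRight f N
  tensorUnit := regular A
  associator := associatorBimod
  leftUnitor := leftUnitorBimod
  rightUnitor := rightUnitorBimod
  tensorHom_comp_tensorHom := (bimodMonoidalAux A).tensorHom_comp_tensorHom
  id_tensorHom_id := (bimodMonoidalAux A).id_tensorHom_id
  tensorHom_def _ _ := rfl
  whiskerLeft_id := (bimodMonoidalAux A).whiskerLeft_id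
  id_whiskerRight := (bimodMonoidalAux A).id_whiskerRight
  associator_naturality := (bimodMonoidalAux A).associator_naturality
  leftUnitor_naturality := (bimodMonoidalAux A).leftUnitor_naturality
  rightUnitor_naturality := (bimodMonoidalAux A).rightUnitor_naturality
  pentagon := (bimodMonoidalAux A).pentagon
  triangle := (bimodMonoidalAux A).triangle

section bimodProj

variable {A : Mon C} (P Q R : Bimod A A)

/-- The projection onto the relative tensor product of bimodules. -/
noncomputable def bπ : P.X ⊗ Q.X ⟶ (P ⊗ Q : Bimod A A).X := coequalizer.π _ _

instance : Epi (bπ P Q) := inferInstanceAs (Epi (coequalizer.π _ _))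

instance (Z : C) : Epi (bπ P Q ▷ Z) :=
  inferInstanceAs (Epi ((tensorRight Z).map (coequalizer.π _ _)))

instance (Z : C) : Epi (Z ◁ bπ P Q) :=
  inferInstanceAs (Epi ((tensorLeft Z).map (coequalizer.π _ _)))

variable {P Q R}

lemma bπ_whiskerLeft (f : Q ⟶ R) : bπ P Q ≫ (P ◁ f).hom = P.X ◁ f.hom ≫ bπ P R :=
  Limits.ι_colimMap _ _

lemma bπ_whiskerLeft_assoc (f : Q ⟶ R) {Z : C} (h : (P ⊗ R).X ⟶ Z) :
    bπ P Q ≫ (P ◁ f).hom ≫ h = P.X ◁ f.hom ≫ bπ P R ≫ h := by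
  rw [reassoc_of% (bπ_whiskerLeft (P := P) f)]

lemma bπ_whiskerRight (f : Q ⟶ R) : bπ Q P ≫ (f ▷ P).hom = f.hom ▷ P.X ≫ bπ R P :=
  Limits.ι_colimMap _ _

lemma bπ_whiskerRight_assoc (f : Q ⟶ R) {Z : C} (h : (R ⊗ P).X ⟶ Z) :
    bπ Q P ≫ (f ▷ P).hom ≫ h = f.hom ▷ P.X ≫ bπ R P ≫ h := by
  rw [reassoc_of% (bπ_whiskerRight (P := P) f)]

variable (P Q R)

lemma bπ_leftUnitor : bπ (𝟙_ (Bimod A A)) P ≫ (λ_ P).hom.hom = P.actLeft :=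
  coequalizer.π_desc _ _

lemma bπ_rightUnitor : bπ P (𝟙_ (Bimod A A)) ≫ (ρ_ P).hom.hom = P.actRight :=
  coequalizer.π_desc _ _

lemma bπ_associator : bπ P Q ▷ R.X ≫ bπ (P ⊗ Q) R ≫ (α_ P Q R).hom.hom =
    (α_ P.X Q.X R.X).hom ≫ P.X ◁ bπ Q R ≫ bπ P (Q ⊗ R) := by
  have h1 : bπ (P ⊗ Q) R ≫ (α_ P Q R).hom.hom = Bimod.AssociatorBimod.homAux P Q R :=
    coequalizer.π_desc _ _
  rw [h1]
  exact π_tensor_id_preserves_coequalizer_inv_desc _ _ _ _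

lemma bπ_associator_assoc {Z : C} (h : (P ⊗ Q ⊗ R).X ⟶ Z) :
    bπ P Q ▷ R.X ≫ bπ (P ⊗ Q) R ≫ (α_ P Q R).hom.hom ≫ h =
      (α_ P.X Q.X R.X).hom ≫ P.X ◁ bπ Q R ≫ bπ P (Q ⊗ R) ≫ h := by
  rw [reassoc_of% (bπ_associator (P := P) (Q := Q) (R := R))]

end bimodProj

section tensor

variable {A : Mon C} [IsCommMonObj A.X]

/-- The right module `M ⊗_A N`: the coequalizer of the two maps `M ⊗ A ⊗ N ⟶ M ⊗ N` given by the
right action on `M` and the left action `A ⊗ N ⟶ N ⊗ A ⟶ N` on `N`, with `A` acting on `N`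
from the right. -/
noncomputable def tensorMod (M N : RightMod A) : RightMod A where
  X := coequalizer (M.act ▷ N.X)
    ((α_ M.X A.X N.X).hom ≫ M.X ◁ ((β_ A.X N.X).hom ≫ N.act))
  act := Bimod.TensorBimod.actRight M.toBimod N.toBimod
  act_one := Bimod.TensorBimod.actRight_one' M.toBimod N.toBimod
  act_assoc := Bimod.TensorBimod.right_assoc' M.toBimod N.toBimod

/-- The projection `M ⊗ N ⟶ M ⊗_A N`. -/
noncomputable def πAux (M N : RightMod A) : M.X ⊗ N.X ⟶ (tensorMod M N).X := coequalizer.π _ _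

lemma πAux_condition (M N : RightMod A) : M.act ▷ N.X ≫ πAux M N =
    (α_ M.X A.X N.X).hom ≫ M.X ◁ ((β_ A.X N.X).hom ≫ N.act) ≫ πAux M N := by
  have := coequalizer.condition (M.act ▷ N.X)
    ((α_ M.X A.X N.X).hom ≫ M.X ◁ ((β_ A.X N.X).hom ≫ N.act))
  rw [Category.assoc] at this
  exact this

instance (M N : RightMod A) : Epi (πAux M N) :=
  inferInstanceAs (Epi (coequalizer.π _ _))

instance (M N : RightMod A) (P : C) : Epi (πAux M N ▷ P) :=
  inferInstanceAs (Epi ((tensorRight P).map (coequalizer.π _ _)))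

instance (M N : RightMod A) (P : C) : Epi (P ◁ πAux M N) :=
  inferInstanceAs (Epi ((tensorLeft P).map (coequalizer.π _ _)))

lemma πAux_act (M N : RightMod A) : πAux M N ▷ A.X ≫ (tensorMod M N).act =
    (α_ M.X N.X A.X).hom ≫ M.X ◁ N.act ≫ πAux M N :=
  Bimod.TensorBimod.π_tensor_id_actRight M.toBimod N.toBimod

lemma πAux_actLeft (M N : RightMod A) :
    A.X ◁ πAux M N ≫ (β_ A.X (tensorMod M N).X).hom ≫ (tensorMod M N).act =
    (α_ A.X M.X N.X).inv ≫ ((β_ A.X M.X).hom ≫ M.act) ▷ N.X ≫ πAux M N := by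
  rw [BraidedCategory.braiding_naturality_right_assoc, πAux_act,
    BraidedCategory.braiding_tensor_right_hom]
  simp only [Category.assoc, Iso.inv_hom_id_assoc, comp_whiskerRight, πAux_condition]
  simp

/-- The bimodule attached to `M ⊗_A N` is the relative tensor product of bimodules. -/
noncomputable def μIso (M N : RightMod A) :
    M.toBimod ⊗ N.toBimod ≅ (tensorMod M N).toBimod :=
  Bimod.isoOfIso (Iso.refl (tensorMod M N).X)
   (by
      refine (Category.comp_id _).trans (Eq.trans ?_ (congrArg (· ≫ _)
        (MonoidalCategory.whiskerLeft_id _ _).symm))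
      refine Eq.trans ?_ (Category.id_comp _).symm
      exact (cancel_epi (A.X ◁ πAux M N)).1
        ((Bimod.TensorBimod.whiskerLeft_π_actLeft M.toBimod N.toBimod).trans (πAux_actLeft M N).symm))
   (by
      dsimp only [Iso.refl_hom]
      erw [Category.comp_id, MonoidalCategory.id_whiskerRight, Category.id_comp]
      rfl)

/-- The regular module `A`. -/
def regular (A : Mon C) : RightMod A where
  X := A.X
  act := μ
  act_one := MonObj.mul_one A.X
  act_assoc := MonObj.mul_assoc_flip A.X

noncomputable def εIso (A : Mon C) [IsCommMonObj A.X] :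
    𝟙_ (Bimod A A) ≅ (regular A).toBimod :=
  Bimod.isoOfIso (Iso.refl A.X) 
   (by
      dsimp only [Iso.refl_hom]
      erw [Category.comp_id, MonoidalCategory.whiskerLeft_id, Category.id_comp]
      exact (IsCommMonObj.mul_comm A.X).symm)
   (by
      dsimp only [Iso.refl_hom]
      erw [Category.comp_id, MonoidalCategory.id_whiskerRight, Category.id_comp]
      rfl)

noncomputable instance monoidalStruct : MonoidalCategoryStruct (RightMod A) where
  tensorObj := tensorMod
  tensorUnit := regular A
  whiskerLeft M _ _ f := (toBimodFullyFaithful A).preimage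
    ((μIso _ _).inv ≫ M.toBimod ◁ (toBimodFunctor A).map f ≫ (μIso _ _).hom)
  whiskerRight f N := (toBimodFullyFaithful A).preimage
    ((μIso _ _).inv ≫ (toBimodFunctor A).map f ▷ N.toBimod ≫ (μIso _ _).hom)
  tensorHom f g := (toBimodFullyFaithful A).preimage
    ((μIso _ _).inv ≫ ((toBimodFunctor A).map f ⊗ₘ (toBimodFunctor A).map g) ≫ (μIso _ _).hom)
  associator M N P := (toBimodFullyFaithful A).preimageIso
    (((μIso _ _).symm ≪≫ ((μIso _ _).symm ⊗ᵢ .refl _))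
        ≪≫ α_ M.toBimod N.toBimod P.toBimod
        ≪≫ ((.refl _ ⊗ᵢ μIso _ _) ≪≫ μIso _ _))
  leftUnitor M := (toBimodFullyFaithful A).preimageIso
    (((μIso _ _).symm ≪≫ ((εIso A).symm ⊗ᵢ .refl _)) ≪≫ λ_ M.toBimod)
  rightUnitor M := (toBimodFullyFaithful A).preimageIso
    (((μIso _ _).symm ≪≫ (.refl _ ⊗ᵢ (εIso A).symm)) ≪≫ ρ_ M.toBimod)

/-- Right modules over a commutative algebra form a monoidal category. -/
noncomputable instance monoidal : MonoidalCategory (RightMod A) :=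
  Monoidal.induced (toBimodFunctor A)
    { μIso := μIso
      εIso := εIso A
      whiskerLeft_eq := fun _ _ _ _ => (toBimodFullyFaithful A).map_preimage _
      whiskerRight_eq := fun _ _ => (toBimodFullyFaithful A).map_preimage _
      tensorHom_eq := fun _ _ => (toBimodFullyFaithful A).map_preimage _
      associator_eq := fun _ _ _ => (toBimodFullyFaithful A).map_preimage _
      leftUnitor_eq := fun _ => (toBimodFullyFaithful A).map_preimage _
      rightUnitor_eq := fun _ => (toBimodFullyFaithful A).map_preimage _ }

/-- The projection `M ⊗ N ⟶ M ⊗_A N`. -/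
noncomputable def π (M N : RightMod A) : M.X ⊗ N.X ⟶ (M ⊗ N : RightMod A).X := πAux M N

instance (M N : RightMod A) : Epi (π M N) := inferInstanceAs (Epi (πAux M N))

instance (M N : RightMod A) (P : C) : Epi (π M N ▷ P) := inferInstanceAs (Epi (πAux M N ▷ P))

instance (M N : RightMod A) (P : C) : Epi (P ◁ π M N) := inferInstanceAs (Epi (P ◁ πAux M N))

lemma π_condition (M N : RightMod A) : M.act ▷ N.X ≫ π M N =
    (α_ M.X A.X N.X).hom ≫ M.X ◁ ((β_ A.X N.X).hom ≫ N.act) ≫ π M N :=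
  πAux_condition M N

lemma π_act (M N : RightMod A) : π M N ▷ A.X ≫ (M ⊗ N : RightMod A).act =
    (α_ M.X N.X A.X).hom ≫ M.X ◁ N.act ≫ π M N :=
  πAux_act M N

lemma π_act_assoc (M N : RightMod A) {Z : C} (h : (M ⊗ N).X ⟶ Z) :
    π M N ▷ A.X ≫ (M ⊗ N).act ≫ h = (α_ M.X N.X A.X).hom ≫ M.X ◁ N.act ≫ π M N ≫ h := by
  rw [reassoc_of% (π_act M N)]

/-- Morphisms out of `M ⊗_A N` are balanced morphisms out of `M ⊗ N`. -/
noncomputable def desc {M N : RightMod A} {Z : C} (f : M.X ⊗ N.X ⟶ Z)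
    (h : M.act ▷ N.X ≫ f = (α_ M.X A.X N.X).hom ≫ M.X ◁ ((β_ A.X N.X).hom ≫ N.act) ≫ f) :
    (M ⊗ N : RightMod A).X ⟶ Z :=
  coequalizer.desc f (by rw [h, Category.assoc])

lemma π_desc {M N : RightMod A} {Z : C} (f : M.X ⊗ N.X ⟶ Z) (h) :
    π M N ≫ desc f h = f := coequalizer.π_desc _ _

lemma π_desc_assoc {M N : RightMod A} {Z : C} (f : M.X ⊗ N.X ⟶ Z) (h) {W : C} (g : Z ⟶ W) :
    π M N ≫ desc f h ≫ g = f ≫ g := by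
  rw [reassoc_of% (π_desc f h)]

lemma bπ_μIso_hom (M N : RightMod A) :
    bπ M.toBimod N.toBimod ≫ (μIso M N).hom.hom = π M N := Category.comp_id _

lemma π_μIso_inv (M N : RightMod A) :
    π M N ≫ (μIso M N).inv.hom = bπ M.toBimod N.toBimod := Category.comp_id _

lemma π_μIso_inv_assoc (M N : RightMod A) {Z : C} (h : (M.toBimod ⊗ N.toBimod).X ⟶ Z) :
    π M N ≫ (μIso M N).inv.hom ≫ h = bπ M.toBimod N.toBimod ≫ h :=
  (Category.assoc _ _ _).symm.trans (congrArg (· ≫ h) (π_μIso_inv M N))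

lemma π_whiskerLeft (M : RightMod A) {N P : RightMod A} (f : N ⟶ P) :
    π M N ≫ (M ◁ f).hom = M.X ◁ f.hom ≫ π M P := by
  have h : (M ◁ f).hom = (μIso M N).inv.hom ≫
    (M.toBimod ◁ (toBimodFunctor A).map f).hom ≫ (μIso M P).hom.hom := rfl
  refine (congrArg (π M N ≫ ·) h).trans ((π_μIso_inv_assoc M N _).trans ?_)
  exact (bπ_whiskerLeft_assoc _ _).trans (congrArg _ (bπ_μIso_hom M P))

lemma π_whiskerLeft_assoc (M : RightMod A) {N P : RightMod A} (f : N ⟶ P) {Z : C} (h : (M ⊗ P).X ⟶ Z) :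
    π M N ≫ (M ◁ f).hom ≫ h = M.X ◁ f.hom ≫ π M P ≫ h := by
  rw [reassoc_of% (π_whiskerLeft M f)]

lemma π_whiskerRight {M N : RightMod A} (f : M ⟶ N) (P : RightMod A) :
    π M P ≫ (f ▷ P).hom = f.hom ▷ P.X ≫ π N P := by
  have h : (f ▷ P).hom = (μIso M P).inv.hom ≫
    ((toBimodFunctor A).map f ▷ P.toBimod).hom ≫ (μIso N P).hom.hom := rfl
  refine (congrArg (π M P ≫ ·) h).trans ((π_μIso_inv_assoc M P _).trans ?_)
  exact (bπ_whiskerRight_assoc _ _).trans (congrArg _ (bπ_μIso_hom N P))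

lemma π_whiskerRight_assoc {M N : RightMod A} (f : M ⟶ N) (P : RightMod A) {Z : C} (h : (N ⊗ P).X ⟶ Z) :
    π M P ≫ (f ▷ P).hom ≫ h = f.hom ▷ P.X ≫ π N P ≫ h := by
  rw [reassoc_of% (π_whiskerRight f P)]

lemma π_leftUnitor (M : RightMod A) :
    π (𝟙_ (RightMod A)) M ≫ (λ_ M).hom.hom = (β_ A.X M.X).hom ≫ M.act := by
  have h : (λ_ M).hom.hom = ((μIso (𝟙_ (RightMod A)) M).inv.hom ≫
    ((εIso A).inv ⊗ₘ 𝟙 M.toBimod).hom) ≫ (λ_ M.toBimod).hom.hom := rfl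
  have t : ((εIso A).inv ⊗ₘ 𝟙 M.toBimod) = (εIso A).inv ▷ M.toBimod := tensorHom_id _ _
  refine (congrArg (π (𝟙_ (RightMod A)) M ≫ ·) (h.trans (Category.assoc _ _ _))).trans
    ((π_μIso_inv_assoc (𝟙_ (RightMod A)) M _).trans ?_)
  refine (congrArg (fun q => bπ _ _ ≫ Bimod.Hom.hom q ≫ _) t).trans ?_
  refine (bπ_whiskerRight_assoc _ _).trans ?_
  refine (congrArg _ (bπ_leftUnitor _)).trans ?_
  refine Eq.trans ?_ (Category.id_comp _)
  exact congrArg (· ≫ ((β_ A.X M.X).hom ≫ M.act)) (MonoidalCategory.id_whiskerRight _ _)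

lemma π_rightUnitor (M : RightMod A) :
    π M (𝟙_ (RightMod A)) ≫ (ρ_ M).hom.hom = M.act := by
  have h : (ρ_ M).hom.hom = ((μIso M (𝟙_ (RightMod A))).inv.hom ≫
    (𝟙 M.toBimod ⊗ₘ (εIso A).inv).hom) ≫ (ρ_ M.toBimod).hom.hom := rfl
  have t : (𝟙 M.toBimod ⊗ₘ (εIso A).inv) = M.toBimod ◁ (εIso A).inv := id_tensorHom _ _
  refine (congrArg (π M (𝟙_ (RightMod A)) ≫ ·) (h.trans (Category.assoc _ _ _))).trans
    ((π_μIso_inv_assoc M (𝟙_ (RightMod A)) _).trans ?_)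
  refine (congrArg (fun q => bπ _ _ ≫ Bimod.Hom.hom q ≫ _) t).trans ?_
  refine (bπ_whiskerLeft_assoc _ _).trans ?_
  refine (congrArg _ (bπ_rightUnitor _)).trans ?_
  refine Eq.trans ?_ (Category.id_comp _)
  exact congrArg (· ≫ M.act) (MonoidalCategory.whiskerLeft_id _ _)

lemma π_associator (M N P : RightMod A) :
    π M N ▷ P.X ≫ π (M ⊗ N) P ≫ (α_ M N P).hom.hom =
      (α_ M.X N.X P.X).hom ≫ M.X ◁ π N P ≫ π M (N ⊗ P) := by
  have h : (α_ M N P).hom.hom =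
    ((μIso (M ⊗ N) P).inv.hom ≫ ((μIso M N).inv ⊗ₘ 𝟙 P.toBimod).hom) ≫
    (α_ M.toBimod N.toBimod P.toBimod).hom.hom ≫ (𝟙 M.toBimod ⊗ₘ (μIso N P).hom).hom ≫
      (μIso M (N ⊗ P)).hom.hom := rfl
  have t1 : ((μIso M N).inv ⊗ₘ 𝟙 P.toBimod) = (μIso M N).inv ▷ P.toBimod := tensorHom_id _ _
  have t2 : (𝟙 M.toBimod ⊗ₘ (μIso N P).hom) = M.toBimod ◁ (μIso N P).hom := id_tensorHom _ _
  have h3 : π M N ▷ P.X ≫ (μIso M N).inv.hom ▷ P.X = bπ M.toBimod N.toBimod ▷ P.X :=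
    (comp_whiskerRight _ _ _).symm.trans (congrArg (· ▷ P.X) (π_μIso_inv M N))
  have h5 : M.X ◁ bπ N.toBimod P.toBimod ≫ M.X ◁ (μIso N P).hom.hom = M.X ◁ π N P :=
    (MonoidalCategory.whiskerLeft_comp _ _ _).symm.trans
      (congrArg (M.X ◁ ·) (bπ_μIso_hom N P))
  refine (congrArg (fun q => π M N ▷ P.X ≫ π (M ⊗ N) P ≫ q)
    (h.trans (Category.assoc _ _ _))).trans ?_
  refine (congrArg (π M N ▷ P.X ≫ ·) (π_μIso_inv_assoc (M ⊗ N) P _)).trans ?_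
  refine (congrArg (fun q => π M N ▷ P.X ≫
    bπ (tensorMod M N).toBimod P.toBimod ≫ Bimod.Hom.hom q ≫ _) t1).trans ?_
  refine (congrArg (π M N ▷ P.X ≫ ·) (bπ_whiskerRight_assoc _ _)).trans ?_
  refine (Category.assoc _ _ _).symm.trans ((congrArg (· ≫ _) h3).trans ?_)
  refine (bπ_associator_assoc M.toBimod N.toBimod P.toBimod _).trans ?_
  refine (congrArg (fun q => (α_ M.X N.X P.X).hom ≫ M.X ◁ bπ N.toBimod P.toBimod ≫
    bπ M.toBimod (N.toBimod ⊗ P.toBimod) ≫ Bimod.Hom.hom q ≫ _) t2).trans ?_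
  refine (congrArg (fun t => (α_ M.X N.X P.X).hom ≫ M.X ◁ bπ N.toBimod P.toBimod ≫ t)
    (bπ_whiskerLeft_assoc _ _)).trans ?_
  refine congrArg ((α_ M.X N.X P.X).hom ≫ ·) ?_
  refine (Category.assoc _ _ _).symm.trans ((congrArg (· ≫ _) h5).trans ?_)
  exact congrArg (M.X ◁ π N P ≫ ·) (bπ_μIso_hom M (N ⊗ P))

lemma π_associator_assoc (M N P : RightMod A) {Z : C} (h : (M ⊗ N ⊗ P).X ⟶ Z) :
    π M N ▷ P.X ≫ π (M ⊗ N) P ≫ (α_ M N P).hom.hom ≫ h =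
      (α_ M.X N.X P.X).hom ≫ M.X ◁ π N P ≫ π M (N ⊗ P) ≫ h := by
  rw [reassoc_of% (π_associator M N P)]

lemma π_associator_inv (M N P : RightMod A) :
    M.X ◁ π N P ≫ π M (N ⊗ P) ≫ (α_ M N P).inv.hom =
      (α_ M.X N.X P.X).inv ≫ π M N ▷ P.X ≫ π (M ⊗ N) P := by
  have h : (α_ M N P).hom.hom ≫ (α_ M N P).inv.hom = 𝟙 _ :=
    congrArg Hom.hom (α_ M N P).hom_inv_id
  rw [Iso.eq_inv_comp, ← π_associator_assoc, h, Category.comp_id]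

lemma π_associator_inv_assoc (M N P : RightMod A) {Z : C} (h : ((M ⊗ N) ⊗ P).X ⟶ Z) :
    M.X ◁ π N P ≫ π M (N ⊗ P) ≫ (α_ M N P).inv.hom ≫ h =
      (α_ M.X N.X P.X).inv ≫ π M N ▷ P.X ≫ π (M ⊗ N) P ≫ h := by
  rw [reassoc_of% (π_associator_inv M N P)]

/-- A right module `M` is local if its action is not changed by precomposition with the double
braiding `M ⊗ A ⟶ A ⊗ M ⟶ M ⊗ A`. -/
def isLocal (A : Mon C) : ObjectProperty (RightMod A) := fun M =>
  (β_ M.X A.X).hom ≫ (β_ A.X M.X).hom ≫ M.act = M.act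

lemma braid_act (M N : RightMod A) (hM : isLocal A M) :
    M.X ◁ N.act ≫ (β_ M.X N.X).hom ≫ π N M =
      (α_ _ _ _).inv ≫ (β_ M.X N.X).hom ▷ A.X ≫ (α_ _ _ _).hom ≫ N.X ◁ M.act ≫ π N M := by
  simp only [Category.assoc, BraidedCategory.braiding_naturality_right_assoc, π_condition]
  simp only [BraidedCategory.braiding_tensor_right_hom, Category.assoc, Iso.inv_hom_id_assoc,
    ← MonoidalCategory.whiskerLeft_comp_assoc]
  rw [show (β_ M.X A.X).hom ≫ (β_ A.X M.X).hom ≫ M.act = M.act from hM]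

lemma braid_condition (M N : RightMod A) (hM : isLocal A M) :
    M.act ▷ N.X ≫ (β_ M.X N.X).hom ≫ π N M =
      (α_ M.X A.X N.X).hom ≫ M.X ◁ ((β_ A.X N.X).hom ≫ N.act) ≫ (β_ M.X N.X).hom ≫ π N M := by
  rw [MonoidalCategory.whiskerLeft_comp, Category.assoc, braid_act M N hM,
    BraidedCategory.braiding_naturality_left_assoc, BraidedCategory.braiding_tensor_left_hom]
  simp only [Category.assoc]

lemma braid_inv_condition (M N : RightMod A) (hM : isLocal A M) :
    N.act ▷ M.X ≫ (β_ M.X N.X).inv ≫ π M N =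
      (α_ N.X A.X M.X).hom ≫ N.X ◁ ((β_ A.X M.X).hom ≫ M.act) ≫ (β_ M.X N.X).inv ≫ π M N := by
  rw [← cancel_epi (β_ M.X (N.X ⊗ A.X)).hom]
  have h1 : N.X ◁ M.act ≫ (β_ M.X N.X).inv =
      (β_ (M.X ⊗ A.X) N.X).inv ≫ M.act ▷ N.X := by
    rw [Iso.eq_inv_comp, ← BraidedCategory.braiding_naturality_left_assoc, Iso.hom_inv_id,
      Category.comp_id]
  rw [← BraidedCategory.braiding_naturality_right_assoc, Iso.hom_inv_id_assoc]
  simp only [BraidedCategory.braiding_tensor_right_hom, Category.assoc, Iso.inv_hom_id_assoc,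
    ← MonoidalCategory.whiskerLeft_comp_assoc]
  rw [show (β_ M.X A.X).hom ≫ (β_ A.X M.X).hom ≫ M.act = M.act from hM, reassoc_of% h1,
    π_condition, BraidedCategory.braiding_tensor_left_inv]
  simp

/-- The braiding on `M ⊗_A N`, for a local module `M`, induced by the braiding on `M ⊗ N`. -/
noncomputable def braidIso (M N : RightMod A) (hM : isLocal A M) : M ⊗ N ≅ N ⊗ M where
  hom :=
    { hom := desc ((β_ M.X N.X).hom ≫ π N M) (braid_condition M N hM)
      act_hom := by
        rw [← cancel_epi (π M N ▷ A.X), π_act_assoc, π_desc _ (braid_condition M N hM), braid_act M N hM,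
          Iso.hom_inv_id_assoc, ← comp_whiskerRight_assoc, π_desc _ (braid_condition M N hM),
          comp_whiskerRight_assoc, π_act] }
  inv :=
    { hom := desc ((β_ M.X N.X).inv ≫ π M N) (braid_inv_condition M N hM)
      act_hom := by
        rw [← cancel_epi (π N M ▷ A.X), ← cancel_epi ((β_ M.X N.X).hom ▷ A.X),
          ← cancel_epi (α_ _ _ _).inv]
        rw [π_act_assoc, π_desc _ (braid_inv_condition M N hM)]
        have h := congrArg (· ≫ desc ((β_ M.X N.X).inv ≫ π M N) (braid_inv_condition M N hM))
          (braid_act M N hM)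
        simp only [Category.assoc, π_desc, Iso.hom_inv_id_assoc] at h
        have h2 : (β_ M.X N.X).hom ▷ A.X ≫ ((β_ M.X N.X).inv ≫ π M N) ▷ A.X = π M N ▷ A.X := by
          rw [← comp_whiskerRight, Iso.hom_inv_id_assoc]
        rw [← h, ← comp_whiskerRight_assoc (π N M), π_desc _ (braid_inv_condition M N hM),
          reassoc_of% h2, π_act, Iso.inv_hom_id_assoc] }
  hom_inv_id := by
    ext
    rw [← cancel_epi (π M N), comp_hom, π_desc_assoc _ (braid_condition M N hM), Category.assoc, π_desc,
      Iso.hom_inv_id_assoc, id_hom, Category.comp_id]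
  inv_hom_id := by
    ext
    rw [← cancel_epi (π N M), comp_hom, π_desc_assoc _ (braid_inv_condition M N hM), Category.assoc, π_desc,
      Iso.inv_hom_id_assoc, id_hom, Category.comp_id]

lemma π_braidIso_hom (M N : RightMod A) (hM : isLocal A M) :
    π M N ≫ (braidIso M N hM).hom.hom = (β_ M.X N.X).hom ≫ π N M :=
  π_desc _ (braid_condition M N hM)

lemma π_braidIso_hom_assoc (M N : RightMod A) (hM : isLocal A M) {Z : C} (h : (N ⊗ M).X ⟶ Z) :
    π M N ≫ (braidIso M N hM).hom.hom ≫ h = (β_ M.X N.X).hom ≫ π N M ≫ h := by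
  rw [reassoc_of% (π_braidIso_hom M N hM)]

instance : (isLocal A).IsMonoidal where
  prop_unit := by
    change (β_ A.X A.X).hom ≫ (β_ A.X A.X).hom ≫ μ = μ
    rw [IsCommMonObj.mul_comm, IsCommMonObj.mul_comm]
  prop_tensor M N hM hN := by
    change (β_ (M ⊗ N).X A.X).hom ≫ (β_ A.X (M ⊗ N).X).hom ≫ (M ⊗ N).act = (M ⊗ N).act
    have hM' : (β_ M.X A.X).hom ≫ (β_ A.X M.X).hom ≫ M.act = M.act := hM
    have hN' : (β_ N.X A.X).hom ≫ (β_ A.X N.X).hom ≫ N.act = N.act := hN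
    rw [← cancel_epi (π M N ▷ A.X), BraidedCategory.braiding_naturality_left_assoc,
      BraidedCategory.braiding_naturality_right_assoc, π_act]
    simp only [BraidedCategory.braiding_tensor_left_hom,
      BraidedCategory.braiding_tensor_right_hom, Category.assoc, Iso.inv_hom_id_assoc,
      Iso.hom_inv_id_assoc]
    have h1 := π_condition M N
    rw [MonoidalCategory.whiskerLeft_comp, Category.assoc, ← Iso.inv_comp_eq] at h1
    have hM2 : (β_ M.X A.X).hom ▷ N.X ≫ (β_ A.X M.X).hom ▷ N.X ≫ M.act ▷ N.X = M.act ▷ N.X := by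
      rw [← comp_whiskerRight, ← comp_whiskerRight, hM']
    rw [← h1, Iso.hom_inv_id_assoc, reassoc_of% hM2, h1,
      ← MonoidalCategory.whiskerLeft_comp_assoc, ← MonoidalCategory.whiskerLeft_comp_assoc,
      Category.assoc, hN']

/-- Local modules over a commutative algebra form a braided monoidal category. -/
noncomputable instance braidedLocal : BraidedCategory (isLocal A).FullSubcategory where
  braiding M N := (isLocal A).isoMk (braidIso M.1 N.1 M.2)
  braiding_naturality_right M N P f := by
    ext
    change (M.1 ◁ f.hom).hom ≫ (braidIso M.1 P.1 M.2).hom.hom =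
      (braidIso M.1 N.1 M.2).hom.hom ≫ (f.hom ▷ M.1).hom
    rw [← cancel_epi (π M.1 N.1), π_whiskerLeft_assoc, π_braidIso_hom, π_braidIso_hom_assoc,
      π_whiskerRight, BraidedCategory.braiding_naturality_right_assoc]
  braiding_naturality_left {M N} f P := by
    ext
    change (f.hom ▷ P.1).hom ≫ (braidIso N.1 P.1 N.2).hom.hom =
      (braidIso M.1 P.1 M.2).hom.hom ≫ (P.1 ◁ f.hom).hom
    rw [← cancel_epi (π M.1 P.1), π_whiskerRight_assoc, π_braidIso_hom, π_braidIso_hom_assoc,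
      π_whiskerLeft, BraidedCategory.braiding_naturality_left_assoc]
  hexagon_forward M N P := by
    ext
    change (α_ M.1 N.1 P.1).hom.hom ≫ (braidIso M.1 (N.1 ⊗ P.1) M.2).hom.hom ≫
      (α_ N.1 P.1 M.1).hom.hom = ((braidIso M.1 N.1 M.2).hom ▷ P.1).hom ≫
      (α_ N.1 M.1 P.1).hom.hom ≫ (N.1 ◁ (braidIso M.1 P.1 M.2).hom).hom
    rw [← cancel_epi (π (M.1 ⊗ N.1) P.1), ← cancel_epi (π M.1 N.1 ▷ P.1.X),
      π_associator_assoc, π_braidIso_hom_assoc, π_whiskerRight_assoc,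
      BraidedCategory.braiding_naturality_right_assoc, π_associator,
      ← comp_whiskerRight_assoc, π_braidIso_hom, comp_whiskerRight_assoc,
      π_associator_assoc, π_whiskerLeft, ← MonoidalCategory.whiskerLeft_comp_assoc (N.1.X),
      π_braidIso_hom, MonoidalCategory.whiskerLeft_comp_assoc,
      BraidedCategory.hexagon_forward_assoc]
  hexagon_reverse M N P := by
    ext
    change (α_ M.1 N.1 P.1).inv.hom ≫ (braidIso (M.1 ⊗ N.1) P.1 (M ⊗ N).2).hom.hom ≫
      (α_ P.1 M.1 N.1).inv.hom = (M.1 ◁ (braidIso N.1 P.1 N.2).hom).hom ≫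
      (α_ M.1 P.1 N.1).inv.hom ≫ ((braidIso M.1 P.1 M.2).hom ▷ N.1).hom
    rw [← cancel_epi (π M.1 (N.1 ⊗ P.1)), ← cancel_epi (M.1.X ◁ π N.1 P.1),
      π_associator_inv_assoc, π_braidIso_hom_assoc, π_whiskerLeft_assoc,
      BraidedCategory.braiding_naturality_left_assoc, π_associator_inv,
      ← MonoidalCategory.whiskerLeft_comp_assoc, π_braidIso_hom,
      MonoidalCategory.whiskerLeft_comp_assoc,
      π_associator_inv_assoc, π_whiskerRight, ← comp_whiskerRight_assoc,
      π_braidIso_hom, comp_whiskerRight_assoc,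
      BraidedCategory.hexagon_reverse_assoc]

end tensor

end RightMod
end RightModules

section GradedReps

open CategoryTheory Limits MonoidalCategory TensorProduct

open scoped Classical

attribute [local instance] Fintype.ofFinite

/-- A group `F` acting on a group `G` by automorphisms, together with normalised functions
`γ : F × F × G → kˣ`, `β : F × G × G → kˣ`, `α : G × G × G → kˣ` subject to the
compatibilities which make `γ`-projective `F`-actions on `G`-graded vector spaces into a monoidal
category. -/
structure TwistDatum (k F G : Type u) [Field k] [Group F] [Group G] where
  /-- the action of `F` on `G` -/
  act : F →* MulAut G
  γ : F → F → G → kˣ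
  β : F → G → G → kˣ
  α : G → G → G → kˣ
  γ_one_left : ∀ g x, γ 1 g x = 1
  γ_one_mid : ∀ f x, γ f 1 x = 1
  γ_one_right : ∀ f g, γ f g 1 = 1
  β_one_left : ∀ x y, β 1 x y = 1
  β_one_mid : ∀ f y, β f 1 y = 1
  β_one_right : ∀ f x, β f x 1 = 1
  α_one_left : ∀ y z, α 1 y z = 1
  α_one_mid : ∀ x z, α x 1 z = 1
  α_one_right : ∀ x y, α x y 1 = 1
  γ_cocycle : ∀ f g h x, γ f (g * h) x * γ g h x = γ (f * g) h x * γ f g (act h x)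
  β_γ : ∀ f g x y, β (f * g) x y * γ f g x * γ f g y =
    γ f g (x * y) * β g x y * β f (act g x) (act g y)
  α_β : ∀ f x y z, α x y z * β f (x * y) z * β f x y =
    β f x (y * z) * β f y z * α (act f x) (act f y) (act f z)
  α_cocycle : ∀ x y z w, α y z w * α x (y * z) w * α x y z = α x y (z * w) * α (x * y) z w

variable {k F G : Type u} [Field k] [Group F] [Group G] [Finite G]

/-- Finite-dimensional `G`-graded vector spaces with a `γ`-projective `F`-action. -/
structure GrRep (T : TwistDatum k F G) where
  /-- the underlying vector space -/
  V : Type u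
  [addCommGroup : AddCommGroup V]
  [module : Module k V]
  [finite : Module.Finite k V]
  /-- the homogeneous components -/
  deg : G → Submodule k V
  isInternal : DirectSum.IsInternal deg
  /-- the automorphism of `V` given by an element of `F` -/
  ρ : F → V ≃ₗ[k] V
  map_deg : ∀ f x, (deg x).map (ρ f).toLinearMap = deg (T.act f x)
  ρ_mul : ∀ f g x, ∀ v ∈ deg x, ρ (f * g) v = (T.γ f g x : k) • ρ f (ρ g v)

attribute [instance] GrRep.addCommGroup GrRep.module GrRep.finite

/-- A family of submodules with a system of projections is a direct sum decomposition. -/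
lemma isInternal_of_proj {V : Type u} [AddCommGroup V] [Module k V] (D : G → Submodule k V)
    (p : G → V →ₗ[k] V) (mem : ∀ x v, p x v ∈ D x) (fix : ∀ x, ∀ v ∈ D x, p x v = v)
    (orth : ∀ x y, x ≠ y → ∀ v ∈ D x, p y v = 0) (sum : ∀ v, ∑ x, p x v = v) :
    DirectSum.IsInternal D := by
  rw [DirectSum.isInternal_submodule_iff_iSupIndep_and_iSup_eq_top]
  constructor
  · intro x
    rw [Submodule.disjoint_def]
    intro v hv hv'
    rw [← fix x v hv]
    have : (⨆ j, ⨆ (_ : j ≠ x), D j) ≤ LinearMap.ker (p x) := by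
      refine iSup_le fun j => iSup_le fun hj => ?_
      intro w hw
      exact orth j x hj w hw
    exact this hv'
  · rw [eq_top_iff]
    intro v _
    rw [← sum v]
    exact Submodule.sum_mem _ fun x _ => Submodule.mem_iSup_of_mem x (mem x v)

namespace GrRep

variable {T : TwistDatum k F G} (X Y Z W : GrRep T)

lemma bijective_coe : Function.Bijective (DirectSum.coeLinearMap X.deg) := X.isInternal

/-- The projection onto the component of degree `x`. -/
noncomputable def proj (x : G) : X.V →ₗ[k] X.V :=
  (X.deg x).subtype ∘ₗ DirectSum.component k G (fun x => X.deg x) x ∘ₗ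
    (LinearEquiv.ofBijective (DirectSum.coeLinearMap X.deg) X.bijective_coe).symm.toLinearMap

lemma proj_mem (x : G) (v : X.V) : X.proj x v ∈ X.deg x := by
  simp [proj]

lemma proj_same {x : G} {v : X.V} (h : v ∈ X.deg x) : X.proj x v = v := by
  have : (LinearEquiv.ofBijective (DirectSum.coeLinearMap X.deg) X.bijective_coe).symm v =
    DirectSum.lof k G (fun x => X.deg x) x ⟨v, h⟩ := by
    rw [LinearEquiv.symm_apply_eq]; simp
  simp [proj, this]

lemma proj_ne {x y : G} {v : X.V} (h : v ∈ X.deg x) (hxy : x ≠ y) : X.proj y v = 0 := by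
  have : (LinearEquiv.ofBijective (DirectSum.coeLinearMap X.deg) X.bijective_coe).symm v =
    DirectSum.lof k G (fun x => X.deg x) x ⟨v, h⟩ := by
    rw [LinearEquiv.symm_apply_eq]; simp
  simp [proj, this, DirectSum.component.of, hxy]

lemma iSup_deg : ⨆ x, X.deg x = ⊤ := X.isInternal.submodule_iSup_eq_top

variable {X} in
@[elab_as_elim]
lemma induction {p : X.V → Prop} (v : X.V) (h : ∀ x, ∀ v ∈ X.deg x, p v) (h0 : p 0)
    (hadd : ∀ v w, p v → p w → p (v + w)) : p v :=
  Submodule.iSup_induction X.deg (motive := p) (by rw [X.iSup_deg]; trivial)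
    (fun x v hv => h x v hv) h0 hadd

lemma sum_proj (v : X.V) : ∑ x, X.proj x v = v := by
  induction v using induction with
  | h x v hv =>
    rw [Finset.sum_eq_single x, X.proj_same hv]
    · intro y _ hy; exact X.proj_ne hv hy.symm
    · simp
  | h0 => simp
  | hadd v w hv hw => simp only [map_add, Finset.sum_add_distrib, hv, hw]

lemma ρ_mem {x : G} {v : X.V} (f : F) (h : v ∈ X.deg x) : X.ρ f v ∈ X.deg (T.act f x) := by
  rw [← X.map_deg]; exact ⟨v, h, rfl⟩

lemma ρ_symm_mem {x : G} {v : X.V} (f : F) (h : v ∈ X.deg x) :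
    (X.ρ f).symm v ∈ X.deg (T.act f⁻¹ x) := by
  have : v ∈ X.deg (T.act f (T.act f⁻¹ x)) := by
    rwa [← MulAut.mul_apply, ← map_mul, mul_inv_cancel, map_one]
  rw [← X.map_deg] at this
  obtain ⟨w, hw, rfl⟩ := this
  simpa using hw

/-- It suffices to check one inclusion in the condition `f(V_x) = V_{f(x)}`. -/
lemma map_deg_of_le {V : Type u} [AddCommGroup V] [Module k V] {D : G → Submodule k V}
    (h : DirectSum.IsInternal D) (σ : MulAut G) (e : V ≃ₗ[k] V)
    (he : ∀ x, ∀ v ∈ D x, e v ∈ D (σ x)) (x : G) : (D x).map e.toLinearMap = D (σ x) := by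
  apply le_antisymm
  · rintro _ ⟨v, hv, rfl⟩; exact he x v hv
  · intro w hw
    rw [DirectSum.isInternal_submodule_iff_iSupIndep_and_iSup_eq_top] at h
    obtain ⟨v, rfl⟩ := e.surjective w
    have hv : v ∈ D x ⊔ ⨆ j, ⨆ (_ : j ≠ x), D j := by
      have : D x ⊔ ⨆ j, ⨆ (_ : j ≠ x), D j = ⊤ := by
        rw [eq_top_iff, ← h.2]
        refine iSup_le fun j => ?_
        by_cases hj : j = x
        · subst hj; exact le_sup_left
        · exact (le_iSup₂ (f := fun j (_ : j ≠ x) => D j) j hj).trans le_sup_right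
      rw [this]; trivial
    obtain ⟨a, ha, b, hb, rfl⟩ := Submodule.mem_sup.1 hv
    have hb' : e b ∈ ⨆ j, ⨆ (_ : j ≠ σ x), D j := by
      have : (⨆ j, ⨆ (_ : j ≠ x), D j) ≤
          (⨆ j, ⨆ (_ : j ≠ σ x), D j).comap e.toLinearMap := by
        refine iSup_le fun j => iSup_le fun hj => ?_
        intro v hv
        exact Submodule.mem_iSup_of_mem (σ j) (Submodule.mem_iSup_of_mem
          (by simpa using hj) (he j v hv))
      exact this hb
    have hb'' : e b ∈ D (σ x) := by
      have := (D (σ x)).sub_mem hw (he x a ha)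
      simpa using this
    have : e b = 0 := Submodule.disjoint_def.1 (h.1 (σ x)) _ hb'' hb'
    have : b = 0 := by simpa using this
    subst this
    exact ⟨a, ha, by simp⟩

lemma ρ_one (v : X.V) : X.ρ 1 v = v := by
  induction v using induction with
  | h x v hv =>
    have := X.ρ_mul 1 1 x v hv
    rw [T.γ_one_left, mul_one] at this
    simpa using this.symm
  | h0 => simp
  | hadd v w hv hw => simp only [map_add, hv, hw]

/-- Morphisms are graded linear maps commuting with the actions. -/
@[ext]
structure Hom where
  /-- the underlying linear map -/
  toLin : X.V →ₗ[k] Y.V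
  map_mem : ∀ x, ∀ v ∈ X.deg x, toLin v ∈ Y.deg x
  comm : ∀ f v, toLin (X.ρ f v) = Y.ρ f (toLin v)

instance : Category (GrRep T) where
  Hom X Y := Hom X Y
  id X := ⟨LinearMap.id, fun _ _ h => h, fun _ _ => rfl⟩
  comp f g := ⟨g.toLin ∘ₗ f.toLin, fun x v h => g.map_mem x _ (f.map_mem x v h), fun a v => by
    simp [f.comm, g.comm]⟩

variable {X Y Z W}

@[ext]
lemma hom_ext (f g : X ⟶ Y) (h : f.toLin = g.toLin) : f = g := Hom.ext h

@[simp] lemma id_toLin : (𝟙 X : Hom X X).toLin = LinearMap.id := rfl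
@[simp] lemma comp_toLin (f : X ⟶ Y) (g : Y ⟶ Z) :
    (f ≫ g : Hom X Z).toLin = g.toLin ∘ₗ f.toLin := rfl

/-- An isomorphism from a graded equivariant linear equivalence. -/
def isoMk (e : X.V ≃ₗ[k] Y.V) (h : ∀ x, ∀ v ∈ X.deg x, e v ∈ Y.deg x)
    (hc : ∀ f, e.toLinearMap ∘ₗ (X.ρ f).toLinearMap = (Y.ρ f).toLinearMap ∘ₗ e.toLinearMap) :
    X ≅ Y :=
  have hc' : ∀ f v, e (X.ρ f v) = Y.ρ f (e v) := fun f v => LinearMap.congr_fun (hc f) v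
  { hom := ⟨e.toLinearMap, h, hc'⟩
    inv := ⟨e.symm.toLinearMap, fun x v hv => by
      have h1 : ∀ (y : G) (u : X.V), e (X.proj y u) = Y.proj y (e u) := fun y u => by
        induction u using induction with
        | h z u hu =>
          by_cases hz : z = y
          · subst hz; rw [X.proj_same hu, Y.proj_same (h _ _ hu)]
          · rw [X.proj_ne hu hz, Y.proj_ne (h _ _ hu) hz, map_zero]
        | h0 => simp
        | hadd v w hv hw => simp only [map_add, hv, hw]
      have h2 : e.symm v = X.proj x (e.symm v) := by
        apply e.injective
        rw [h1, e.apply_symm_apply, Y.proj_same hv]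
      change e.symm v ∈ _
      rw [h2]; exact X.proj_mem _ _, fun f v => by
      apply e.injective
      simp [hc']⟩
    hom_inv_id := by ext v; simp
    inv_hom_id := by ext v; simp }

@[simp] lemma isoMk_hom_toLin (e : X.V ≃ₗ[k] Y.V) (h) (hc) :
    Hom.toLin (isoMk e h hc).hom = e.toLinearMap := rfl
@[simp] lemma isoMk_inv_toLin (e : X.V ≃ₗ[k] Y.V) (h) (hc) :
    Hom.toLin (isoMk e h hc).inv = e.symm.toLinearMap := rfl

section tensor

variable (X Y Z)

/-- The operator on `X ⊗ Y` which multiplies `X_x ⊗ Y_y` by the scalar `c x y`. -/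
noncomputable def twist (c : G → G → k) : X.V ⊗[k] Y.V →ₗ[k] X.V ⊗[k] Y.V :=
  ∑ x, ∑ y, c x y • TensorProduct.map (X.proj x) (Y.proj y)

variable {X Y Z}

lemma twist_tmul (c : G → G → k) {x y : G} {u : X.V} {v : Y.V} (hu : u ∈ X.deg x)
    (hv : v ∈ Y.deg y) : twist X Y c (u ⊗ₜ v) = c x y • u ⊗ₜ[k] v := by
  simp only [twist, LinearMap.sum_apply, LinearMap.smul_apply, TensorProduct.map_tmul]
  rw [Finset.sum_eq_single x, Finset.sum_eq_single y, X.proj_same hu, Y.proj_same hv]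
  · intro y' _ hy; rw [Y.proj_ne hv hy.symm]; simp
  · simp
  · intro x' _ hx; simp [X.proj_ne hu hx.symm]
  · simp

/-- Linear maps out of `X ⊗ Y` are determined by their values on homogeneous pure tensors. -/
lemma tensor_ext {M : Type u} [AddCommGroup M] [Module k M] {f g : X.V ⊗[k] Y.V →ₗ[k] M}
    (h : ∀ x, ∀ u ∈ X.deg x, ∀ y, ∀ v ∈ Y.deg y, f (u ⊗ₜ v) = g (u ⊗ₜ v)) : f = g := by
  apply TensorProduct.ext'
  intro u v
  induction u using induction with
  | h x u hu =>
    induction v using induction with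
    | h y v hv => exact h x u hu y v hv
    | h0 => simp
    | hadd v w hv hw => simp only [TensorProduct.tmul_add, map_add, hv, hw]
  | h0 => simp
  | hadd v w hv hw => simp only [TensorProduct.add_tmul, map_add, hv, hw]

variable (X Y) in
/-- Multiplication of `X_x ⊗ Y_y` by the unit `c x y`. -/
noncomputable def twistEquiv (c : G → G → kˣ) : X.V ⊗[k] Y.V ≃ₗ[k] X.V ⊗[k] Y.V :=
  LinearEquiv.ofLinearMap (twist X Y fun x y => (c x y : k)) (twist X Y fun x y => ((c x y)⁻¹ : kˣ))
    (tensor_ext fun x u hu y v hv => by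
      simp [twist_tmul _ hu hv, smul_smul])
    (tensor_ext fun x u hu y v hv => by
      simp [twist_tmul _ hu hv, smul_smul])

lemma twistEquiv_tmul (c : G → G → kˣ) {x y : G} {u : X.V} {v : Y.V} (hu : u ∈ X.deg x)
    (hv : v ∈ Y.deg y) : twistEquiv X Y c (u ⊗ₜ v) = (c x y : k) • u ⊗ₜ[k] v :=
  twist_tmul _ hu hv

variable (X Y) in
/-- The component of degree `z` of `X ⊗ Y` is the sum of the `X_x ⊗ Y_y` with `x y = z`. -/
def tensorDeg (z : G) : Submodule k (X.V ⊗[k] Y.V) :=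
  Submodule.span k {t | ∃ x y, x * y = z ∧ ∃ u ∈ X.deg x, ∃ v ∈ Y.deg y, t = u ⊗ₜ v}

lemma tmul_mem {x y : G} {u : X.V} {v : Y.V} (hu : u ∈ X.deg x) (hv : v ∈ Y.deg y) :
    u ⊗ₜ v ∈ tensorDeg X Y (x * y) :=
  Submodule.subset_span ⟨x, y, rfl, u, hu, v, hv, rfl⟩

lemma tensorDeg_le {M : Type u} [AddCommGroup M] [Module k M] {f : X.V ⊗[k] Y.V →ₗ[k] M}
    {z : G} {N : Submodule k M}
    (h : ∀ x y, x * y = z → ∀ u ∈ X.deg x, ∀ v ∈ Y.deg y, f (u ⊗ₜ v) ∈ N) :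
    ∀ t ∈ tensorDeg X Y z, f t ∈ N := by
  change tensorDeg X Y z ≤ N.comap f
  rw [tensorDeg, Submodule.span_le]
  rintro _ ⟨x, y, hxy, u, hu, v, hv, rfl⟩
  exact h x y hxy u hu v hv

lemma tensorDeg_eq {M : Type u} [AddCommGroup M] [Module k M] {f g : X.V ⊗[k] Y.V →ₗ[k] M}
    {z : G}
    (h : ∀ x y, x * y = z → ∀ u ∈ X.deg x, ∀ v ∈ Y.deg y, f (u ⊗ₜ v) = g (u ⊗ₜ v)) :
    ∀ t ∈ tensorDeg X Y z, f t = g t := by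
  intro t ht
  have := tensorDeg_le (f := f - g) (N := ⊥) (fun x y hxy u hu v hv => by
    simp [h x y hxy u hu v hv]) t ht
  simpa [sub_eq_zero] using this

lemma tensorDeg_isInternal : DirectSum.IsInternal (tensorDeg X Y) := by
  have key : ∀ z x y : G, ∀ u ∈ X.deg x, ∀ v ∈ Y.deg y,
      twist X Y (fun x y => if x * y = z then 1 else 0) (u ⊗ₜ v) =
        if x * y = z then u ⊗ₜ[k] v else 0 := fun z x y u hu v hv => by
    rw [twist_tmul _ hu hv]; split_ifs <;> simp
  refine isInternal_of_proj _
    (fun z => twist X Y (fun x y => if x * y = z then 1 else 0)) ?_ ?_ ?_ ?_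
  · intro z t
    induction t using TensorProduct.induction_on with
    | zero => simp
    | add s t hs ht => rw [map_add]; exact Submodule.add_mem _ hs ht
    | tmul u v =>
      induction u using induction with
      | h x u hu =>
        induction v using induction with
        | h y v hv =>
          rw [key z x y u hu v hv]
          split_ifs with hz
          · rw [← hz]; exact tmul_mem hu hv
          · simp
        | h0 => simp
        | hadd v w hv hw =>
          rw [TensorProduct.tmul_add, map_add]; exact Submodule.add_mem _ hv hw
      | h0 => simp
      | hadd v w hv hw =>
        rw [TensorProduct.add_tmul, map_add]; exact Submodule.add_mem _ hv hw
  · intro z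
    refine tensorDeg_eq (g := LinearMap.id) fun x y hxy u hu v hv => ?_
    rw [key z x y u hu v hv, if_pos hxy]; rfl
  · intro z z' hz
    refine tensorDeg_eq (g := 0) fun x y hxy u hu v hv => ?_
    rw [key z' x y u hu v hv, if_neg (by rw [hxy]; exact hz)]; rfl
  · have : ∑ z, twist X Y (fun x y => if x * y = z then 1 else 0) = LinearMap.id :=
      tensor_ext fun x u hu y v hv => by
        rw [LinearMap.sum_apply, Finset.sum_eq_single (x * y), key _ x y u hu v hv, if_pos rfl]
        · rfl
        · intro z _ hz; rw [key _ x y u hu v hv, if_neg hz.symm]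
        · simp
    intro t
    rw [← LinearMap.sum_apply, this]; rfl

variable (X Y) in
/-- The tensor product, with the action `f(u ⊗ v) = β(f|x,y) f(u) ⊗ f(v)` on `X_x ⊗ Y_y`. -/
noncomputable def tensor : GrRep T where
  V := X.V ⊗[k] Y.V
  deg := tensorDeg X Y
  isInternal := tensorDeg_isInternal
  ρ f := twistEquiv X Y (T.β f) ≪≫ₗ TensorProduct.congr (X.ρ f) (Y.ρ f)
  map_deg f := map_deg_of_le tensorDeg_isInternal _ _ fun z => by
    refine tensorDeg_le (f := ((twistEquiv X Y (T.β f) ≪≫ₗ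
      TensorProduct.congr (X.ρ f) (Y.ρ f)) : X.V ⊗[k] Y.V →ₗ[k] X.V ⊗[k] Y.V))
      fun x y hxy u hu v hv => ?_
    simp only [LinearEquiv.coe_coe, LinearEquiv.trans_apply, twistEquiv_tmul _ hu hv, map_smul,
      TensorProduct.congr_tmul, ← hxy, map_mul]
    exact Submodule.smul_mem _ _ (tmul_mem (X.ρ_mem f hu) (Y.ρ_mem f hv))
  ρ_mul f g z := by
    refine tensorDeg_eq (f := ((twistEquiv X Y (T.β (f * g)) ≪≫ₗ
      TensorProduct.congr (X.ρ (f * g)) (Y.ρ (f * g))) : X.V ⊗[k] Y.V →ₗ[k] X.V ⊗[k] Y.V))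
      (g := (T.γ f g z : k) • ((twistEquiv X Y (T.β g) ≪≫ₗ
      TensorProduct.congr (X.ρ g) (Y.ρ g)) ≪≫ₗ (twistEquiv X Y (T.β f) ≪≫ₗ
      TensorProduct.congr (X.ρ f) (Y.ρ f))).toLinearMap)
      fun x y hxy u hu v hv => ?_
    simp only [LinearEquiv.coe_coe, LinearEquiv.trans_apply, twistEquiv_tmul _ hu hv, map_smul,
      TensorProduct.congr_tmul, LinearMap.smul_apply, X.ρ_mul f g x u hu, Y.ρ_mul f g y v hv,
      twistEquiv_tmul _ (X.ρ_mem g hu) (Y.ρ_mem g hv), TensorProduct.smul_tmul_smul, smul_smul]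
    congr 1
    have := congrArg Units.val (T.β_γ f g x y)
    simp only [Units.val_mul] at this
    rw [← hxy]
    linear_combination this

/-- The pure tensor `u ⊗ v`, as an element of the tensor product of graded representations. -/
def tm (u : X.V) (v : Y.V) : (tensor X Y).V := u ⊗ₜ[k] v

lemma tm_smul (c : k) (u : X.V) (v : Y.V) : tm u (c • v) = c • tm u v :=
  TensorProduct.tmul_smul c u v

lemma smul_tm (c : k) (u : X.V) (v : Y.V) : tm (c • u) v = c • tm u v :=
  (TensorProduct.smul_tmul' c u v).symm

lemma tm_zero (u : X.V) : tm u (0 : Y.V) = 0 := TensorProduct.tmul_zero _ _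

lemma zero_tm (v : Y.V) : tm (0 : X.V) v = 0 := TensorProduct.zero_tmul _ _

lemma tm_mem {x y : G} {u : X.V} {v : Y.V} (hu : u ∈ X.deg x) (hv : v ∈ Y.deg y) :
    tm u v ∈ (tensor X Y).deg (x * y) := tmul_mem hu hv

lemma ρ_tm (f : F) {x y : G} {u : X.V} {v : Y.V} (hu : u ∈ X.deg x) (hv : v ∈ Y.deg y) :
    (tensor X Y).ρ f (tm u v) = (T.β f x y : k) • tm (X.ρ f u) (Y.ρ f v) := by
  change TensorProduct.congr (X.ρ f) (Y.ρ f) (twistEquiv X Y (T.β f) (u ⊗ₜ v)) = _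
  simp only [twistEquiv_tmul _ hu hv, map_smul, TensorProduct.congr_tmul]
  rfl

lemma tm_ext {M : Type u} [AddCommGroup M] [Module k M] {f g : (tensor X Y).V →ₗ[k] M}
    (h : ∀ x, ∀ u ∈ X.deg x, ∀ y, ∀ v ∈ Y.deg y, f (tm u v) = g (tm u v)) : f = g :=
  tensor_ext h

variable (X Y) in
/-- `u ⊗ v` as a bilinear map. -/
def tmₗ : X.V →ₗ[k] Y.V →ₗ[k] (tensor X Y).V := TensorProduct.mk k X.V Y.V

lemma tm_ext₃ {M : Type u} [AddCommGroup M] [Module k M]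
    {f g : (tensor (tensor X Y) Z).V →ₗ[k] M}
    (h : ∀ x, ∀ u ∈ X.deg x, ∀ y, ∀ v ∈ Y.deg y, ∀ z, ∀ w ∈ Z.deg z,
      f (tm (tm u v) w) = g (tm (tm u v) w)) : f = g := by
  refine tm_ext fun s p _ z w hw => ?_
  have : f ∘ₗ (tmₗ (tensor X Y) Z).flip w = g ∘ₗ (tmₗ (tensor X Y) Z).flip w :=
    tm_ext fun x u hu y v hv => h x u hu y v hv z w hw
  exact LinearMap.congr_fun this p

lemma tm_ext₄ {M : Type u} [AddCommGroup M] [Module k M]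
    {f g : (tensor (tensor (tensor X Y) Z) W).V →ₗ[k] M}
    (h : ∀ x, ∀ u ∈ X.deg x, ∀ y, ∀ v ∈ Y.deg y, ∀ z, ∀ w ∈ Z.deg z, ∀ t, ∀ s ∈ W.deg t,
      f (tm (tm (tm u v) w) s) = g (tm (tm (tm u v) w) s)) : f = g := by
  refine tm_ext fun _ p _ t s hs => ?_
  have : f ∘ₗ (tmₗ (tensor (tensor X Y) Z) W).flip s =
      g ∘ₗ (tmₗ (tensor (tensor X Y) Z) W).flip s :=
    tm_ext₃ fun x u hu y v hv z w hw => h x u hu y v hv z w hw t s hs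
  exact LinearMap.congr_fun this p

lemma tm_le {M : Type u} [AddCommGroup M] [Module k M] {f : (tensor X Y).V →ₗ[k] M}
    {N : G → Submodule k M}
    (h : ∀ x, ∀ u ∈ X.deg x, ∀ y, ∀ v ∈ Y.deg y, f (tm u v) ∈ N (x * y)) (z : G) :
    ∀ t ∈ (tensor X Y).deg z, f t ∈ N z :=
  tensorDeg_le fun x y hxy u hu v hv => hxy ▸ h x u hu y v hv

lemma tm_le₃ {M : Type u} [AddCommGroup M] [Module k M]
    {f : (tensor (tensor X Y) Z).V →ₗ[k] M} {N : G → Submodule k M}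
    (h : ∀ x, ∀ u ∈ X.deg x, ∀ y, ∀ v ∈ Y.deg y, ∀ z, ∀ w ∈ Z.deg z,
      f (tm (tm u v) w) ∈ N (x * y * z)) (z : G) :
    ∀ t ∈ (tensor (tensor X Y) Z).deg z, f t ∈ N z := by
  refine tm_le (X := tensor X Y) (f := f) (N := N) (fun s p hp z w hw => ?_) z
  exact tm_le (X := X) (Y := Y) (f := f ∘ₗ (tmₗ (tensor X Y) Z).flip w)
    (N := fun s => N (s * z)) (fun x u hu y v hv => h x u hu y v hv z w hw) s p hp

variable (T) in
/-- A finite-dimensional representation of `F`, placed in degree `1`. -/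
noncomputable def ofRep (U : Type u) [AddCommGroup U] [Module k U] [Module.Finite k U]
    (σ : F →* (U ≃ₗ[k] U)) : GrRep T where
  V := U
  deg x :=
    { carrier := {v | x ≠ 1 → v = 0}
      add_mem' := fun ha hb hx => by rw [ha hx, hb hx, add_zero]
      zero_mem' := fun _ => rfl
      smul_mem' := fun c v hv hx => by rw [hv hx, smul_zero] }
  isInternal := isInternal_of_proj _ (fun x => if x = 1 then LinearMap.id else 0)
    (fun x v hx => by rw [if_neg hx]; rfl)
    (fun x v hv => by
      by_cases hx : x = 1
      · rw [if_pos hx]; rfl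
      · rw [hv hx, map_zero])
    (fun x y hxy v hv => by
      by_cases hy : y = 1
      · rw [hv (fun h => hxy (h.trans hy.symm)), map_zero]
      · rw [if_neg hy]; rfl)
    (fun v => by
      rw [Finset.sum_eq_single 1]
      · simp
      · intro x _ hx; simp [hx]
      · simp)
  ρ f := σ f
  map_deg f x := by
    ext v
    constructor
    · rintro ⟨w, hw, rfl⟩ hx
      have : w = 0 := hw (fun h => hx (by simp [h]))
      simp [this]
    · intro hv
      refine ⟨(σ f).symm v, fun hx => ?_, by simp⟩
      have : v = 0 := hv (by simpa using hx)
      simp [this]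
  ρ_mul f g x v hv := by
    by_cases hx : x = 1
    · simp [hx, T.γ_one_right]
    · rw [hv hx]; simp

lemma mem_ofRep_deg {U : Type u} [AddCommGroup U] [Module k U] [Module.Finite k U]
    {σ : F →* (U ≃ₗ[k] U)} {x : G} {v : U} :
    v ∈ (ofRep T U σ).deg x ↔ (x ≠ 1 → v = 0) := Iff.rfl

variable (T) in
/-- The unit object: the field `k` in degree `1` with trivial action. -/
noncomputable def unit : GrRep T := ofRep T k 1

/-- The tensor product of two linear maps. -/
def tmMap {X' Y' : GrRep T} (f : X.V →ₗ[k] X'.V) (g : Y.V →ₗ[k] Y'.V) :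
    (tensor X Y).V →ₗ[k] (tensor X' Y').V := TensorProduct.map f g

lemma tmMap_tm {X' Y' : GrRep T} (f : X.V →ₗ[k] X'.V) (g : Y.V →ₗ[k] Y'.V) (u : X.V) (v : Y.V) :
    tmMap f g (tm u v) = tm (f u) (g v) := rfl

variable (X Y) in
/-- Multiplication of `X_x ⊗ Y_y` by the scalar `c x y`. -/
noncomputable def tmTwist (c : G → G → k) : (tensor X Y).V →ₗ[k] (tensor X Y).V := twist X Y c

lemma tmTwist_tm (c : G → G → k) {x y : G} {u : X.V} {v : Y.V}
    (hu : u ∈ X.deg x) (hv : v ∈ Y.deg y) : tmTwist X Y c (tm u v) = c x y • tm u v :=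
  twist_tmul _ hu hv

/-- Multiplication of `X_x ⊗ Y_y ⊗ Z_z` by the scalar `c x y z`. -/
noncomputable def twist₃ (X Y Z : GrRep T) (c : G → G → G → k) :
    (tensor (tensor X Y) Z).V →ₗ[k] (tensor (tensor X Y) Z).V :=
  ∑ z, tmMap (tmTwist X Y fun x y => c x y z) (Z.proj z)

lemma twist₃_tm (c : G → G → G → k) {x y z : G} {u : X.V} {v : Y.V} {w : Z.V}
    (hu : u ∈ X.deg x) (hv : v ∈ Y.deg y) (hw : w ∈ Z.deg z) :
    twist₃ X Y Z c (tm (tm u v) w) = c x y z • tm (tm u v) w := by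
  rw [twist₃, LinearMap.sum_apply, Finset.sum_eq_single z]
  · rw [tmMap_tm, Z.proj_same hw, ← smul_tm]
    rw [tmTwist_tm _ hu hv]
  · intro z' _ hz
    rw [tmMap_tm, Z.proj_ne hw hz.symm, tm_zero]
  · simp

variable (X Y Z) in
/-- The linear map `(u ⊗ v) ⊗ w ↦ α(x,y,z)⁻¹ u ⊗ (v ⊗ w)`. -/
noncomputable def assocEquiv : (tensor (tensor X Y) Z).V ≃ₗ[k] (tensor X (tensor Y Z)).V :=
  LinearEquiv.ofLinearMap
    (twist₃ X Y Z fun x y z => ((T.α x y z)⁻¹ : kˣ)) (twist₃ X Y Z fun x y z => (T.α x y z : k))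
    (tm_ext₃ fun x u hu y v hv z w hw => by
      simp [twist₃_tm _ hu hv hw, smul_smul])
    (tm_ext₃ fun x u hu y v hv z w hw => by
      simp [twist₃_tm _ hu hv hw, smul_smul]) ≪≫ₗ TensorProduct.assoc k X.V Y.V Z.V

lemma assocEquiv_tm {x y z : G} {u : X.V} {v : Y.V} {w : Z.V}
    (hu : u ∈ X.deg x) (hv : v ∈ Y.deg y) (hw : w ∈ Z.deg z) :
    assocEquiv X Y Z (tm (tm u v) w) = (((T.α x y z)⁻¹ : kˣ) : k) • tm u (tm v w) := by
  change TensorProduct.assoc k X.V Y.V Z.V (twist₃ X Y Z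
    (fun x y z => ((T.α x y z)⁻¹ : kˣ)) (tm (tm u v) w)) = _
  rw [twist₃_tm _ hu hv hw]
  exact map_smul (TensorProduct.assoc k X.V Y.V Z.V) _ _

variable (X Y Z) in
/-- The associativity constraint; its inverse is `u ⊗ (v ⊗ w) ↦ α(x,y,z) (u ⊗ v) ⊗ w`. -/
noncomputable def assocIso : tensor (tensor X Y) Z ≅ tensor X (tensor Y Z) :=
  isoMk (assocEquiv X Y Z)
    (tm_le₃ (f := (assocEquiv X Y Z).toLinearMap) fun x u hu y v hv z w hw => by
      rw [LinearEquiv.coe_coe, assocEquiv_tm hu hv hw, mul_assoc]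
      exact Submodule.smul_mem _ _ (tm_mem hu (tm_mem hv hw)))
    (fun f => tm_ext₃ fun x u hu y v hv z w hw => by
      simp only [LinearMap.comp_apply, LinearEquiv.coe_coe, ρ_tm f (tm_mem hu hv) hw,
        ρ_tm f hu hv, assocEquiv_tm hu hv hw, map_smul, ρ_tm f hu (tm_mem hv hw), ρ_tm f hv hw,
        tm_smul, smul_tm, smul_smul,
        assocEquiv_tm (X.ρ_mem f hu) (Y.ρ_mem f hv) (Z.ρ_mem f hw)]
      congr 1
      have : T.β f (x * y) z * T.β f x y * (T.α (T.act f x) (T.act f y) (T.act f z))⁻¹ =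
          (T.α x y z)⁻¹ * T.β f x (y * z) * T.β f y z := by
        rw [mul_inv_eq_iff_eq_mul, mul_assoc, mul_assoc, ← mul_assoc (T.β f x (y * z)),
          ← T.α_β f x y z]
        simp [mul_assoc]
      have := congrArg Units.val this
      simpa only [Units.val_mul, mul_assoc] using this)

lemma assocIso_hom_tm {x y z : G} {u : X.V} {v : Y.V} {w : Z.V}
    (hu : u ∈ X.deg x) (hv : v ∈ Y.deg y) (hw : w ∈ Z.deg z) :
    Hom.toLin (assocIso X Y Z).hom (tm (tm u v) w) =
      (((T.α x y z)⁻¹ : kˣ) : k) • tm u (tm v w) := assocEquiv_tm hu hv hw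

/-- The tensor product of morphisms, as a linear map. -/
noncomputable def tensorLin {X' Y' : GrRep T} (f : X ⟶ X') (g : Y ⟶ Y') :
    (tensor X Y).V →ₗ[k] (tensor X' Y').V := TensorProduct.map f.toLin g.toLin

lemma tensorLin_tm {X' Y' : GrRep T} (f : X ⟶ X') (g : Y ⟶ Y') (u : X.V) (v : Y.V) :
    tensorLin f g (tm u v) = tm (f.toLin u) (g.toLin v) := rfl

/-- The tensor product of morphisms. -/
noncomputable def tensorMap {X' Y' : GrRep T} (f : X ⟶ X') (g : Y ⟶ Y') :
    tensor X Y ⟶ tensor X' Y' where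
  toLin := tensorLin f g
  map_mem := tm_le (f := tensorLin f g)
    fun x u hu y v hv => tm_mem (f.map_mem x u hu) (g.map_mem y v hv)
  comm a t := by
    have : tensorLin f g ∘ₗ ((tensor X Y).ρ a).toLinearMap =
        ((tensor X' Y').ρ a).toLinearMap ∘ₗ tensorLin f g :=
      tm_ext fun x u hu y v hv => by
        simp only [LinearMap.comp_apply, LinearEquiv.coe_coe, ρ_tm a hu hv, map_smul, tensorLin_tm,
          ρ_tm a (f.map_mem x u hu) (g.map_mem y v hv), f.comm, g.comm]
    exact LinearMap.congr_fun this t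

lemma tensorMap_tm {X' Y' : GrRep T} (f : X ⟶ X') (g : Y ⟶ Y') (u : X.V) (v : Y.V) :
    (tensorMap f g).toLin (tm u v) = tm (f.toLin u) (g.toLin v) := rfl

variable (T) in
/-- The generator of the unit object. -/
def one : (unit T).V := (1 : k)

lemma one_mem : one T ∈ (unit T).deg 1 := fun h => absurd rfl h

lemma ρ_one_elem (f : F) : (unit T).ρ f (one T) = one T := rfl

lemma mem_unit {x : G} {c : (unit T).V} (h : c ∈ (unit T).deg x) :
    ∃ a : k, c = a • one T ∧ (x = 1 ∨ a = 0) := by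
  refine ⟨(show k from c), (@mul_one k _ c).symm, ?_⟩
  by_cases hx : x = 1
  · exact Or.inl hx
  · exact Or.inr (h hx)

lemma unit_tm_ext {M : Type u} [AddCommGroup M] [Module k M]
    {f g : (tensor (unit T) X).V →ₗ[k] M}
    (h : ∀ x, ∀ u ∈ X.deg x, f (tm (one T) u) = g (tm (one T) u)) : f = g :=
  tm_ext fun y c hc x u hu => by
    obtain ⟨a, rfl, -⟩ := mem_unit hc
    rw [smul_tm, map_smul, map_smul, h x u hu]

lemma tm_unit_ext {M : Type u} [AddCommGroup M] [Module k M]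
    {f g : (tensor X (unit T)).V →ₗ[k] M}
    (h : ∀ x, ∀ u ∈ X.deg x, f (tm u (one T)) = g (tm u (one T))) : f = g :=
  tm_ext fun x u hu y c hc => by
    obtain ⟨a, rfl, -⟩ := mem_unit hc
    rw [tm_smul, map_smul, map_smul, h x u hu]

variable (X) in
/-- The left unit constraint, as a linear map. -/
noncomputable def lidEquiv : (tensor (unit T) X).V ≃ₗ[k] X.V := TensorProduct.lid k X.V

variable (X) in
/-- The right unit constraint, as a linear map. -/
noncomputable def ridEquiv : (tensor X (unit T)).V ≃ₗ[k] X.V := TensorProduct.rid k X.V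

lemma lidEquiv_tm (v : X.V) : lidEquiv X (tm (one T) v) = v := TensorProduct.lid_tmul v 1 |>.trans
  (one_smul k v)

lemma ridEquiv_tm (v : X.V) : ridEquiv X (tm v (one T)) = v := TensorProduct.rid_tmul v 1 |>.trans
  (one_smul k v)

variable (X) in
/-- The left unit constraint. -/
noncomputable def leftUnitorIso : tensor (unit T) X ≅ X :=
  isoMk (lidEquiv X)
    (tm_le (f := (lidEquiv X).toLinearMap) fun x c hc y v hv => by
      obtain ⟨a, rfl, h⟩ := mem_unit hc
      rw [smul_tm, map_smul, LinearEquiv.coe_coe, lidEquiv_tm]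
      rcases h with rfl | rfl
      · rw [one_mul]; exact Submodule.smul_mem _ _ hv
      · rw [zero_smul]; exact Submodule.zero_mem _)
    (fun f => unit_tm_ext fun y v hv => by
      simp only [LinearMap.comp_apply, LinearEquiv.coe_coe, ρ_tm f one_mem hv, T.β_one_mid,
        Units.val_one, one_smul, ρ_one_elem, lidEquiv_tm])

variable (X) in
/-- The right unit constraint. -/
noncomputable def rightUnitorIso : tensor X (unit T) ≅ X :=
  isoMk (ridEquiv X)
    (tm_le (f := (ridEquiv X).toLinearMap) fun y v hv x c hc => by
      obtain ⟨a, rfl, h⟩ := mem_unit hc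
      rw [tm_smul, map_smul, LinearEquiv.coe_coe, ridEquiv_tm]
      rcases h with rfl | rfl
      · rw [mul_one]; exact Submodule.smul_mem _ _ hv
      · rw [zero_smul]; exact Submodule.zero_mem _)
    (fun f => tm_unit_ext fun y v hv => by
      simp only [LinearMap.comp_apply, LinearEquiv.coe_coe, ρ_tm f hv one_mem, T.β_one_right,
        Units.val_one, one_smul, ρ_one_elem, ridEquiv_tm])

lemma leftUnitorIso_tm (v : X.V) :
    Hom.toLin (leftUnitorIso X).hom (tm (one T) v) = v := lidEquiv_tm v

lemma rightUnitorIso_tm (v : X.V) :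
    Hom.toLin (rightUnitorIso X).hom (tm v (one T)) = v := ridEquiv_tm v

noncomputable instance : MonoidalCategoryStruct (GrRep T) where
  tensorObj := tensor
  tensorUnit := unit T
  tensorHom := tensorMap
  whiskerLeft X _ _ f := tensorMap (𝟙 X) f
  whiskerRight f Y := tensorMap f (𝟙 Y)
  associator := assocIso
  leftUnitor := leftUnitorIso
  rightUnitor := rightUnitorIso

noncomputable instance : MonoidalCategory (GrRep T) :=
  .ofTensorHom
    (id_tensorHom_id := fun X Y => hom_ext _ _ <| tm_ext fun _ _ _ _ _ _ => rfl)
    (tensorHom_comp_tensorHom := fun _ _ _ _ =>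
      hom_ext _ _ <| tm_ext fun _ _ _ _ _ _ => rfl)
    (associator_naturality := fun f g h => hom_ext _ _ <| tm_ext₃ fun x u hu y v hv z w hw => by
      refine (assocIso_hom_tm (f.map_mem x u hu) (g.map_mem y v hv) (h.map_mem z w hw)).trans ?_
      refine Eq.trans ?_ (congrArg (tensorMap f (tensorMap g h)).toLin
        (assocIso_hom_tm hu hv hw)).symm
      rw [map_smul]; rfl)
    (leftUnitor_naturality := fun {X Y} f => hom_ext _ _ <| unit_tm_ext fun y v hv => by
      change Hom.toLin (leftUnitorIso Y).hom (tm (one T) (f.toLin v)) =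
        f.toLin (Hom.toLin (leftUnitorIso X).hom (tm (one T) v))
      rw [leftUnitorIso_tm, leftUnitorIso_tm])
    (rightUnitor_naturality := fun {X Y} f => hom_ext _ _ <| tm_unit_ext fun y v hv => by
      change Hom.toLin (rightUnitorIso Y).hom (tm (f.toLin v) (one T)) =
        f.toLin (Hom.toLin (rightUnitorIso X).hom (tm v (one T)))
      rw [rightUnitorIso_tm, rightUnitorIso_tm])
    (pentagon := fun A B C D => hom_ext _ _ <| tm_ext₄ fun x u hu y v hv z w hw t s hs => by
      change Hom.toLin (tensorMap (𝟙 A) (assocIso B C D).hom)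
        (Hom.toLin (assocIso A (tensor B C) D).hom
          (Hom.toLin (tensorMap (assocIso A B C).hom (𝟙 D)) (tm (tm (tm u v) w) s))) =
        Hom.toLin (assocIso A B (tensor C D)).hom
          (Hom.toLin (assocIso (tensor A B) C D).hom (tm (tm (tm u v) w) s))
      rw [tensorMap_tm, assocIso_hom_tm hu hv hw, smul_tm, map_smul,
        assocIso_hom_tm (tm_mem hu hv) hw hs, map_smul, map_smul]
      rw [show Hom.toLin (𝟙 D) s = s from rfl, assocIso_hom_tm hu (tm_mem hv hw) hs,
        assocIso_hom_tm hu hv (tm_mem hw hs), map_smul, tensorMap_tm, assocIso_hom_tm hv hw hs,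
        tm_smul, smul_smul, smul_smul, smul_smul]
      change _ • tm u (tm v (tm w s)) = _
      congr 1
      have := congrArg (fun t => ((t⁻¹ : kˣ) : k)) (T.α_cocycle x y z t)
      simp only [mul_inv, Units.val_mul] at this
      linear_combination this)
    (triangle := fun A B => hom_ext _ _ <| tm_ext₃ fun x u hu y c hc z w hw => by
      change Hom.toLin (tensorMap (𝟙 A) (leftUnitorIso B).hom)
        (Hom.toLin (assocIso A (unit T) B).hom (tm (tm u c) w)) = 
        Hom.toLin (tensorMap (rightUnitorIso A).hom (𝟙 B)) (tm (tm u c) w)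
      obtain ⟨a, rfl, -⟩ := mem_unit hc
      rw [tm_smul, smul_tm, map_smul, map_smul, map_smul,
        assocIso_hom_tm hu one_mem hw, T.α_one_mid, inv_one, Units.val_one, one_smul,
        tensorMap_tm, tensorMap_tm, leftUnitorIso_tm, rightUnitorIso_tm]
      rfl)

end tensor

end GrRep
end GradedReps

section GradedRepsLimits

open CategoryTheory Limits MonoidalCategory TensorProduct

open scoped Classical

attribute [local instance] Fintype.ofFinite

variable {k F G : Type u} [Field k] [Group F] [Group G] [Finite G]

namespace GrRep

variable {T : TwistDatum k F G} {X Y Z W : GrRep T}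

lemma lin_ext {M : Type u} [AddCommGroup M] [Module k M] {f g : X.V →ₗ[k] M}
    (h : ∀ x, ∀ v ∈ X.deg x, f v = g v) : f = g := by
  ext v
  induction v using induction with
  | h x v hv => exact h x v hv
  | h0 => simp
  | hadd v w hv hw => simp only [map_add, hv, hw]

lemma exists_ρ (f : F) {x : G} {v : X.V} (hv : v ∈ X.deg x) :
    ∃ y, T.act f y = x ∧ ∃ w ∈ X.deg y, X.ρ f w = v :=
  ⟨T.act f⁻¹ x, by rw [← MulAut.mul_apply, ← map_mul, mul_inv_cancel, map_one]; rfl,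
    (X.ρ f).symm v, X.ρ_symm_mem f hv, by simp⟩

lemma unit_aux {M : Type u} [CommGroup M] (a b c d e f : M) (h : b * a * d = c * e * f) :
    a⁻¹ * (b⁻¹ * c) = d * (f⁻¹ * e⁻¹) := by
  have key : ∀ {N : Type u} [AddCommGroup N] (a b c d e f : N), b + a + d = c + e + f →
    -a + (-b + c) = d + (-f + -e) := by intros; grind
  exact key (N := Additive M) a b c d e f h

section ihom

variable (X Y)

/-- The component of degree `h` of the space of linear maps: the maps sending `X_x` to
`Y_{xh}`. -/
def ihomDeg (h : G) : Submodule k (X.V →ₗ[k] Y.V) where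
  carrier := {φ | ∀ x, ∀ v ∈ X.deg x, φ v ∈ Y.deg (x * h)}
  add_mem' ha hb x v hv := Submodule.add_mem _ (ha x v hv) (hb x v hv)
  zero_mem' _ _ _ := Submodule.zero_mem _
  smul_mem' c _ ha x v hv := Submodule.smul_mem _ c (ha x v hv)

/-- Multiplication of the component `X_x → Y_y` of a linear map by the scalar `c x y`. -/
noncomputable def ihomTwist (c : G → G → k) : (X.V →ₗ[k] Y.V) →ₗ[k] (X.V →ₗ[k] Y.V) where
  toFun φ := ∑ x, ∑ y, c x y • (Y.proj y ∘ₗ φ ∘ₗ X.proj x)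
  map_add' φ ψ := by
    simp only [LinearMap.add_comp, LinearMap.comp_add, smul_add, Finset.sum_add_distrib]
  map_smul' a φ := by
    simp only [LinearMap.smul_comp, LinearMap.comp_smul, Finset.smul_sum, RingHom.id_apply]
    refine Finset.sum_congr rfl fun x _ => Finset.sum_congr rfl fun y _ => smul_comm _ _ _

variable {X Y}

lemma ihomTwist_apply' (c : G → G → k) (φ : X.V →ₗ[k] Y.V) {x : G} {v : X.V}
    (hv : v ∈ X.deg x) : ihomTwist X Y c φ v = ∑ y, c x y • Y.proj y (φ v) := by
  simp only [ihomTwist, LinearMap.coe_mk, AddHom.coe_mk, LinearMap.sum_apply,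
    LinearMap.smul_apply, LinearMap.comp_apply]
  rw [Finset.sum_eq_single x]
  · rw [X.proj_same hv]
  · intro y _ hy; simp [X.proj_ne hv hy.symm]
  · simp

lemma ihomTwist_apply (c : G → G → k) {φ : X.V →ₗ[k] Y.V} {x h : G} {v : X.V}
    (hφ : φ ∈ ihomDeg X Y h) (hv : v ∈ X.deg x) :
    ihomTwist X Y c φ v = c x (x * h) • φ v := by
  rw [ihomTwist_apply' c φ hv, Finset.sum_eq_single (x * h), Y.proj_same (hφ x v hv)]
  · intro y _ hy; rw [Y.proj_ne (hφ x v hv) hy.symm, smul_zero]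
  · simp

lemma proj_proj (x y : G) (v : X.V) : X.proj x (X.proj y v) = if y = x then X.proj y v else 0 := by
  split_ifs with h
  · subst h; exact X.proj_same (X.proj_mem _ _)
  · exact X.proj_ne (X.proj_mem _ _) h

lemma ihomTwist_ihomTwist (c d : G → G → k) (φ : X.V →ₗ[k] Y.V) :
    ihomTwist X Y c (ihomTwist X Y d φ) = ihomTwist X Y (fun x y => c x y * d x y) φ := by
  refine lin_ext fun x v hv => ?_
  rw [ihomTwist_apply' _ _ hv, ihomTwist_apply' _ _ hv, ihomTwist_apply' _ _ hv]
  refine Finset.sum_congr rfl fun y _ => ?_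
  simp only [map_sum, map_smul, proj_proj]
  simp [mul_smul]

lemma ihomTwist_one (φ : X.V →ₗ[k] Y.V) : ihomTwist X Y (fun _ _ => 1) φ = φ := by
  refine lin_ext fun x v hv => ?_
  rw [ihomTwist_apply' _ _ hv]
  simp [Y.sum_proj]

variable (X Y) in
/-- `ihomTwist` for units. -/
noncomputable def ihomTwistEquiv (c : G → G → kˣ) : (X.V →ₗ[k] Y.V) ≃ₗ[k] (X.V →ₗ[k] Y.V) :=
  LinearEquiv.ofLinearMap (ihomTwist X Y fun x y => (c x y : k))
    (ihomTwist X Y fun x y => ((c x y)⁻¹ : kˣ))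
    (by ext1 φ; simp [ihomTwist_ihomTwist, ihomTwist_one])
    (by ext1 φ; simp [ihomTwist_ihomTwist, ihomTwist_one])

lemma ihomDeg_isInternal : DirectSum.IsInternal (ihomDeg X Y) := by
  refine isInternal_of_proj _
    (fun h => ihomTwist X Y (fun x y => if x * h = y then 1 else 0)) ?_ ?_ ?_ ?_
  · intro h φ x v hv
    rw [ihomTwist_apply' _ _ hv]
    refine Submodule.sum_mem _ fun y _ => ?_
    split_ifs with hy
    · rw [hy]; exact Submodule.smul_mem _ _ (Y.proj_mem _ _)
    · rw [zero_smul]; exact Submodule.zero_mem _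
  · intro h φ hφ
    refine lin_ext fun x v hv => ?_
    rw [ihomTwist_apply _ hφ hv, if_pos rfl, one_smul]
  · intro h h' hh φ hφ
    refine lin_ext fun x v hv => ?_
    rw [ihomTwist_apply _ hφ hv, if_neg (fun e => hh (mul_left_cancel e).symm), zero_smul]; rfl
  · intro φ
    refine lin_ext fun x v hv => ?_
    rw [LinearMap.sum_apply]
    simp only [ihomTwist_apply' _ _ hv]
    rw [Finset.sum_comm]
    refine Eq.trans ?_ (Y.sum_proj (φ v))
    refine Finset.sum_congr rfl fun y _ => ?_
    rw [Finset.sum_eq_single (x⁻¹ * y)]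
    · simp
    · intro b _ hb
      rw [if_neg (fun e => hb (by rw [← e]; group)), zero_smul]
    · simp

variable (X Y) in
/-- The action of `f` on the space of linear maps. -/
noncomputable def ihomρ (f : F) : (X.V →ₗ[k] Y.V) ≃ₗ[k] (X.V →ₗ[k] Y.V) :=
  ihomTwistEquiv X Y (fun x y => (T.β f x (x⁻¹ * y))⁻¹) ≪≫ₗ
    LinearEquiv.arrowCongr (X.ρ f) (Y.ρ f)

lemma ihomρ_apply (f : F) {φ : X.V →ₗ[k] Y.V} {x h : G} {v : X.V}
    (hφ : φ ∈ ihomDeg X Y h) (hv : v ∈ X.deg x) :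
    ihomρ X Y f φ (X.ρ f v) = (((T.β f x h)⁻¹ : kˣ) : k) • Y.ρ f (φ v) := by
  have : ihomρ X Y f φ (X.ρ f v) =
      Y.ρ f (ihomTwist X Y (fun x y => (((T.β f x (x⁻¹ * y))⁻¹ : kˣ) : k)) φ v) := by
    change Y.ρ f (ihomTwist X Y _ φ ((X.ρ f).symm (X.ρ f v))) = _
    rw [LinearEquiv.symm_apply_apply]
  rw [this, ihomTwist_apply _ hφ hv, map_smul, inv_mul_cancel_left]

lemma ihomρ_mem (f : F) {φ : X.V →ₗ[k] Y.V} {h : G} (hφ : φ ∈ ihomDeg X Y h) :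
    ihomρ X Y f φ ∈ ihomDeg X Y (T.act f h) := by
  intro x v hv
  obtain ⟨y, rfl, w, hw, rfl⟩ := exists_ρ f hv
  rw [ihomρ_apply f hφ hw, ← map_mul]
  exact Submodule.smul_mem _ _ (Y.ρ_mem f (hφ y w hw))

variable (X Y) in
/-- The space of linear maps from `X` to `Y`, as a graded space with projective action. -/
noncomputable def ihomObj : GrRep T where
  V := X.V →ₗ[k] Y.V
  deg := ihomDeg X Y
  isInternal := ihomDeg_isInternal
  ρ := ihomρ X Y
  map_deg f := map_deg_of_le ihomDeg_isInternal (T.act f) (ihomρ X Y f)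
    (fun _ _ hφ => ihomρ_mem f hφ)
  ρ_mul f g h φ hφ := by
    refine lin_ext fun x v hv => ?_
    obtain ⟨y, rfl, w, hw, rfl⟩ := exists_ρ f hv
    obtain ⟨z, rfl, s, hs, rfl⟩ := exists_ρ g hw
    rw [LinearMap.smul_apply, ihomρ_apply f (ihomρ_mem g hφ) hw, ihomρ_apply g hφ hs]
    have h1 : X.ρ f (X.ρ g s) = (((T.γ f g z)⁻¹ : kˣ) : k) • X.ρ (f * g) s := by
      rw [X.ρ_mul f g z s hs, smul_smul, Units.inv_mul, one_smul]
    rw [h1, map_smul, ihomρ_apply (f * g) hφ hs, Y.ρ_mul f g _ _ (hφ z s hs)]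
    simp only [map_smul, smul_smul]
    congr 1
    simpa only [Units.val_mul] using congrArg Units.val
      (unit_aux _ _ _ _ _ _ (T.β_γ f g z h))

variable (X Y) in
/-- An element of `ihomObj X Y`, as a linear map. -/
noncomputable def ihomApp : (ihomObj X Y).V →ₗ[k] (X.V →ₗ[k] Y.V) := LinearMap.id

lemma ihomApp_inj {φ ψ : (ihomObj X Y).V} (h : ∀ x, ∀ v ∈ X.deg x,
    ihomApp X Y φ v = ihomApp X Y ψ v) : φ = ψ := lin_ext h

lemma ihomApp_mem {φ : (ihomObj X Y).V} {h : G} (hφ : φ ∈ (ihomObj X Y).deg h) {x : G} {v : X.V}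
    (hv : v ∈ X.deg x) : ihomApp X Y φ v ∈ Y.deg (x * h) := hφ x v hv

lemma ihomApp_ρ (f : F) {φ : (ihomObj X Y).V} {h : G} (hφ : φ ∈ (ihomObj X Y).deg h) {x : G}
    {v : X.V} (hv : v ∈ X.deg x) : ihomApp X Y ((ihomObj X Y).ρ f φ) (X.ρ f v) =
      (((T.β f x h)⁻¹ : kˣ) : k) • Y.ρ f (ihomApp X Y φ v) := ihomρ_apply f hφ hv

/-- Maps `X ⊗ Z ⟶ Y` as linear maps from `Z` to the space of linear maps from `X` to `Y`. -/
noncomputable def curryLin (φ : (tensor X Z).V →ₗ[k] Y.V) : Z.V →ₗ[k] (ihomObj X Y).V :=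
  ((tmₗ X Z).compr₂ φ).flip

lemma curryLin_apply (φ : (tensor X Z).V →ₗ[k] Y.V) (z : Z.V) (x : X.V) :
    ihomApp X Y (curryLin φ z) x = φ (tm x z) := rfl

/-- The inverse of `curryLin`. -/
noncomputable def uncurryLin (g : Z.V →ₗ[k] (ihomObj X Y).V) : (tensor X Z).V →ₗ[k] Y.V :=
  TensorProduct.lift (ihomApp X Y ∘ₗ g).flip

lemma uncurryLin_tm (g : Z.V →ₗ[k] (ihomObj X Y).V) (x : X.V) (z : Z.V) :
    uncurryLin g (tm x z) = ihomApp X Y (g z) x := TensorProduct.lift.tmul _ _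

variable (X Z Y) in
/-- Morphisms `X ⊗ Z ⟶ Y` correspond to morphisms from `Z` to `ihomObj X Y`. -/
noncomputable def curryEquiv : (tensor X Z ⟶ Y) ≃ (Z ⟶ ihomObj X Y) where
  toFun φ :=
    have hmem : ∀ h, ∀ z ∈ Z.deg h, curryLin φ.toLin z ∈ (ihomObj X Y).deg h :=
      fun h z hz x v hv => φ.map_mem _ _ (tm_mem hv hz)
    { toLin := curryLin φ.toLin
      map_mem := hmem
      comm := fun f z => by
        induction z using induction with
        | h h z hz =>
          refine ihomApp_inj fun x v hv => ?_
          obtain ⟨y, rfl, w, hw, rfl⟩ := exists_ρ f hv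
          rw [ihomApp_ρ f (hmem h z hz) hw, curryLin_apply, curryLin_apply, ← φ.comm,
            ρ_tm f hw hz, map_smul, smul_smul, Units.inv_mul, one_smul]
        | h0 => simp only [map_zero]
        | hadd v w hv hw => rw [map_add, map_add, map_add, map_add, hv, hw] }
  invFun g :=
    { toLin := uncurryLin g.toLin
      map_mem := tm_le (f := uncurryLin g.toLin) fun x u hu y v hv => by
        rw [uncurryLin_tm]
        exact ihomApp_mem (g.map_mem y v hv) hu
      comm := fun f t => by
        have : uncurryLin g.toLin ∘ₗ ((tensor X Z).ρ f).toLinearMap =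
            (Y.ρ f).toLinearMap ∘ₗ uncurryLin g.toLin := tm_ext fun x u hu y v hv => by
          simp only [LinearMap.comp_apply, LinearEquiv.coe_coe, ρ_tm f hu hv, map_smul]
          rw [uncurryLin_tm, uncurryLin_tm, g.comm, ihomApp_ρ f (g.map_mem y v hv) hu,
            smul_smul, Units.mul_inv, one_smul]
        exact LinearMap.congr_fun this t }
  left_inv φ := hom_ext _ _ <| tm_ext fun x u hu y v hv => uncurryLin_tm _ _ _
  right_inv g := hom_ext _ _ <| by
    ext z
    exact ihomApp_inj fun x v _ => uncurryLin_tm g.toLin v z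

/-- Tensoring on the left by `X` has a right adjoint. -/
noncomputable def tensorLeftAdj (X : GrRep T) :
    tensorLeft X ⊣ Adjunction.rightAdjointOfEquiv (F := tensorLeft X)
      (fun Z Y => curryEquiv X Y Z) (fun _ _ _ _ _ => rfl) :=
  Adjunction.adjunctionOfEquivRight _ _

instance (X : GrRep T) : PreservesColimitsOfSize.{0, 0} (tensorLeft X) :=
  (tensorLeftAdj X).leftAdjoint_preservesColimits

end ihom

section coequalizer

variable (f g : X ⟶ Y)

/-- The subspace by which one divides to form the coequalizer. -/
def coeqRel : Submodule k Y.V := LinearMap.range (f.toLin - g.toLin)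

lemma proj_toLin (x : G) (v : X.V) : Y.proj x (f.toLin v) = f.toLin (X.proj x v) := by
  induction v using induction with
  | h y v hv =>
    by_cases h : y = x
    · subst h; rw [X.proj_same hv, Y.proj_same (f.map_mem _ _ hv)]
    · rw [X.proj_ne hv h, Y.proj_ne (f.map_mem _ _ hv) h, map_zero]
  | h0 => simp
  | hadd v w hv hw => simp only [map_add, hv, hw]

lemma coeqRel_proj (x : G) : coeqRel f g ≤ (coeqRel f g).comap (Y.proj x) := by
  rintro _ ⟨v, rfl⟩
  exact ⟨X.proj x v, by simp [proj_toLin]⟩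

lemma coeqRel_ρ (a : F) :
    (coeqRel f g).map (Y.ρ a).toLinearMap = coeqRel f g := by
  apply le_antisymm
  · rintro _ ⟨_, ⟨v, rfl⟩, rfl⟩
    exact ⟨X.ρ a v, by simp [f.comm, g.comm]⟩
  · rintro _ ⟨v, rfl⟩
    refine ⟨(f.toLin - g.toLin) ((X.ρ a).symm v), ⟨_, rfl⟩, ?_⟩
    simp [← f.comm, ← g.comm]

/-- The components of the coequalizer. -/
def coeqDeg (x : G) : Submodule k (Y.V ⧸ coeqRel f g) := (Y.deg x).map (coeqRel f g).mkQ

lemma coeqDeg_isInternal : DirectSum.IsInternal (coeqDeg f g) := by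
  refine isInternal_of_proj _
    (fun x => (coeqRel f g).mapQ (coeqRel f g) (Y.proj x) (coeqRel_proj f g x)) ?_ ?_ ?_ ?_
  · intro x v
    obtain ⟨v, rfl⟩ := (coeqRel f g).mkQ_surjective v
    exact ⟨Y.proj x v, Y.proj_mem _ _, rfl⟩
  · rintro x _ ⟨v, hv, rfl⟩
    exact congrArg (coeqRel f g).mkQ (Y.proj_same hv)
  · rintro x y hxy _ ⟨v, hv, rfl⟩
    exact (congrArg (coeqRel f g).mkQ (Y.proj_ne hv hxy)).trans (map_zero _)
  · intro v
    obtain ⟨v, rfl⟩ := (coeqRel f g).mkQ_surjective v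
    refine Eq.trans ?_ (congrArg (coeqRel f g).mkQ (Y.sum_proj v))
    rw [map_sum]; rfl

/-- The coequalizer of two morphisms. -/
noncomputable def coeq : GrRep T where
  V := Y.V ⧸ coeqRel f g
  deg := coeqDeg f g
  isInternal := coeqDeg_isInternal f g
  ρ a := Submodule.Quotient.equiv _ _ (Y.ρ a) (coeqRel_ρ f g a)
  map_deg a := map_deg_of_le (coeqDeg_isInternal f g) (T.act a) _ (by
    rintro x _ ⟨v, hv, rfl⟩
    exact ⟨Y.ρ a v, Y.ρ_mem a hv, rfl⟩)
  ρ_mul a b x := by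
    rintro _ ⟨v, hv, rfl⟩
    refine (congrArg (coeqRel f g).mkQ (Y.ρ_mul a b x v hv)).trans ?_
    rw [map_smul]; rfl

/-- The projection to the coequalizer. -/
noncomputable def coeqπ : Y ⟶ coeq f g where
  toLin := (coeqRel f g).mkQ
  map_mem x v hv := ⟨v, hv, rfl⟩
  comm _ _ := rfl

lemma coeq_condition : f ≫ coeqπ f g = g ≫ coeqπ f g := by
  refine hom_ext _ _ (LinearMap.ext fun v => ?_)
  exact (Submodule.Quotient.eq _).2 ⟨v, rfl⟩

variable {f g} in
/-- The universal property of the coequalizer. -/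
noncomputable def coeqDesc {Z : GrRep T} (h : Y ⟶ Z) (w : f ≫ h = g ≫ h) : coeq f g ⟶ Z where
  toLin := (coeqRel f g).liftQ h.toLin (by
    rintro _ ⟨v, rfl⟩
    have := LinearMap.congr_fun (congrArg Hom.toLin w) v
    simpa [sub_eq_zero] using this)
  map_mem := by
    rintro x _ ⟨v, hv, rfl⟩
    exact h.map_mem x v hv
  comm a v := by
    obtain ⟨v, rfl⟩ := (coeqRel f g).mkQ_surjective v
    exact h.comm a v

instance : HasCoequalizers (GrRep T) :=
  @hasCoequalizers_of_hasColimit_parallelPair _ _ fun {X Y f g} =>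
    ⟨⟨⟨Cofork.ofπ (coeqπ f g) (coeq_condition f g),
      Cofork.IsColimit.mk _ (fun s => coeqDesc s.π s.condition)
        (fun _ => rfl)
        (fun s m hm => hom_ext _ _ (LinearMap.ext fun v => by
          obtain ⟨v, rfl⟩ := (coeqRel f g).mkQ_surjective v
          exact LinearMap.congr_fun (congrArg Hom.toLin hm) v))⟩⟩⟩

end coequalizer

end GrRep
end GradedRepsLimits

section Cocycles

/-- A normalised 3-cocycle of a group `G` with values in `kˣ`. -/
@[ext]
structure Cocycle3 (k G : Type u) [Field k] [Group G] where
  /-- the function `G × G × G → kˣ` -/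
  toFun : G → G → G → kˣ
  one_left : ∀ g h, toFun 1 g h = 1
  one_mid : ∀ g h, toFun g 1 h = 1
  one_right : ∀ g h, toFun g h 1 = 1
  cocycle : ∀ f g h l,
    toFun g h l * toFun f (g * h) l * toFun f g h = toFun (f * g) h l * toFun f g (h * l)

namespace Cocycle3

variable {k G : Type u} [Field k] [Group G]

/-- The restriction of a 3-cocycle to a subgroup. -/
def res (α : Cocycle3 k G) (H : Subgroup G) : Cocycle3 k H where
  toFun f g h := α.toFun f g h
  one_left g h := α.one_left g h
  one_mid g h := α.one_mid g h
  one_right g h := α.one_right g h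
  cocycle f g h l := α.cocycle f g h l

variable (α : Cocycle3 k G)

/-- `α(f, g | x) = α(f, g, x)⁻¹ α(f, g x g⁻¹, g) α(f g x g⁻¹ f⁻¹, f, g)⁻¹`. -/
def conj₂ (f g x : G) : kˣ :=
  (α.toFun f g x)⁻¹ * α.toFun f (g * x * g⁻¹) g * (α.toFun (f * g * x * g⁻¹ * f⁻¹) f g)⁻¹

/-- `α(f | x, y) = α(f, x, y) α(f x f⁻¹, f, y)⁻¹ α(f x f⁻¹, f y f⁻¹, f)`. -/
def conj₁ (f x y : G) : kˣ :=
  α.toFun f x y * (α.toFun (f * x * f⁻¹) f y)⁻¹ * α.toFun (f * x * f⁻¹) (f * y * f⁻¹) f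

lemma add_conj₂ {N : Type u} [AddCommGroup N] (a : G → G → G → N)
    (ha : ∀ f g h l, a g h l + a f (g * h) l + a f g h = a (f * g) h l + a f g (h * l))
    (f g h x : G) :
    (-a f (g * h) x + a f (g * h * x * (g * h)⁻¹) (g * h) +
        -a (f * (g * h) * x * (g * h)⁻¹ * f⁻¹) f (g * h)) +
      (-a g h x + a g (h * x * h⁻¹) h + -a (g * h * x * h⁻¹ * g⁻¹) g h) =
    (-a (f * g) h x + a (f * g) (h * x * h⁻¹) h +
        -a (f * g * h * x * h⁻¹ * (f * g)⁻¹) (f * g) h) +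
      (-a f g (h * x * h⁻¹) + a f (g * (h * x * h⁻¹) * g⁻¹) g +
        -a (f * g * (h * x * h⁻¹) * g⁻¹ * f⁻¹) f g) := by
  have h1 := ha f g h x
  have h2 := ha f g (h * x * h⁻¹) h
  have h3 := ha f (g * h * x * h⁻¹ * g⁻¹) g h
  have h4 := ha (f * g * h * x * h⁻¹ * g⁻¹ * f⁻¹) f g h
  simp only [mul_assoc, mul_inv_rev, inv_mul_cancel_left, mul_inv_cancel_left, inv_mul_cancel,
    mul_inv_cancel, mul_one] at *
  grind

lemma add_conj₁₂ {N : Type u} [AddCommGroup N] (a : G → G → G → N)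
    (ha : ∀ f g h l, a g h l + a f (g * h) l + a f g h = a (f * g) h l + a f g (h * l))
    (f g x y : G) :
    (a (f * g) x y + -a (f * g * x * (f * g)⁻¹) (f * g) y +
        a (f * g * x * (f * g)⁻¹) (f * g * y * (f * g)⁻¹) (f * g)) +
      (-a f g x + a f (g * x * g⁻¹) g + -a (f * g * x * g⁻¹ * f⁻¹) f g) +
      (-a f g y + a f (g * y * g⁻¹) g + -a (f * g * y * g⁻¹ * f⁻¹) f g) =
    (-a f g (x * y) + a f (g * (x * y) * g⁻¹) g + -a (f * g * (x * y) * g⁻¹ * f⁻¹) f g) +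
      (a g x y + -a (g * x * g⁻¹) g y + a (g * x * g⁻¹) (g * y * g⁻¹) g) +
      (a f (g * x * g⁻¹) (g * y * g⁻¹) + -a (f * (g * x * g⁻¹) * f⁻¹) f (g * y * g⁻¹) +
        a (f * (g * x * g⁻¹) * f⁻¹) (f * (g * y * g⁻¹) * f⁻¹) f) := by
  have h1 := ha f g x y
  have h2 := ha f (g * x * g⁻¹) g y
  have h3 := ha (f * g * x * g⁻¹ * f⁻¹) f g y
  have h4 := ha f (g * x * g⁻¹) (g * y * g⁻¹) g
  have h5 := ha (f * g * x * g⁻¹ * f⁻¹) f (g * y * g⁻¹) g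
  have h6 := ha (f * g * x * g⁻¹ * f⁻¹) (f * g * y * g⁻¹ * f⁻¹) f g
  simp only [mul_assoc, mul_inv_rev, inv_mul_cancel_left, mul_inv_cancel_left, inv_mul_cancel,
    mul_inv_cancel, mul_one] at *
  grind

lemma add_conj₁ {N : Type u} [AddCommGroup N] (a : G → G → G → N)
    (ha : ∀ f g h l, a g h l + a f (g * h) l + a f g h = a (f * g) h l + a f g (h * l))
    (f x y z : G) :
    a x y z +
      (a f (x * y) z + -a (f * (x * y) * f⁻¹) f z + a (f * (x * y) * f⁻¹) (f * z * f⁻¹) f) +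
      (a f x y + -a (f * x * f⁻¹) f y + a (f * x * f⁻¹) (f * y * f⁻¹) f) =
    (a f x (y * z) + -a (f * x * f⁻¹) f (y * z) + a (f * x * f⁻¹) (f * (y * z) * f⁻¹) f) +
      (a f y z + -a (f * y * f⁻¹) f z + a (f * y * f⁻¹) (f * z * f⁻¹) f) +
      a (f * x * f⁻¹) (f * y * f⁻¹) (f * z * f⁻¹) := by
  have h1 := ha f x y z
  have h2 := ha (f * x * f⁻¹) f y z
  have h3 := ha (f * x * f⁻¹) (f * y * f⁻¹) f z
  have h4 := ha (f * x * f⁻¹) (f * y * f⁻¹) (f * z * f⁻¹) f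
  simp only [mul_assoc, mul_inv_rev, inv_mul_cancel_left, mul_inv_cancel_left, inv_mul_cancel,
    mul_inv_cancel, mul_one] at *
  grind

lemma conj₂_cocycle (f g h x : G) :
    α.conj₂ f (g * h) x * α.conj₂ g h x = α.conj₂ (f * g) h x * α.conj₂ f g (h * x * h⁻¹) :=
  add_conj₂ (N := Additive kˣ) α.toFun α.cocycle f g h x

lemma conj₁_conj₂ (f g x y : G) :
    α.conj₁ (f * g) x y * α.conj₂ f g x * α.conj₂ f g y =
      α.conj₂ f g (x * y) * α.conj₁ g x y * α.conj₁ f (g * x * g⁻¹) (g * y * g⁻¹) :=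
  add_conj₁₂ (N := Additive kˣ) α.toFun α.cocycle f g x y

lemma conj₁_assoc (f x y z : G) :
    α.toFun x y z * α.conj₁ f (x * y) z * α.conj₁ f x y =
      α.conj₁ f x (y * z) * α.conj₁ f y z *
        α.toFun (f * x * f⁻¹) (f * y * f⁻¹) (f * z * f⁻¹) :=
  add_conj₁ (N := Additive kˣ) α.toFun α.cocycle f x y z

lemma conj₂_one_left (g x : G) : α.conj₂ 1 g x = 1 := by
  simp [conj₂, α.one_left, α.one_mid, α.one_right]

lemma conj₂_one_mid (g x : G) : α.conj₂ g 1 x = 1 := by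
  simp [conj₂, α.one_left, α.one_mid, α.one_right]

lemma conj₂_one_right (f g : G) : α.conj₂ f g 1 = 1 := by
  simp [conj₂, α.one_left, α.one_mid, α.one_right]

lemma conj₁_one_left (g x : G) : α.conj₁ 1 g x = 1 := by
  simp [conj₁, α.one_left, α.one_mid, α.one_right]

lemma conj₁_one_mid (g x : G) : α.conj₁ g 1 x = 1 := by
  simp [conj₁, α.one_left, α.one_mid, α.one_right]

lemma conj₁_one_right (f g : G) : α.conj₁ f g 1 = 1 := by
  simp [conj₁, α.one_left, α.one_mid, α.one_right]

/-- The twisting datum given by a 3-cocycle of `G` and the conjugation action of `F` along a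
homomorphism `φ : F → G`. -/
def conjDatum {F : Type u} [Group F] (φ : F →* G) : TwistDatum k F G where
  act := MulAut.conj.comp φ
  γ f g x := α.conj₂ (φ f) (φ g) x
  β f x y := α.conj₁ (φ f) x y
  α := α.toFun
  γ_one_left g x := by rw [map_one, conj₂_one_left]
  γ_one_mid f x := by rw [map_one, conj₂_one_mid]
  γ_one_right f g := α.conj₂_one_right _ _
  β_one_left x y := by rw [map_one, conj₁_one_left]
  β_one_mid f y := α.conj₁_one_mid _ _
  β_one_right f x := α.conj₁_one_right _ _
  α_one_left := α.one_left
  α_one_mid := α.one_mid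
  α_one_right := α.one_right
  γ_cocycle f g h x := by
    rw [map_mul, map_mul]; exact α.conj₂_cocycle _ _ _ _
  β_γ f g x y := by
    rw [map_mul]; exact α.conj₁_conj₂ _ _ _ _
  α_β f x y z := α.conj₁_assoc _ _ _ _
  α_cocycle x y z w := (α.cocycle x y z w).trans (mul_comm _ _)

end Cocycle3

end Cocycles

section Braiding

open CategoryTheory Limits MonoidalCategory TensorProduct

open scoped Classical

attribute [local instance] Fintype.ofFinite

namespace GrRep

variable {k F G : Type u} [Field k] [Group F] [Group G] [Finite G]

section

variable {T : TwistDatum k F G} {X Y Z W : GrRep T}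

lemma tm_ext₃' {M : Type u} [AddCommGroup M] [Module k M]
    {f g : (tensor X (tensor Y Z)).V →ₗ[k] M}
    (h : ∀ x, ∀ u ∈ X.deg x, ∀ y, ∀ v ∈ Y.deg y, ∀ z, ∀ w ∈ Z.deg z,
      f (tm u (tm v w)) = g (tm u (tm v w))) : f = g := by
  refine tm_ext fun x u hu s p _ => ?_
  have : f ∘ₗ tmₗ X (tensor Y Z) u = g ∘ₗ tmₗ X (tensor Y Z) u :=
    tm_ext fun y v hv z w hw => h x u hu y v hv z w hw
  exact LinearMap.congr_fun this p

lemma assocIso_inv_tm {x y z : G} {u : X.V} {v : Y.V} {w : Z.V}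
    (hu : u ∈ X.deg x) (hv : v ∈ Y.deg y) (hw : w ∈ Z.deg z) :
    Hom.toLin (assocIso X Y Z).inv (tm u (tm v w)) = (T.α x y z : k) • tm (tm u v) w := by
  have h : tm u (tm v w) = (T.α x y z : k) • Hom.toLin (assocIso X Y Z).hom (tm (tm u v) w) := by
    rw [assocIso_hom_tm hu hv hw, smul_smul, Units.mul_inv, one_smul]
  rw [h, map_smul]
  congr 1
  exact LinearMap.congr_fun (congrArg Hom.toLin (assocIso X Y Z).hom_inv_id) _

variable (X Y) in
/-- The exchange of tensor factors. -/
noncomputable def tmSwap : (tensor X Y).V ≃ₗ[k] (tensor Y X).V := TensorProduct.comm k X.V Y.V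

lemma tmSwap_tm (u : X.V) (v : Y.V) : tmSwap X Y (tm u v) = tm v u := rfl

variable (X Y) in
/-- The map sending `u ⊗ v` to `u ⊗ e x v` for `u ∈ X_x`. -/
noncomputable def tmAct (e : G → Y.V →ₗ[k] Y.V) : (tensor X Y).V →ₗ[k] (tensor X Y).V :=
  ∑ x, tmMap (X.proj x) (e x)

lemma tmAct_tm (e : G → Y.V →ₗ[k] Y.V) {x : G} {u : X.V} (hu : u ∈ X.deg x) (v : Y.V) :
    tmAct X Y e (tm u v) = tm u (e x v) := by
  rw [tmAct, LinearMap.sum_apply, Finset.sum_eq_single x]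
  · rw [tmMap_tm, X.proj_same hu]
  · intro z' _ hz
    rw [tmMap_tm, X.proj_ne hu hz.symm, zero_tm]
  · simp

variable (X Y) in
/-- The equivalence sending `u ⊗ v` to `e x v ⊗ u` for `u ∈ X_x`. -/
noncomputable def tmActSwap (e : G → Y.V ≃ₗ[k] Y.V) : (tensor X Y).V ≃ₗ[k] (tensor Y X).V :=
  LinearEquiv.ofLinearMap (tmAct X Y fun x => (e x).toLinearMap)
    (tmAct X Y fun x => (e x).symm.toLinearMap)
    (tm_ext fun x u hu y v hv => by simp [tmAct_tm _ hu])
    (tm_ext fun x u hu y v hv => by simp [tmAct_tm _ hu]) ≪≫ₗ tmSwap X Y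

lemma tmActSwap_tm (e : G → Y.V ≃ₗ[k] Y.V) {x : G} {u : X.V} (hu : u ∈ X.deg x) (v : Y.V) :
    tmActSwap X Y e (tm u v) = tm (e x v) u := by
  change tmSwap X Y (tmAct X Y (fun x => (e x).toLinearMap) (tm u v)) = _
  rw [tmAct_tm _ hu, tmSwap_tm]; rfl

end

section

variable (α : Cocycle3 k G) {X Y Z : GrRep (α.conjDatum (MonoidHom.id G))}

variable {α}

lemma conj_mem {x y : G} {v : Y.V} (hv : v ∈ Y.deg y) : Y.ρ x v ∈ Y.deg (x * y * x⁻¹) :=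
  Y.ρ_mem x hv

lemma conj_ρ_mul (f g : G) {y : G} {v : Y.V} (hv : v ∈ Y.deg y) :
    Y.ρ (f * g) v = (α.conj₂ f g y : k) • Y.ρ f (Y.ρ g v) := Y.ρ_mul f g y v hv

lemma conj_ρ_tm (f : G) {x y : G} {u : X.V} {v : Y.V} (hu : u ∈ X.deg x) (hv : v ∈ Y.deg y) :
    (tensor X Y).ρ f (tm u v) = (α.conj₁ f x y : k) • tm (X.ρ f u) (Y.ρ f v) := ρ_tm f hu hv

lemma braid_aux (f x y : G) : α.conj₁ f x y * α.conj₂ f x y =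
    α.conj₁ f (x * y * x⁻¹) x * α.conj₂ (f * x * f⁻¹) f y := by
  have key : ∀ {N : Type u} [AddCommGroup N] (a : G → G → G → N)
    (_ : ∀ f g h l, a g h l + a f (g * h) l + a f g h = a (f * g) h l + a f g (h * l)),
    (a f x y + -a (f * x * f⁻¹) f y + a (f * x * f⁻¹) (f * y * f⁻¹) f) +
      (-a f x y + a f (x * y * x⁻¹) x + -a (f * x * y * x⁻¹ * f⁻¹) f x) =
    (a f (x * y * x⁻¹) x + -a (f * (x * y * x⁻¹) * f⁻¹) f x +
      a (f * (x * y * x⁻¹) * f⁻¹) (f * x * f⁻¹) f) +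
      (-a (f * x * f⁻¹) f y + a (f * x * f⁻¹) (f * y * f⁻¹) f +
        -a (f * x * f⁻¹ * f * y * f⁻¹ * (f * x * f⁻¹)⁻¹) (f * x * f⁻¹) f) := by
    intro N _ a _
    simp only [mul_assoc, mul_inv_rev, inv_mul_cancel_left, mul_inv_cancel_left, inv_mul_cancel,
      mul_inv_cancel, mul_one, inv_inv]
    grind
  exact key (N := Additive kˣ) α.toFun α.cocycle

variable (X Y) in
/-- The braiding `u ⊗ v ↦ x.v ⊗ u` for `u` of degree `x`. -/
noncomputable def braid : tensor X Y ≅ tensor Y X :=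
  isoMk (tmActSwap X Y Y.ρ)
    (tm_le (f := (tmActSwap X Y Y.ρ).toLinearMap) fun x u hu y v hv => by
      rw [LinearEquiv.coe_coe, tmActSwap_tm _ hu, show x * y = (x * y * x⁻¹) * x by group]
      exact tm_mem (conj_mem hv) hu)
    (fun f => tm_ext fun x u hu y v hv => by
      simp only [LinearMap.comp_apply, LinearEquiv.coe_coe]
      rw [conj_ρ_tm f hu hv, map_smul, tmActSwap_tm _ hu, tmActSwap_tm _ (conj_mem hu),
        conj_ρ_tm f (conj_mem hv) hu]
      have h1 := conj_ρ_mul (f * x * f⁻¹) f hv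
      rw [inv_mul_cancel_right, conj_ρ_mul f x hv] at h1
      have h2 : Y.ρ (f * x * f⁻¹) (Y.ρ f v) = (((α.conj₂ (f * x * f⁻¹) f y)⁻¹ *
          α.conj₂ f x y : kˣ) : k) • Y.ρ f (Y.ρ x v) := by
        rw [Units.val_mul, mul_smul, h1, smul_smul, Units.inv_mul, one_smul]
      rw [h2, smul_tm, smul_smul, ← Units.val_mul]
      congr 2
      rw [mul_left_comm, braid_aux, mul_comm, mul_inv_cancel_right])

lemma braid_tm {x : G} {u : X.V} (hu : u ∈ X.deg x) (v : Y.V) :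
    Hom.toLin (braid X Y).hom (tm u v) = tm (Y.ρ x v) u := tmActSwap_tm _ hu v

noncomputable instance : BraidedCategory (GrRep (α.conjDatum (MonoidHom.id G))) where
  braiding := braid
  braiding_naturality_right X Y Z f := hom_ext _ _ <| tm_ext fun x u hu y v hv => by
    change Hom.toLin (braid X Z).hom (tm u (f.toLin v)) =
      (tensorMap f (𝟙 X)).toLin (Hom.toLin (braid X Y).hom (tm u v))
    rw [braid_tm hu, braid_tm hu, tensorMap_tm, f.comm]; rfl
  braiding_naturality_left {X Y} f Z := hom_ext _ _ <| tm_ext fun x u hu y v hv => by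
    change Hom.toLin (braid Y Z).hom (tm (f.toLin u) v) =
      (tensorMap (𝟙 Z) f).toLin (Hom.toLin (braid X Z).hom (tm u v))
    rw [braid_tm hu, braid_tm (f.map_mem x u hu), tensorMap_tm]; rfl
  hexagon_forward X Y Z := hom_ext _ _ <| tm_ext₃ fun x u hu y v hv z w hw => by
    change Hom.toLin (assocIso Y Z X).hom (Hom.toLin (braid X (tensor Y Z)).hom
        (Hom.toLin (assocIso X Y Z).hom (tm (tm u v) w))) =
      (tensorMap (𝟙 Y) (braid X Z).hom).toLin (Hom.toLin (assocIso Y X Z).hom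
        ((tensorMap (braid X Y).hom (𝟙 Z)).toLin (tm (tm u v) w)))
    rw [assocIso_hom_tm hu hv hw, map_smul, map_smul, braid_tm hu, conj_ρ_tm x hv hw, smul_tm,
      map_smul, assocIso_hom_tm (conj_mem hv) (conj_mem hw) hu, tensorMap_tm, braid_tm hu,
      show Hom.toLin (𝟙 Z) w = w from rfl, assocIso_hom_tm (conj_mem hv) hu hw, map_smul,
      tensorMap_tm, braid_tm hu, smul_smul, smul_smul, ← Units.val_mul, ← Units.val_mul]
    change _ = _ • tm (Y.ρ x v) (tm (Z.ρ x w) u)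
    congr 2
    change (α.toFun x y z)⁻¹ * α.conj₁ x y z * (α.toFun (x * y * x⁻¹) (x * z * x⁻¹) x)⁻¹ = _
    rw [mul_assoc, Cocycle3.conj₁, mul_inv_cancel_right, inv_mul_cancel_left]; rfl
  hexagon_reverse X Y Z := hom_ext _ _ <| tm_ext₃' fun x u hu y v hv z w hw => by
    change Hom.toLin (assocIso Z X Y).inv (Hom.toLin (braid (tensor X Y) Z).hom
        (Hom.toLin (assocIso X Y Z).inv (tm u (tm v w)))) =
      (tensorMap (braid X Z).hom (𝟙 Y)).toLin (Hom.toLin (assocIso X Z Y).inv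
        ((tensorMap (𝟙 X) (braid Y Z).hom).toLin (tm u (tm v w))))
    rw [assocIso_inv_tm hu hv hw, map_smul, map_smul, braid_tm (tm_mem hu hv),
      assocIso_inv_tm (conj_mem hw) hu hv, tensorMap_tm, braid_tm hv,
      show Hom.toLin (𝟙 X) u = u from rfl, assocIso_inv_tm hu (conj_mem hw) hv, map_smul,
      tensorMap_tm, braid_tm hu, conj_ρ_mul x y hw, smul_tm, smul_tm, smul_smul, smul_smul,
      ← Units.val_mul, ← Units.val_mul]
    change _ = _ • tm (tm (Z.ρ x (Z.ρ y w)) u) v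
    congr 2
    have h : ∀ a b c : kˣ, a * c * (a⁻¹ * b * c⁻¹) = b := fun a b c => by
      rw [mul_assoc a⁻¹, mul_mul_mul_comm, mul_inv_cancel, one_mul, mul_left_comm,
        mul_inv_cancel, mul_one]
    change α.toFun x y z * α.toFun (x * y * z * (x * y)⁻¹) x y * α.conj₂ x y z = _
    rw [Cocycle3.conj₂, mul_inv_rev, ← mul_assoc (x * y * z), h]; rfl

instance (X : GrRep (α.conjDatum (MonoidHom.id G))) :
    PreservesColimitsOfSize.{0, 0} (tensorRight X) :=
  preservesColimits_of_natIso (BraidedCategory.tensorLeftIsoTensorRight X)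

end

end GrRep
end Braiding

section FunctionAlgebra

open CategoryTheory Limits MonoidalCategory TensorProduct

open scoped Classical

attribute [local instance] Fintype.ofFinite

namespace GrRep

variable {k G : Type u} [Field k] [Group G] [Finite G]

variable (α : Cocycle3 k G) (S : Type u) [Finite S] [MulAction G S]

variable (k G) in
/-- The action of `G` on functions on a `G`-set: `(g.a)(x) = a(g⁻¹ x)`. -/
def funRep : G →* ((S → k) ≃ₗ[k] (S → k)) where
  toFun g := LinearEquiv.funCongrLeft k k (MulAction.toPerm g⁻¹)
  map_one' := by ext a x; simp
  map_mul' g h := by ext a x; simp [mul_smul]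

/-- The space of functions on a finite `G`-set, in degree `1`. -/
noncomputable def funObj : GrRep (α.conjDatum (MonoidHom.id G)) := ofRep _ (S → k) (funRep k G S)

/-- Pointwise multiplication of functions, as a map on the tensor product. -/
noncomputable def funMul : (tensor (funObj α S) (funObj α S)).V →ₗ[k] (funObj α S).V :=
  TensorProduct.lift (LinearMap.mul k (S → k))

/-- A function as an element of `funObj`. -/
def toFunObj (a : S → k) : (funObj α S).V := a

variable {α S}

lemma funObj_cases {x : G} {a : (funObj α S).V} (ha : a ∈ (funObj α S).deg x) :
    x = 1 ∨ a = 0 := by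
  by_cases hx : x = 1
  · exact Or.inl hx
  · exact Or.inr (ha hx)

lemma toFunObj_mem (a : (funObj α S).V) : a ∈ (funObj α S).deg 1 := fun h => absurd rfl h

lemma funMul_tm (a b : S → k) :
    funMul α S (tm (toFunObj α S a) (toFunObj α S b)) = toFunObj α S (a * b) :=
  TensorProduct.lift.tmul _ _

lemma funObj_ρ (g : G) (a : S → k) :
    (funObj α S).ρ g (toFunObj α S a) = toFunObj α S (fun x => a (g⁻¹ • x)) := rfl

variable (α S)

/-- The constant functions. -/
noncomputable def funOne : unit (α.conjDatum (MonoidHom.id G)) ⟶ funObj α S where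
  toLin := (LinearMap.toSpanSingleton k (S → k) 1)
  map_mem x v hv hx := by
    have : v = 0 := hv hx
    subst this
    exact zero_smul k (1 : S → k)
  comm _ _ := rfl

lemma funOne_one : (funOne α S).toLin (one _) = toFunObj α S 1 := one_smul k (1 : S → k)

/-- The pointwise multiplication of functions. -/
noncomputable def funMulHom : tensor (funObj α S) (funObj α S) ⟶ funObj α S where
  toLin := funMul α S
  map_mem := tm_le (f := funMul α S) fun x a ha y b hb => by
    rcases funObj_cases ha with rfl | rfl
    · rcases funObj_cases hb with rfl | rfl
      · rw [one_mul]; exact toFunObj_mem _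
      · rw [tm_zero, map_zero]; exact Submodule.zero_mem _
    · rw [zero_tm, map_zero]; exact Submodule.zero_mem _
  comm g t := by
    have : funMul α S ∘ₗ ((tensor (funObj α S) (funObj α S)).ρ g).toLinearMap =
        ((funObj α S).ρ g).toLinearMap ∘ₗ funMul α S := tm_ext fun x a ha y b hb => by
      rcases funObj_cases ha with rfl | rfl
      · simp only [LinearMap.comp_apply, LinearEquiv.coe_coe]
        rw [conj_ρ_tm g ha hb, α.conj₁_one_mid, Units.val_one, one_smul]
        change funMul α S (tm (toFunObj α S fun x => a (g⁻¹ • x))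
          (toFunObj α S fun x => b (g⁻¹ • x))) =
          (funObj α S).ρ g (funMul α S (tm (toFunObj α S a) (toFunObj α S b)))
        rw [funMul_tm]
        exact (congrArg ((funObj α S).ρ g) (funMul_tm (α := α) (S := S) a b)).symm
      · simp [zero_tm]
    exact LinearMap.congr_fun this t

lemma funMulHom_tm (a b : S → k) :
    (funMulHom α S).toLin (tm (toFunObj α S a) (toFunObj α S b)) = toFunObj α S (a * b) :=
  funMul_tm a b

noncomputable instance : MonObj (funObj α S) where
  one := funOne α S
  mul := funMulHom α S
  one_mul := hom_ext _ _ <| unit_tm_ext fun x a _ => by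
    change (funMulHom α S).toLin ((tensorMap (funOne α S) (𝟙 _)).toLin (tm (one _) a)) =
      Hom.toLin (leftUnitorIso (funObj α S)).hom (tm (one _) a)
    rw [leftUnitorIso_tm, tensorMap_tm, funOne_one]
    exact (funMulHom_tm α S 1 a).trans (one_mul (M := S → k) a)
  mul_one := hom_ext _ _ <| tm_unit_ext fun x a _ => by
    change (funMulHom α S).toLin ((tensorMap (𝟙 _) (funOne α S)).toLin (tm a (one _))) =
      Hom.toLin (rightUnitorIso (funObj α S)).hom (tm a (one _))
    rw [rightUnitorIso_tm, tensorMap_tm, funOne_one]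
    exact (funMulHom_tm α S a 1).trans (mul_one (M := S → k) a)
  mul_assoc := hom_ext _ _ <| tm_ext₃ fun x a ha y b hb z c hc => by
    change (funMulHom α S).toLin ((tensorMap (funMulHom α S) (𝟙 _)).toLin (tm (tm a b) c)) =
      (funMulHom α S).toLin ((tensorMap (𝟙 _) (funMulHom α S)).toLin
        (Hom.toLin (assocIso (funObj α S) (funObj α S) (funObj α S)).hom (tm (tm a b) c)))
    rcases funObj_cases ha with rfl | rfl
    · rw [assocIso_hom_tm ha hb hc, show (α.conjDatum (MonoidHom.id G)).α 1 y z = 1 from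
        α.one_left _ _, inv_one, Units.val_one, one_smul, tensorMap_tm, tensorMap_tm]
      have h1 := funMulHom_tm α S a b
      have h2 := funMulHom_tm α S b c
      have h3 := funMulHom_tm α S (HMul.hMul (α := S → k) (β := S → k) a b) c
      have h4 := funMulHom_tm α S a (HMul.hMul (α := S → k) (β := S → k) b c)
      refine (congrArg (fun t => (funMulHom α S).toLin (tm t (toFunObj α S c))) h1).trans
        (h3.trans (Eq.trans ?_ ((congrArg
        (fun t => (funMulHom α S).toLin (tm (toFunObj α S a) t)) h2).trans h4).symm))
      exact congrArg (toFunObj α S) (mul_assoc (G := S → k) a b c)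
    · simp only [zero_tm, map_zero]

instance : IsCommMonObj (funObj α S) where
  mul_comm := hom_ext _ _ <| tm_ext fun x a ha y b hb => by
    change (funMulHom α S).toLin (Hom.toLin (braid (funObj α S) (funObj α S)).hom (tm a b)) =
      (funMulHom α S).toLin (tm a b)
    rcases funObj_cases ha with rfl | rfl
    · rw [braid_tm ha, ρ_one]
      exact (funMulHom_tm α S b a).trans ((congrArg (toFunObj α S)
        (mul_comm (G := S → k) b a)).trans (funMulHom_tm α S a b).symm)
    · simp only [zero_tm, map_zero]

/-- The function algebra of a finite `G`-set as a commutative algebra. -/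
noncomputable def funAlg : Mon (GrRep (α.conjDatum (MonoidHom.id G))) := ⟨funObj α S⟩

instance : IsCommMonObj (funAlg α S).X := inferInstanceAs (IsCommMonObj (funObj α S))

end GrRep
end FunctionAlgebra

section Inclusion

open CategoryTheory Limits MonoidalCategory TensorProduct

open scoped Classical

attribute [local instance] Fintype.ofFinite

namespace GrRep

variable {k G : Type u} [Field k] [Group G] [Finite G]

variable (α : Cocycle3 k G) (H : Subgroup G)

section

variable {α H} (X Y Z : GrRep ((α.res H).conjDatum (MonoidHom.id H)))

/-- The grading by `G` obtained from a grading by the subgroup `H` via extension by zero. -/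
noncomputable def extDeg (g : G) : Submodule k X.V := if h : g ∈ H then X.deg ⟨g, h⟩ else ⊥

variable {X}

lemma extDeg_cases {g : G} {v : X.V} (hv : v ∈ extDeg X g) :
    v = 0 ∨ ∃ h : H, (h : G) = g ∧ v ∈ X.deg h := by
  unfold extDeg at hv
  split_ifs at hv with h
  · exact Or.inr ⟨⟨g, h⟩, rfl, hv⟩
  · exact Or.inl hv

lemma mem_extDeg {h : H} {v : X.V} (hv : v ∈ X.deg h) : v ∈ extDeg X (h : G) := by
  unfold extDeg
  rw [dif_pos h.2]
  exact hv

lemma extDeg_isInternal : DirectSum.IsInternal (extDeg X) := by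
  refine isInternal_of_proj _ (fun g => if h : g ∈ H then X.proj ⟨g, h⟩ else 0) ?_ ?_ ?_ ?_
  · intro g v
    split_ifs with h
    · exact mem_extDeg (h := ⟨g, h⟩) (X.proj_mem _ _)
    · exact Submodule.zero_mem _
  · intro g v hv
    rcases extDeg_cases hv with rfl | ⟨h, rfl, hv1⟩
    · rw [map_zero]
    · rw [dif_pos h.2]; exact X.proj_same hv1
  · intro g g' hg v hv
    rcases extDeg_cases hv with rfl | ⟨h, rfl, hv1⟩
    · rw [map_zero]
    · split_ifs with h'
      · exact X.proj_ne hv1 (fun e => hg (congrArg Subtype.val e))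
      · rfl
  · intro v
    letI : Fintype H := Fintype.ofFinite H
    refine Eq.trans ?_ (X.sum_proj v)
    symm
    refine Finset.sum_of_injOn (fun h : H => (h : G)) (Subtype.val_injective.injOn)
      (fun _ _ => Finset.mem_coe.2 (Finset.mem_univ _)) ?_ ?_
    · intro g _ hg
      rw [dif_neg (fun h => hg ⟨⟨g, h⟩, Finset.mem_coe.2 (Finset.mem_univ _), rfl⟩)]; rfl
    · intro h _
      rw [dif_pos h.2]

variable (X)

/-- An object of `Z(H, α|_H)` viewed as an object of `C(G, H, α)`, by extending the grading from
`H` to `G` by zero. -/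
noncomputable def inclObj : GrRep (α.conjDatum H.subtype) where
  V := X.V
  deg := extDeg X
  isInternal := extDeg_isInternal
  ρ := X.ρ
  map_deg f := map_deg_of_le extDeg_isInternal _ (X.ρ f) (by
    intro g v hv
    rcases extDeg_cases hv with rfl | ⟨h, rfl, hv1⟩
    · rw [map_zero]; exact Submodule.zero_mem _
    · exact mem_extDeg (X.ρ_mem f hv1))
  ρ_mul f g x v hv := by
    rcases extDeg_cases hv with rfl | ⟨h, rfl, hv1⟩
    · simp
    · exact X.ρ_mul f g h v hv1

/-- The identity map from `X` to `inclObj X`. -/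
noncomputable def inclV : X.V ≃ₗ[k] (inclObj X).V := LinearEquiv.refl k X.V

lemma inclV_ρ (f : H) (v : X.V) : (inclObj X).ρ f (inclV X v) = inclV X (X.ρ f v) := rfl

variable {X Y Z}

lemma inclV_mem {h : H} {v : X.V} (hv : v ∈ X.deg h) : inclV X v ∈ (inclObj X).deg (h : G) :=
  mem_extDeg hv

lemma incl_cases {g : G} {v : (inclObj X).V} (hv : v ∈ (inclObj X).deg g) :
    v = 0 ∨ ∃ h : H, (h : G) = g ∧ ∃ w ∈ X.deg h, v = inclV X w := by
  rcases extDeg_cases hv with rfl | ⟨h, hg, hv⟩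
  · exact Or.inl rfl
  · exact Or.inr ⟨h, hg, v, hv, rfl⟩

lemma incl_tm_ext {M : Type u} [AddCommGroup M] [Module k M]
    {f g : (tensor (inclObj X) (inclObj Y)).V →ₗ[k] M}
    (h : ∀ x, ∀ u ∈ X.deg x, ∀ y, ∀ v ∈ Y.deg y,
      f (tm (inclV X u) (inclV Y v)) = g (tm (inclV X u) (inclV Y v))) : f = g := by
  refine tm_ext fun x u hu y v hv => ?_
  rcases incl_cases hu with rfl | ⟨x, rfl, u, hu1, rfl⟩
  · simp only [zero_tm, map_zero]
  · rcases incl_cases hv with rfl | ⟨y, rfl, v, hv1, rfl⟩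
    · simp only [tm_zero, map_zero]
    · exact h x u hu1 y v hv1

lemma incl_tm_ext₃ {M : Type u} [AddCommGroup M] [Module k M]
    {f g : (tensor (tensor (inclObj X) (inclObj Y)) (inclObj Z)).V →ₗ[k] M}
    (h : ∀ x, ∀ u ∈ X.deg x, ∀ y, ∀ v ∈ Y.deg y, ∀ z, ∀ w ∈ Z.deg z,
      f (tm (tm (inclV X u) (inclV Y v)) (inclV Z w)) =
        g (tm (tm (inclV X u) (inclV Y v)) (inclV Z w))) : f = g := by
  refine tm_ext fun _ p _ z w hw => ?_
  rcases incl_cases hw with rfl | ⟨z, rfl, w, hw1, rfl⟩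
  · simp only [tm_zero, map_zero]
  have : f ∘ₗ (tmₗ (tensor (inclObj X) (inclObj Y)) (inclObj Z)).flip (inclV Z w) =
      g ∘ₗ (tmₗ (tensor (inclObj X) (inclObj Y)) (inclObj Z)).flip (inclV Z w) :=
    incl_tm_ext fun x u hu y v hv => h x u hu y v hv z w hw1
  exact LinearMap.congr_fun this p

/-- A morphism of `Z(H, α|_H)` viewed as a morphism of `C(G, H, α)`. -/
noncomputable def inclMap (f : X ⟶ Y) : inclObj X ⟶ inclObj Y where
  toLin := f.toLin
  map_mem g v hv := by
    rcases extDeg_cases hv with rfl | ⟨h, rfl, hv1⟩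
    · exact (map_zero f.toLin) ▸ Submodule.zero_mem _
    · exact mem_extDeg (f.map_mem h v hv1)
  comm := f.comm

lemma inclMap_apply (f : X ⟶ Y) (v : X.V) :
    (inclMap f).toLin (inclV X v) = inclV Y (f.toLin v) := rfl

variable (X Y) in
/-- The identity map of `X ⊗ Y`. -/
noncomputable def inclμ : (tensor (inclObj X) (inclObj Y)).V ≃ₗ[k] (inclObj (tensor X Y)).V :=
  LinearEquiv.refl k (X.V ⊗[k] Y.V)

lemma inclμ_tm (u : X.V) (v : Y.V) :
    inclμ X Y (tm (inclV X u) (inclV Y v)) = inclV (tensor X Y) (tm u v) := rfl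

variable (X Y) in
/-- The inclusion preserves tensor products. -/
noncomputable def inclμIso : tensor (inclObj X) (inclObj Y) ≅ inclObj (tensor X Y) :=
  isoMk (inclμ X Y)
    (tm_le (f := (inclμ X Y).toLinearMap) fun x u hu y v hv => by
      rcases incl_cases hu with rfl | ⟨x, rfl, u, hu1, rfl⟩
      · rw [zero_tm, map_zero]; exact Submodule.zero_mem _
      · rcases incl_cases hv with rfl | ⟨y, rfl, v, hv1, rfl⟩
        · rw [tm_zero, map_zero]; exact Submodule.zero_mem _
        · exact inclV_mem (X := tensor X Y) (tm_mem hu1 hv1))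
    (fun f => incl_tm_ext fun x u hu y v hv => by
      simp only [LinearMap.comp_apply, LinearEquiv.coe_coe]
      rw [ρ_tm f (inclV_mem hu) (inclV_mem hv), map_smul, inclV_ρ, inclV_ρ, inclμ_tm, inclμ_tm,
        inclV_ρ, ρ_tm f hu hv, map_smul]
      rfl)

lemma inclμIso_tm (u : X.V) (v : Y.V) : Hom.toLin (inclμIso X Y).hom
    (tm (inclV X u) (inclV Y v)) = inclV (tensor X Y) (tm u v) := rfl

variable (α H) in
/-- The identity map of the unit object. -/
noncomputable def inclε : (unit (α.conjDatum H.subtype)).V ≃ₗ[k]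
    (inclObj (unit ((α.res H).conjDatum (MonoidHom.id H)))).V := LinearEquiv.refl k k

lemma inclε_one : inclε α H (one _) = inclV _ (one _) := rfl

variable (α H) in
/-- The inclusion preserves the unit object. -/
noncomputable def inclεIso : unit (α.conjDatum H.subtype) ≅
    inclObj (unit ((α.res H).conjDatum (MonoidHom.id H))) :=
  isoMk (inclε α H)
    (fun x v hv => by
      obtain ⟨a, rfl, h⟩ := mem_unit hv
      rw [map_smul, inclε_one]
      rcases h with rfl | rfl
      · exact Submodule.smul_mem _ _ (inclV_mem one_mem)
      · rw [zero_smul]; exact Submodule.zero_mem _)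
    (fun _ => rfl)

lemma inclεIso_one : Hom.toLin (inclεIso α H).hom (one _) = inclV _ (one _) := rfl

lemma incl_ext {M : Type u} [AddCommGroup M] [Module k M] {f g : (inclObj X).V →ₗ[k] M}
    (h : ∀ x, ∀ u ∈ X.deg x, f (inclV X u) = g (inclV X u)) : f = g := by
  refine lin_ext fun x v hv => ?_
  rcases incl_cases hv with rfl | ⟨x, rfl, v, hv1, rfl⟩
  · simp only [map_zero]
  · exact h x v hv1

lemma unit_incl_ext {M : Type u} [AddCommGroup M] [Module k M]
    {f g : (tensor (unit (α.conjDatum H.subtype)) (inclObj X)).V →ₗ[k] M}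
    (h : ∀ x, ∀ u ∈ X.deg x, f (tm (one _) (inclV X u)) = g (tm (one _) (inclV X u))) : f = g :=
  unit_tm_ext fun x u hu => by
    rcases incl_cases hu with rfl | ⟨x, rfl, u, hu1, rfl⟩
    · simp only [tm_zero, map_zero]
    · exact h x u hu1

lemma incl_unit_ext {M : Type u} [AddCommGroup M] [Module k M]
    {f g : (tensor (inclObj X) (unit (α.conjDatum H.subtype))).V →ₗ[k] M}
    (h : ∀ x, ∀ u ∈ X.deg x, f (tm (inclV X u) (one _)) = g (tm (inclV X u) (one _))) : f = g :=
  tm_unit_ext fun x u hu => by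
    rcases incl_cases hu with rfl | ⟨x, rfl, u, hu1, rfl⟩
    · simp only [zero_tm, map_zero]
    · exact h x u hu1

end

/-- The inclusion of `Z(H, α|_H)` in `C(G, H, α)`. -/
noncomputable def incl :
    GrRep ((α.res H).conjDatum (MonoidHom.id H)) ⥤ GrRep (α.conjDatum H.subtype) where
  obj := inclObj
  map := inclMap

/-- The monoidal structure of the inclusion, given by identity maps. -/
noncomputable def inclCore : (incl α H).CoreMonoidal where
  εIso := inclεIso α H
  μIso := inclμIso
  μIso_hom_natural_left f Z := hom_ext _ _ <| incl_tm_ext fun x u hu y v hv => rfl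
  μIso_hom_natural_right Z f := hom_ext _ _ <| incl_tm_ext fun x u hu y v hv => rfl
  associativity X Y Z := hom_ext _ _ <| incl_tm_ext₃ fun x u hu y v hv z w hw => by
    change (inclMap (assocIso X Y Z).hom).toLin (Hom.toLin (inclμIso (tensor X Y) Z).hom
        ((tensorMap (inclμIso X Y).hom (𝟙 _)).toLin
          (tm (tm (inclV X u) (inclV Y v)) (inclV Z w)))) =
      Hom.toLin (inclμIso X (tensor Y Z)).hom ((tensorMap (𝟙 _) (inclμIso Y Z).hom).toLin
        (Hom.toLin (assocIso (inclObj X) (inclObj Y) (inclObj Z)).hom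
          (tm (tm (inclV X u) (inclV Y v)) (inclV Z w))))
    rw [assocIso_hom_tm (inclV_mem hu) (inclV_mem hv) (inclV_mem hw), map_smul, map_smul,
      tensorMap_tm, tensorMap_tm, inclμIso_tm, inclμIso_tm]
    change Hom.toLin (inclMap (assocIso X Y Z).hom) (inclV (tensor (tensor X Y) Z)
      (tm (tm u v) w)) = _ • inclV (tensor X (tensor Y Z)) (tm u (tm v w))
    rw [inclMap_apply, assocIso_hom_tm hu hv hw, map_smul]
    rfl
  left_unitality X := hom_ext _ _ <| unit_incl_ext fun x u _ =>
    (leftUnitorIso_tm (inclV X u)).trans (congrArg (inclV X) (leftUnitorIso_tm u)).symm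
  right_unitality X := hom_ext _ _ <| incl_unit_ext fun x u _ =>
    (rightUnitorIso_tm (inclV X u)).trans (congrArg (inclV X) (rightUnitorIso_tm u)).symm

noncomputable instance : (incl α H).Monoidal := (inclCore α H).toMonoidal

end GrRep
end Inclusion

section Categories

variable {k G : Type u} [Field k] [Group G] [Finite G]

/-- `Z(G, α)`: finite-dimensional `G`-graded vector spaces with an `α`-projective `G`-action,
where `G` acts on itself by conjugation. -/
abbrev ZCat (α : Cocycle3 k G) := GrRep (α.conjDatum (MonoidHom.id G))

/-- `C(G, H, α)`: finite-dimensional `G`-graded vector spaces with an `α`-projective action of the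
subgroup `H`, which acts on `G` by conjugation. -/
abbrev CCat (α : Cocycle3 k G) (H : Subgroup G) := GrRep (α.conjDatum H.subtype)

/-- The algebra `k(G/H)` of functions on the set of cosets, as an algebra in `Z(G, α)`. -/
noncomputable abbrev cosetAlg (α : Cocycle3 k G) (H : Subgroup G) : CategoryTheory.Mon (ZCat α) :=
  GrRep.funAlg α (G ⧸ H)

end Categories

open CategoryTheory

/-! ### Modules over a function algebra as graded spaces with a system of idempotents -/

section ModuleAction

open CategoryTheory Limits MonoidalCategory TensorProduct

open scoped Classical

attribute [local instance] Fintype.ofFinite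

namespace GrRep

variable {k G : Type u} [Field k] [Group G] [Finite G] {α : Cocycle3 k G}
  {S : Type u} [Finite S] [MulAction G S]

/-! Let `A = k(S)` for a finite `G`-set `S`. Functions sit in degree `1` and `α` is normalised, so
every associativity, braiding or action scalar with a function among its arguments is trivial. An
`A`-module in `Z(G, α)` is thus an object `M` on which functions act by degree-preserving operators.
The indicators of points are orthogonal idempotents with sum `1`, so `M` splits as a direct sum of
components `M_s`, and `g` carries `M_s` onto `M_{gs}`.

For `S = G/H` the action is transitive, so `M` is determined by its fibre over the trivial coset.
This fibre is a `G`-graded subspace stable under `H`, hence an object of `C(G, H, α)`; taking it is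
the functor `D` (`fibFunctor`). Morphisms are determined on the fibre, since its translates span `M`
(`fib_ext`). Conversely, an `H`-equivariant graded map of fibres extends by `t.v ↦ t.f(v)`; the
projective scalars agree on both sides because `f` preserves degrees (`extLin_ρ`). Essential
surjectivity comes from a twisted coinduced module, whose elements record the components over the
trivial coset of all translates `g.Ψ`; evaluation at `1` identifies its fibre with the given object
(`fibCoindIso`).

In `M ⊗_A N` the balancing relation kills `M_s ⊗ N_t` for `s ≠ t`, so the fibre of `M ⊗_A N` is the
tensor product of the fibres (`fibμLin_δLin`). The tensor and associativity scalars are evaluated at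
the same degrees as before, which makes `D` monoidal.

For `m` of degree `x` the double braiding sends `m ⊗ a` to `m ⊗ x.a`. Locality therefore compares
`x.a` with `a`, and on the fibre it says that only degrees fixing the trivial coset occur, that is,
degrees in `H` (`isLocal_iff_supported`). So `D` carries local modules to objects supported on `H`,
which form the essential image of the fully faithful inclusion `ι`. This produces `L` with `L ⋙ ι`
isomorphic to `D` on local modules, and the monoidal structure of `L` is reflected along `ι`.
Finally `L` is braided because both braidings are `u ⊗ v ↦ x.v ⊗ u` for `u` of degree `x ∈ H`. -/

/-- The action map of a module over the function algebra. -/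
def actHom (M : RightMod (funAlg α S)) : tensor M.X (funObj α S) ⟶ M.X := M.act

/-- The action of a function on a module, as a linear map. -/
noncomputable def actₗ (M : RightMod (funAlg α S)) : (S → k) →ₗ[k] M.X.V →ₗ[k] M.X.V :=
  ((tmₗ M.X (funObj α S)).compr₂ (actHom M).toLin).flip

lemma actHom_tm (M : RightMod (funAlg α S)) (m : M.X.V) (a : S → k) :
    (actHom M).toLin (tm m (toFunObj α S a)) = actₗ M a m := rfl

lemma actₗ_mem (M : RightMod (funAlg α S)) (a : S → k) {x : G} {m : M.X.V} (hm : m ∈ M.X.deg x) :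
    actₗ M a m ∈ M.X.deg x := by
  have := (actHom M).map_mem _ _ (tm_mem hm (toFunObj_mem (toFunObj α S a)))
  rwa [mul_one] at this

lemma actₗ_one (M : RightMod (funAlg α S)) (m : M.X.V) : actₗ M 1 m = m := by
  have h := LinearMap.congr_fun (congrArg Hom.toLin M.act_one)
    (tm m (one _) : (tensor M.X (unit _)).V)
  have h1 : (actHom M).toLin (tm m (Hom.toLin (funOne α S) (one _))) = m :=
    h.trans (rightUnitorIso_tm m)
  rwa [funOne_one] at h1

/-- Associativity of the right action. The constraint contributes only `α(x,1,1) = 1`, but this is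
known on homogeneous vectors, hence the induction on `m`. -/
lemma actₗ_mul (M : RightMod (funAlg α S)) (a b : S → k) (m : M.X.V) :
    actₗ M (a * b) m = actₗ M b (actₗ M a m) := by
  induction m using induction with
  | h x m hm =>
    have h := LinearMap.congr_fun (congrArg Hom.toLin M.act_assoc)
      (tm m (tm (toFunObj α S a) (toFunObj α S b)) :
        (tensor M.X (tensor (funObj α S) (funObj α S))).V)
    have h1 : (actHom M).toLin (tm m ((funMulHom α S).toLin (tm (toFunObj α S a)
        (toFunObj α S b)))) = (actHom M).toLin ((tensorMap (actHom M) (𝟙 (funObj α S))).toLin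
          (Hom.toLin (assocIso M.X (funObj α S) (funObj α S)).inv
            (tm m (tm (toFunObj α S a) (toFunObj α S b))))) := h
    rw [assocIso_inv_tm hm (toFunObj_mem _) (toFunObj_mem _), map_smul, map_smul,
      tensorMap_tm, funMulHom_tm] at h1
    rw [show (α.conjDatum (MonoidHom.id G)).α x 1 1 = 1 from α.one_right _ _, Units.val_one,
      one_smul] at h1
    exact h1
  | h0 => simp
  | hadd v w hv hw => simp only [map_add, hv, hw]

/-- Equivariance of the action map, in which the tensor scalar `α(g|x,1)` is `1`. It is what makes
`M` an equivariant family over `S`. -/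
lemma ρ_actₗ (M : RightMod (funAlg α S)) (g : G) (a : S → k) (m : M.X.V) :
    M.X.ρ g (actₗ M a m) = actₗ M (fun s => a (g⁻¹ • s)) (M.X.ρ g m) := by
  induction m using induction with
  | h x m hm =>
    have h := (actHom M).comm g (tm m (toFunObj α S a))
    have h1 : (actHom M).toLin ((tensor M.X (funObj α S)).ρ g (tm m (toFunObj α S a))) =
      M.X.ρ g (actₗ M a m) := h
    rw [conj_ρ_tm g hm (toFunObj_mem _), α.conj₁_one_right, Units.val_one, one_smul,
      funObj_ρ] at h1
    exact h1.symm
  | h0 => simp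
  | hadd v w hv hw => simp only [map_add, hv, hw]

lemma hom_actₗ {M N : RightMod (funAlg α S)} (f : M ⟶ N) (a : S → k) (m : M.X.V) :
    Hom.toLin f.hom (actₗ M a m) = actₗ N a (Hom.toLin f.hom m) :=
  LinearMap.congr_fun (congrArg Hom.toLin f.act_hom)
    (tm m (toFunObj α S a) : (tensor M.X (funObj α S)).V)

/-- A morphism of modules from an equivariant linear map. -/
def modHom {M N : RightMod (funAlg α S)} (f : M.X ⟶ N.X)
    (h : ∀ a m, f.toLin (actₗ M a m) = actₗ N a (f.toLin m)) : M ⟶ N where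
  hom := f
  act_hom := hom_ext _ _ <| tm_ext (X := M.X) (Y := funObj α S) fun _ m _ _ a _ => h a m

/-- The linear map `m ⊗ a ↦ A a m`. -/
noncomputable def liftAct {X : GrRep (α.conjDatum (MonoidHom.id G))}
    (A : (S → k) →ₗ[k] X.V →ₗ[k] X.V) : (tensor X (funObj α S)).V →ₗ[k] X.V :=
  TensorProduct.lift A.flip

/-- A module from an action of functions by graded equivariant linear maps. -/
noncomputable def modMk (X : GrRep (α.conjDatum (MonoidHom.id G))) (A : (S → k) →ₗ[k] X.V →ₗ[k] X.V)
    (hmem : ∀ a x, ∀ m ∈ X.deg x, A a m ∈ X.deg x) (h1 : ∀ m, A 1 m = m)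
    (hmul : ∀ a b m, A (a * b) m = A b (A a m))
    (hρ : ∀ g a m, X.ρ g (A a m) = A (fun s => a (g⁻¹ • s)) (X.ρ g m)) :
    RightMod (funAlg α S) :=
  let act : tensor X (funObj α S) ⟶ X :=
    { toLin := liftAct A
      map_mem := tm_le (X := X) (Y := funObj α S) (f := liftAct A)
        fun x m hm y a ha => by
          rcases funObj_cases ha with rfl | rfl
          · rw [mul_one]; exact hmem a x m hm
          · rw [tm_zero, map_zero]; exact Submodule.zero_mem _
      comm := fun g t => by
        have : liftAct A ∘ₗ ((tensor X (funObj α S)).ρ g).toLinearMap =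
            (X.ρ g).toLinearMap ∘ₗ liftAct A :=
          tm_ext fun x m hm y a ha => by
            rcases funObj_cases ha with rfl | rfl
            · simp only [LinearMap.comp_apply, LinearEquiv.coe_coe]
              rw [conj_ρ_tm g hm ha, α.conj₁_one_right, Units.val_one, one_smul]
              exact (hρ g a m).symm
            · simp [tm_zero]
        exact LinearMap.congr_fun this t }
  { X := X
    act := act
    act_one := hom_ext _ _ <| tm_unit_ext (X := X) fun x m hm => by
      change act.toLin (tm m (Hom.toLin (funOne α S) (one _))) =
        Hom.toLin (rightUnitorIso X).hom (tm m (one _))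
      rw [funOne_one, rightUnitorIso_tm]
      exact h1 m
    act_assoc := hom_ext _ _ <| tm_ext₃' (X := X) (Y := funObj α S) (Z := funObj α S)
      fun x m hm y a ha z b hb => by
        change act.toLin (tm m ((funMulHom α S).toLin (tm a b))) =
          act.toLin ((tensorMap act (𝟙 (funObj α S))).toLin
            (Hom.toLin (assocIso X (funObj α S) (funObj α S)).inv (tm m (tm a b))))
        -- The degree of `b` alone decides: either it is `1`, and then `α(x,y,1) = 1`, or `b = 0`.
        rcases funObj_cases hb with rfl | rfl
        · rw [assocIso_inv_tm hm ha hb,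
            show (α.conjDatum (MonoidHom.id G)).α x y 1 = 1 from α.one_right _ _,
            Units.val_one, one_smul, tensorMap_tm]
          exact (congrArg (fun t => act.toLin (tm m t)) (funMulHom_tm α S a b)).trans (hmul a b m)
        · simp only [tm_zero, map_zero] }

/-- The indicator function of a point. -/
noncomputable def indic (k : Type u) [Field k] {S : Type u} (s : S) : S → k := Pi.single s 1

lemma indic_self (s : S) : indic k s s = 1 := Pi.single_eq_same _ _

lemma indic_ne {s t : S} (h : t ≠ s) : indic k s t = 0 := Pi.single_eq_of_ne h _

lemma mul_indic (a : S → k) (s : S) : a * indic k s = a s • indic k s := by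
  ext t
  by_cases h : t = s
  · subst h; simp
  · simp [indic_ne h]

lemma indic_mul (a : S → k) (s : S) : indic k s * a = a s • indic k s := by
  rw [mul_comm, mul_indic]

lemma sum_indic : ∑ s : S, indic k s = (1 : S → k) := by
  ext t
  rw [Finset.sum_apply, Finset.sum_eq_single t, indic_self]; · rfl
  · intro s _ hs; exact indic_ne hs.symm
  · simp

lemma indic_smul (g : G) (s : S) : (fun t => indic k s (g⁻¹ • t)) = indic k (g • s) := by
  ext t
  by_cases h : t = g • s
  · subst h; simp [indic_self]
  · rw [indic_ne h, indic_ne]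
    rintro rfl
    simp at h

/-- The element `g` carries the component over `s` to the component over `g • s`. -/
lemma ρ_indic (M : RightMod (funAlg α S)) (g : G) (s : S) (m : M.X.V) :
    M.X.ρ g (actₗ M (indic k s) m) = actₗ M (indic k (g • s)) (M.X.ρ g m) := by
  rw [ρ_actₗ, indic_smul]

/-- The indicators form a partition of unity, so `m` is the sum of its components over the points of
`S`. -/
lemma sum_indic_act (M : RightMod (funAlg α S)) (m : M.X.V) :
    ∑ s, actₗ M (indic k s) m = m := by
  rw [← LinearMap.sum_apply, ← map_sum, sum_indic, actₗ_one]

end GrRep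
end ModuleAction

/-! ### The fibre over the trivial coset; it is a fully faithful functor -/

section FibreFunctor

open CategoryTheory Limits MonoidalCategory TensorProduct

open scoped Classical

attribute [local instance] Fintype.ofFinite

namespace GrRep

variable {k G : Type u} [Field k] [Group G] [Finite G] {α : Cocycle3 k G} {H : Subgroup G}

/-- The trivial coset. -/
def baseCoset (H : Subgroup G) : G ⧸ H := QuotientGroup.mk 1

lemma smul_baseCoset (g : G) : g • baseCoset H = QuotientGroup.mk g :=
  congrArg QuotientGroup.mk (mul_one g)

lemma smul_baseCoset_eq_iff {g : G} : g • baseCoset H = baseCoset H ↔ g ∈ H := by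
  rw [smul_baseCoset, baseCoset, eq_comm, QuotientGroup.eq]
  simp

lemma coe_smul_baseCoset (h : H) : (h : G) • baseCoset H = baseCoset H :=
  smul_baseCoset_eq_iff.2 h.2

section

variable (M : RightMod (cosetAlg α H))

/-- The image of the idempotent attached to the trivial coset. -/
noncomputable def fib : Submodule k M.X.V :=
  -- The image of an idempotent is its space of fixed vectors; written as a kernel, membership is a
  -- single equation.
  LinearMap.ker (actₗ M (indic k (baseCoset H)) - LinearMap.id)

variable {M}

lemma mem_fib {m : M.X.V} : m ∈ fib M ↔ actₗ M (indic k (baseCoset H)) m = m := by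
  rw [fib, LinearMap.mem_ker, LinearMap.sub_apply, sub_eq_zero]; rfl

lemma act_base_mem (m : M.X.V) : actₗ M (indic k (baseCoset H)) m ∈ fib M := by
  rw [mem_fib, ← actₗ_mul, mul_indic, indic_self, one_smul]

/-- Multiplying `a` by the indicator of the trivial coset gives `a (baseCoset H)` times that
indicator, which fixes the fibre. -/
lemma act_fib (a : G ⧸ H → k) {m : M.X.V} (hm : m ∈ fib M) :
    actₗ M a m = a (baseCoset H) • m := by
  conv_lhs => rw [← mem_fib.1 hm]
  rw [← actₗ_mul, indic_mul, map_smul, LinearMap.smul_apply, mem_fib.1 hm]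

/-- The translate by `g` of the fibre lies over `g • baseCoset H`, where `a` acts by its value at
that coset. -/
lemma act_ρ_fib (a : G ⧸ H → k) (g : G) {m : M.X.V} (hm : m ∈ fib M) :
    actₗ M a (M.X.ρ g m) = a (g • baseCoset H) • M.X.ρ g m := by
  conv_lhs => rw [← mem_fib.1 hm, ρ_indic, ← actₗ_mul, indic_mul, map_smul, LinearMap.smul_apply,
    ← ρ_indic, mem_fib.1 hm]

lemma ρ_fib {h : G} (hh : h ∈ H) {m : M.X.V} (hm : m ∈ fib M) : M.X.ρ h m ∈ fib M := by
  rw [mem_fib, act_ρ_fib _ h hm, smul_baseCoset_eq_iff.2 hh, indic_self, one_smul]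

/-- The inverse of `ρ g` appears here instead of `ρ g⁻¹`: for a projective action the two differ by
scalars depending on the degree. -/
lemma act_base_ρ_symm (g : G) (m : M.X.V) :
    actₗ M (indic k (baseCoset H)) ((M.X.ρ g).symm m) =
      (M.X.ρ g).symm (actₗ M (indic k (g • baseCoset H)) m) := by
  apply (M.X.ρ g).injective
  rw [ρ_indic, LinearEquiv.apply_symm_apply, LinearEquiv.apply_symm_apply]

lemma proj_actₗ (a : G ⧸ H → k) (x : G) (m : M.X.V) :
    M.X.proj x (actₗ M a m) = actₗ M a (M.X.proj x m) := by
  induction m using induction with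
  | h y v hv =>
    by_cases h : y = x
    · subst h; rw [M.X.proj_same hv, M.X.proj_same (actₗ_mem M a hv)]
    · rw [M.X.proj_ne hv h, M.X.proj_ne (actₗ_mem M a hv) h, map_zero]
  | h0 => simp
  | hadd v w hv hw => simp only [map_add, hv, hw]

/-- The idempotent preserves degrees, so the fibre is a graded subspace. -/
lemma proj_fib (x : G) {m : M.X.V} (hm : m ∈ fib M) : M.X.proj x m ∈ fib M := by
  rw [mem_fib, ← proj_actₗ, mem_fib.1 hm]

lemma map_ρ_fib (h : H) : (fib M).map (M.X.ρ (h : G)).toLinearMap = fib M := by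
  apply le_antisymm
  · rintro _ ⟨m, hm, rfl⟩; exact ρ_fib h.2 hm
  · intro m hm
    refine ⟨(M.X.ρ (h : G)).symm m, ?_, by simp⟩
    rw [SetLike.mem_coe, mem_fib, act_base_ρ_symm, coe_smul_baseCoset, mem_fib.1 hm]

variable (M)

/-- The fibre of a module at the trivial coset. -/
noncomputable def fibObj : CCat α H where
  V := fib M
  deg x := (M.X.deg x).comap (fib M).subtype
  isInternal := isInternal_of_proj _
    (fun x => (M.X.proj x).restrict fun _ hm => proj_fib x hm)
    (fun x _ => M.X.proj_mem x _)
    (fun x _ hv => Subtype.ext (M.X.proj_same hv))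
    (fun x y hxy _ hv => Subtype.ext (M.X.proj_ne hv hxy))
    (fun v => by
      apply Subtype.ext
      rw [Submodule.coe_sum]
      exact M.X.sum_proj (v : M.X.V))
  ρ h := (M.X.ρ (h : G)).ofSubmodules _ _ (map_ρ_fib h)
  map_deg h x := by
    ext v
    constructor
    · rintro ⟨w, hw, rfl⟩
      exact M.X.ρ_mem (h : G) hw
    · intro hv
      refine ⟨((M.X.ρ (h : G)).ofSubmodules _ _ (map_ρ_fib h)).symm v, ?_,
        LinearEquiv.apply_symm_apply _ _⟩
      have hv' : (v : M.X.V) ∈ M.X.deg ((α.conjDatum (MonoidHom.id G)).act (h : G) x) := hv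
      have := M.X.ρ_symm_mem (h : G) hv'
      rwa [← MulAut.mul_apply, ← map_mul, inv_mul_cancel, map_one] at this
  ρ_mul f g x v hv := Subtype.ext (M.X.ρ_mul (f : G) g x v hv)

/-- The inclusion of the fibre. -/
noncomputable def fibι : (fibObj M).V →ₗ[k] M.X.V := (fib M).subtype

/-- The projection to the fibre. -/
noncomputable def fibπ : M.X.V →ₗ[k] (fibObj M).V :=
  (actₗ M (indic k (baseCoset H))).codRestrict (fib M) act_base_mem

variable {M}

lemma fibι_injective : Function.Injective (fibι M) := Subtype.val_injective

lemma fibι_mem (v : (fibObj M).V) : fibι M v ∈ fib M := v.2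

lemma fibι_π (m : M.X.V) : fibι M (fibπ M m) = actₗ M (indic k (baseCoset H)) m := rfl

lemma fibπ_ι (v : (fibObj M).V) : fibπ M (fibι M v) = v :=
  fibι_injective (mem_fib.1 (fibι_mem v))

lemma fibι_π_of_mem {m : M.X.V} (hm : m ∈ fib M) : fibι M (fibπ M m) = m := mem_fib.1 hm

lemma fibι_mem_deg {x : G} {v : (fibObj M).V} : fibι M v ∈ M.X.deg x ↔ v ∈ (fibObj M).deg x :=
  Iff.rfl

lemma fibπ_mem_deg {x : G} {m : M.X.V} (hm : m ∈ M.X.deg x) : fibπ M m ∈ (fibObj M).deg x :=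
  fibι_mem_deg.1 (actₗ_mem M _ hm)

lemma fibι_ρ (h : H) (v : (fibObj M).V) : fibι M ((fibObj M).ρ h v) = M.X.ρ (h : G) (fibι M v) :=
  rfl

lemma actₗ_fibι (a : G ⧸ H → k) (v : (fibObj M).V) :
    actₗ M a (fibι M v) = a (baseCoset H) • fibι M v := act_fib a (fibι_mem v)

/-- Linear maps out of a module are determined by their values on the translates of the fibre. -/
lemma fib_ext {W : Type u} [AddCommGroup W] [Module k W] {f g : M.X.V →ₗ[k] W}
    (h : ∀ (t x : G), ∀ v ∈ (fibObj M).deg x,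
      f (M.X.ρ t (fibι M v)) = g (M.X.ρ t (fibι M v))) : f = g := by
  refine lin_ext fun x m hm => ?_
  rw [← sum_indic_act M m, map_sum, map_sum]
  refine Finset.sum_congr rfl fun s _ => ?_
  obtain ⟨t, rfl⟩ := QuotientGroup.mk_surjective s
  rw [← smul_baseCoset]
  -- The component of `m` over `t • baseCoset H` is `t` applied to the component of `t⁻¹(m)` over
  -- the trivial coset, with `t⁻¹` the inverse operator.
  have h1 : actₗ M (indic k (t • baseCoset H)) m =
      M.X.ρ t (fibι M (fibπ M ((M.X.ρ t).symm m))) := by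
    rw [fibι_π, act_base_ρ_symm, LinearEquiv.apply_symm_apply]
  rw [h1]
  exact h t _ _ (fibπ_mem_deg (M.X.ρ_symm_mem t hm))

end

variable {M N P : RightMod (cosetAlg α H)}

lemma hom_fib (f : M ⟶ N) {m : M.X.V} (hm : m ∈ fib M) : Hom.toLin f.hom m ∈ fib N := by
  rw [mem_fib, ← hom_actₗ, mem_fib.1 hm]

/-- The map on fibres induced by a morphism of modules. -/
noncomputable def fibMap (f : M ⟶ N) : fibObj M ⟶ fibObj N where
  toLin := (Hom.toLin f.hom).restrict fun _ hm => hom_fib f hm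
  map_mem x _ hv := Hom.map_mem f.hom x _ hv
  comm h _ := Subtype.ext (Hom.comm f.hom (h : G) _)

lemma fibι_map (f : M ⟶ N) (v : (fibObj M).V) :
    fibι N ((fibMap f).toLin v) = Hom.toLin f.hom (fibι M v) := rfl

/-- The extension of a linear map between fibres. -/
noncomputable def extLin (f : (fibObj M).V →ₗ[k] (fibObj N).V) : M.X.V →ₗ[k] N.X.V :=
  -- On the component over each coset: move to the fibre by a chosen representative, apply `f`, move
  -- back. For `f` a morphism the choice does not matter, by `extLin_ρ`.
  ∑ s : G ⧸ H, (N.X.ρ s.out).toLinearMap ∘ₗ fibι N ∘ₗ f ∘ₗ fibπ M ∘ₗ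
    (M.X.ρ s.out).symm.toLinearMap

/-- The vector `t.v` lies over `t • baseCoset H`, hence has no component over the different coset `s
• baseCoset H`, which is the one that `s` moves back to the trivial coset. -/
lemma fibπ_ρ_symm_ρ {s t : G} (h : t • baseCoset H ≠ s • baseCoset H) (v : (fibObj M).V) :
    fibπ M ((M.X.ρ s).symm (M.X.ρ t (fibι M v))) = 0 := by
  apply fibι_injective
  rw [fibι_π, act_base_ρ_symm, act_ρ_fib _ _ (fibι_mem v), indic_ne h, zero_smul, map_zero,
    map_zero]

/-- Only the summand of the coset of `t` survives. Write `t = s h` with `s` the chosen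
representative and `h ∈ H`. Since `f` preserves degrees, the same scalar `α(s,h|x)` arises in `M`
and in `N`, and `f` commutes with `h`. -/
lemma extLin_ρ (f : fibObj M ⟶ fibObj N) (t : G) {x : G} {v : (fibObj M).V}
    (hv : v ∈ (fibObj M).deg x) :
    extLin f.toLin (M.X.ρ t (fibι M v)) = N.X.ρ t (fibι N (f.toLin v)) := by
  rw [extLin, LinearMap.sum_apply, Finset.sum_eq_single (QuotientGroup.mk t)]
  · obtain ⟨h, hh⟩ : ∃ h : H, t = (QuotientGroup.mk t : G ⧸ H).out * h :=
      ⟨⟨(QuotientGroup.mk t : G ⧸ H).out⁻¹ * t,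
        QuotientGroup.eq.1 (QuotientGroup.out_eq' (QuotientGroup.mk t : G ⧸ H))⟩, by simp⟩
    -- The representative becomes an arbitrary `s`; otherwise it would depend on `t`, and `t = s *
    -- h` could not be substituted.
    generalize (QuotientGroup.mk t : G ⧸ H).out = s at hh ⊢
    subst hh
    rw [conj_ρ_mul s h (fibι_mem_deg.2 hv), conj_ρ_mul s h (fibι_mem_deg.2 (f.map_mem x v hv)),
      ← fibι_ρ, ← fibι_ρ, ← f.comm]
    simp only [LinearMap.comp_apply, LinearEquiv.coe_coe, map_smul,
      LinearEquiv.symm_apply_apply, fibπ_ι]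
  · intro s _ hs
    simp only [LinearMap.comp_apply, LinearEquiv.coe_coe]
    rw [fibπ_ρ_symm_ρ, map_zero, map_zero, map_zero]
    rw [smul_baseCoset, smul_baseCoset, QuotientGroup.out_eq']
    exact hs.symm
  · simp

/-- The extension of a morphism between fibres to a morphism of modules. -/
noncomputable def extHom (f : fibObj M ⟶ fibObj N) : M ⟶ N :=
  modHom
    { toLin := extLin f.toLin
      map_mem := fun x m hm => by
        rw [extLin, LinearMap.sum_apply]
        refine Submodule.sum_mem _ fun s _ => ?_
        have := N.X.ρ_mem s.out (fibι_mem_deg.2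
          (f.map_mem _ _ (fibπ_mem_deg (M.X.ρ_symm_mem s.out hm))))
        rwa [← MulAut.mul_apply, ← map_mul, mul_inv_cancel, map_one] at this
      comm := fun g m => by
        have : extLin f.toLin ∘ₗ (M.X.ρ g).toLinearMap =
            (N.X.ρ g).toLinearMap ∘ₗ extLin f.toLin := fib_ext fun t x v hv => by
          simp only [LinearMap.comp_apply, LinearEquiv.coe_coe]
          have h1 := conj_ρ_mul g t (fibι_mem_deg.2 hv)
          have h2 := conj_ρ_mul g t (fibι_mem_deg.2 (f.map_mem x v hv))
          -- The image of `(g t).v` is computed in two ways. The scalar `α(g,t|x)` occurs in both,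
          -- since `f` preserves degrees, and being a unit it cancels.
          have h3 := congrArg (extLin f.toLin) h1
          rw [extLin_ρ f _ hv, h2, map_smul] at h3
          rw [extLin_ρ f _ hv]
          exact (smul_right_injective _ (Units.ne_zero _) h3).symm
        exact LinearMap.congr_fun this m }
    (fun a m => by
      have : extLin f.toLin ∘ₗ actₗ M a = actₗ N a ∘ₗ extLin f.toLin :=
        fib_ext fun t x v hv => by
          simp only [LinearMap.comp_apply]
          rw [act_ρ_fib a t (fibι_mem v), map_smul, extLin_ρ f _ hv, act_ρ_fib a t (fibι_mem _)]
      exact LinearMap.congr_fun this m)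

/-- The case `t = 1` of `extLin_ρ`; this gives fullness. -/
lemma fibMap_extHom (f : fibObj M ⟶ fibObj N) : fibMap (extHom f) = f :=
  hom_ext _ _ <| lin_ext fun x v hv => fibι_injective <| by
    have h := extLin_ρ f 1 hv
    rw [ρ_one, ρ_one] at h
    exact h

/-- The translates of the fibre span `M`, and a morphism is determined on them by equivariance. -/
lemma fibMap_injective {f g : M ⟶ N} (h : fibMap f = fibMap g) : f = g :=
  RightMod.hom_ext _ _ <| hom_ext _ _ <| fib_ext fun t x v _ => by
    rw [Hom.comm f.hom, Hom.comm g.hom, ← fibι_map, ← fibι_map, h]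

variable (α H) in
/-- The functor sending a module to its fibre at the trivial coset. -/
noncomputable def fibFunctor : RightMod (cosetAlg α H) ⥤ CCat α H where
  obj := fibObj
  map := fibMap

instance : (fibFunctor α H).Faithful where
  map_injective h := fibMap_injective h

instance : (fibFunctor α H).Full where
  map_surjective f := ⟨extHom f, fibMap_extHom f⟩

end GrRep
end FibreFunctor

/-! ### Twisted coinduction; the fibre functor is essentially surjective -/

section Coinduction

open CategoryTheory Limits MonoidalCategory TensorProduct

open scoped Classical

attribute [local instance] Fintype.ofFinite

namespace GrRep

variable {k G : Type u} [Field k] [Group G] [Finite G] {α : Cocycle3 k G} {H : Subgroup G}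

/-- The cocycle identity of `α(f,g|x)`, rearranged into the form in which the action of `G` on
coinduced functions respects `H`-equivariance. -/
lemma conj₂_inv_mul_conj₂ (f g h x : G) :
    (α.conj₂ (f * g) h x)⁻¹ * α.conj₂ f (g * h) x =
      α.conj₂ f g (h * x * h⁻¹) * (α.conj₂ g h x)⁻¹ := by
  rw [inv_mul_eq_iff_eq_mul, ← mul_assoc, ← α.conj₂_cocycle, mul_inv_cancel_right]

lemma sub_ρ_mul (V : CCat α H) (f g : H) {x : G} {v : V.V} (hv : v ∈ V.deg x) :
    V.ρ (f * g) v = (α.conj₂ f g x : k) • V.ρ f (V.ρ g v) := V.ρ_mul f g x v hv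

lemma sub_ρ_mem (V : CCat α H) (f : H) {x : G} {v : V.V} (hv : v ∈ V.deg x) :
    V.ρ f v ∈ V.deg (f * x * (f : G)⁻¹) := V.ρ_mem f hv

variable (V : CCat α H)

/-- The space underlying the coinduced object. Its element `Ψ` of degree `x` is thought of as
the function sending `g` to the component of `g.Ψ` at the trivial coset. -/
def coindSub : Submodule k (G → G → V.V) where
  -- Both conditions are forced by reading `Ψ x g` as the base component of `g.Ψ_x`: this vector has
  -- degree `g x g⁻¹`, and `(h g).Ψ_x = α(h,g|x) h.(g.Ψ_x)`.
  carrier := {Ψ | (∀ x g, Ψ x g ∈ V.deg (g * x * g⁻¹)) ∧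
    ∀ x g (h : H), Ψ x (h * g) = (α.conj₂ h g x : k) • V.ρ h (Ψ x g)}
  add_mem' ha hb := ⟨fun x g => Submodule.add_mem _ (ha.1 x g) (hb.1 x g), fun x g h => by
    simp only [Pi.add_apply, ha.2, hb.2, map_add, smul_add]⟩
  zero_mem' := ⟨fun _ _ => Submodule.zero_mem _, fun _ _ _ => by simp⟩
  smul_mem' c _ ha := ⟨fun x g => Submodule.smul_mem _ c (ha.1 x g), fun x g h => by
    simp only [Pi.smul_apply, ha.2, map_smul, smul_comm c]⟩

/-- Restriction of an element of the coinduced object to degree `x`. -/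
noncomputable def coindProj (x : G) : coindSub V →ₗ[k] coindSub V :=
  LinearMap.restrict
    ({ toFun := fun Ψ y g => if y = x then Ψ y g else 0
       map_add' := fun _ _ => by ext y g; by_cases h : y = x <;> simp [h]
       map_smul' := fun _ _ => by ext y g; by_cases h : y = x <;> simp [h] } :
      (G → G → V.V) →ₗ[k] (G → G → V.V))
    (fun Ψ hΨ => by
      constructor
      · intro y g
        by_cases h : y = x
        · simpa [h] using hΨ.1 x g
        · simp [h]
      · intro y g t
        by_cases h : y = x
        · simpa [h] using hΨ.2 x g t
        · simp [h])

lemma coindProj_apply (x y g : G) (Ψ : coindSub V) :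
    (coindProj V x Ψ).1 y g = if y = x then Ψ.1 y g else 0 := rfl

/-- The components of the coinduced object. -/
def coindDeg (x : G) : Submodule k (coindSub V) where
  carrier := {Ψ | ∀ y, y ≠ x → ∀ g, Ψ.1 y g = 0}
  add_mem' ha hb y hy g := by
    rw [Submodule.coe_add, Pi.add_apply, Pi.add_apply, ha y hy g, hb y hy g, add_zero]
  zero_mem' _ _ _ := rfl
  smul_mem' c _ ha y hy g := by
    rw [Submodule.coe_smul, Pi.smul_apply, Pi.smul_apply, ha y hy g, smul_zero]

lemma coindDeg_isInternal : DirectSum.IsInternal (coindDeg V) := by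
  refine isInternal_of_proj _ (coindProj V) ?_ ?_ ?_ ?_
  · intro x Ψ y hy g
    rw [coindProj_apply, if_neg hy]
  · intro x Ψ hΨ
    ext y g
    rw [coindProj_apply]
    split_ifs with h
    · rfl
    · exact (hΨ y h g).symm
  · intro x y hxy Ψ hΨ
    ext z g
    rw [coindProj_apply]
    split_ifs with h
    · subst h; exact hΨ z (fun e => hxy e.symm) g
    · rfl
  · intro Ψ
    ext y g
    rw [Submodule.coe_sum, Finset.sum_apply, Finset.sum_apply, Finset.sum_eq_single y]
    · rw [coindProj_apply, if_pos rfl]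
    · intro x _ hx; rw [coindProj_apply, if_neg hx.symm]
    · simp

/-- The action of `f` on the coinduced object, as a linear map. -/
noncomputable def coindLin (f : G) : coindSub V →ₗ[k] coindSub V :=
  LinearMap.restrict
    -- The part of `f.Ψ` in degree `y` comes from degree `z = f⁻¹ y f`, and `(g f).Ψ_z = α(g,f|z)
    -- g.(f.Ψ_z)`; solving for `g.(f.Ψ_z)` gives the formula.
    ({ toFun := fun Ψ y g => (((α.conj₂ g f (f⁻¹ * y * f))⁻¹ : kˣ) : k) •
        Ψ (f⁻¹ * y * f) (g * f)
       map_add' := fun _ _ => by ext y g; simp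
       map_smul' := fun c _ => by
        ext y g; simp only [Pi.smul_apply, RingHom.id_apply, smul_comm c] } :
      (G → G → V.V) →ₗ[k] (G → G → V.V))
    (fun Ψ hΨ => by
      constructor
      · intro y g
        have h := hΨ.1 (f⁻¹ * y * f) (g * f)
        rw [show g * f * (f⁻¹ * y * f) * (g * f)⁻¹ = g * y * g⁻¹ by group] at h
        exact Submodule.smul_mem _ _ h
      · intro y g t
        have h := conj₂_inv_mul_conj₂ (α := α) (t : G) g f (f⁻¹ * y * f)
        rw [show f * (f⁻¹ * y * f) * f⁻¹ = y by group] at h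
        simp only [LinearMap.coe_mk, AddHom.coe_mk, map_smul]
        rw [mul_assoc (t : G) g f, hΨ.2, smul_smul, smul_smul, ← Units.val_mul, ← Units.val_mul, h])

variable {V}

lemma coindLin_apply (f y g : G) (Ψ : coindSub V) :
    (coindLin V f Ψ).1 y g = (((α.conj₂ g f (f⁻¹ * y * f))⁻¹ : kˣ) : k) •
      Ψ.1 (f⁻¹ * y * f) (g * f) := rfl

/-- Each value of `Ψ` is, up to a unit, a value of `f.Ψ`. Since the space is finite-dimensional,
injectivity is enough to obtain an automorphism. -/
lemma coindLin_injective (f : G) : Function.Injective (coindLin V f) := by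
  rw [injective_iff_map_eq_zero]
  intro Ψ h
  ext x g
  have h1 := congrFun (congrFun (congrArg Subtype.val h) (f * x * f⁻¹)) (g * f⁻¹)
  rw [coindLin_apply, show f⁻¹ * (f * x * f⁻¹) * f = x by group,
    inv_mul_cancel_right] at h1
  exact (smul_eq_zero.1 h1).resolve_left (Units.ne_zero _)

variable (V)

/-- The coinduced object. -/
noncomputable def coindObj : ZCat α where
  V := coindSub V
  deg := coindDeg V
  isInternal := coindDeg_isInternal V
  ρ f := LinearEquiv.ofInjectiveEndo (coindLin V f) (coindLin_injective f)
  map_deg f := map_deg_of_le (coindDeg_isInternal V) _ _ fun x Ψ hΨ y hy g => by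
    refine (coindLin_apply f y g Ψ).trans ?_
    rw [hΨ, smul_zero]
    rintro rfl
    exact hy (by change y = f * (f⁻¹ * y * f) * f⁻¹; group)
  ρ_mul f g x Ψ hΨ := by
    apply Subtype.ext
    ext y t
    change (coindLin V (f * g) Ψ).1 y t = (α.conj₂ f g x : k) •
      (coindLin V f (coindLin V g Ψ)).1 y t
    rw [coindLin_apply, coindLin_apply, coindLin_apply,
      show g⁻¹ * (f⁻¹ * y * f) * g = (f * g)⁻¹ * y * (f * g) by group, ← mul_assoc t f g]
    -- As `Ψ` is concentrated in degree `x`, the only relevant `y` is the conjugate of `x` by `f g`.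
    -- There the claim is the cocycle identity at `(t,f,g,x)`; elsewhere both sides vanish.
    by_cases hx : (f * g)⁻¹ * y * (f * g) = x
    · have h := α.conj₂_cocycle t f g x
      rw [show g * x * g⁻¹ = f⁻¹ * y * f by rw [← hx]; group] at h
      rw [hx, smul_smul, smul_smul, ← Units.val_mul, ← Units.val_mul]
      congr 2
      rw [inv_eq_iff_mul_eq_one, mul_assoc, ← mul_inv, mul_comm (α.conj₂ t f _), ← h, ← mul_assoc,
        mul_inv_cancel]
    · rw [hΨ _ hx]; simp

/-- The values of an element of the coinduced object. -/
def coindVal (Ψ : (coindObj V).V) (x g : G) : V.V := Subtype.val (p := (· ∈ coindSub V)) Ψ x g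

variable {V}

lemma coindVal_ext {Φ Ψ : (coindObj V).V} (h : ∀ x g, coindVal V Φ x g = coindVal V Ψ x g) :
    Φ = Ψ := Subtype.ext (funext fun x => funext fun g => h x g)

lemma coindVal_mem (Ψ : (coindObj V).V) (x g : G) :
    coindVal V Ψ x g ∈ V.deg (g * x * g⁻¹) :=
  (Subtype.prop (p := (· ∈ coindSub V)) Ψ).1 x g

lemma coindVal_mul (Ψ : (coindObj V).V) (x g : G) (h : H) :
    coindVal V Ψ x (h * g) = (α.conj₂ h g x : k) • V.ρ h (coindVal V Ψ x g) :=
  (Subtype.prop (p := (· ∈ coindSub V)) Ψ).2 x g h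

lemma coindVal_ρ (f : G) (Ψ : (coindObj V).V) (y g : G) :
    coindVal V ((coindObj V).ρ f Ψ) y g = (((α.conj₂ g f (f⁻¹ * y * f))⁻¹ : kˣ) : k) •
      coindVal V Ψ (f⁻¹ * y * f) (g * f) := rfl

lemma mem_coindDeg {x : G} {Ψ : (coindObj V).V} :
    Ψ ∈ (coindObj V).deg x ↔ ∀ y, y ≠ x → ∀ g, coindVal V Ψ y g = 0 := Iff.rfl

variable (V) in
/-- An element of the coinduced object from its values. -/
def coindMk (Ψ : G → G → V.V) (h1 : ∀ x g, Ψ x g ∈ V.deg (g * x * g⁻¹))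
    (h2 : ∀ x g (h : H), Ψ x (h * g) = (α.conj₂ h g x : k) • V.ρ h (Ψ x g)) : (coindObj V).V :=
  (⟨Ψ, h1, h2⟩ : coindSub V)

/-- Left translation of `g` by `H` does not change `g⁻¹ • baseCoset H`, so multiplying by `a (g⁻¹ •
baseCoset H)` preserves the equivariance condition. -/
lemma inv_smul_baseCoset (h : H) (g : G) :
    ((h : G) * g)⁻¹ • baseCoset H = g⁻¹ • baseCoset H := by
  rw [mul_inv_rev, mul_smul, ← Subgroup.coe_inv, coe_smul_baseCoset]

variable (V) in
/-- The action of functions on the coinduced object. -/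
noncomputable def coindAct : (G ⧸ H → k) →ₗ[k] (coindObj V).V →ₗ[k] (coindObj V).V :=
  LinearMap.mk₂ k
    -- The base component of `g.Ψ` comes from the component of `Ψ` over `g⁻¹ • baseCoset H`, where
    -- `a` must act by its value at that coset.
    (fun a Ψ => coindMk V (fun x g => a (g⁻¹ • baseCoset H) • coindVal V Ψ x g)
      (fun x g => Submodule.smul_mem _ _ (coindVal_mem Ψ x g))
      (fun x g h => by rw [inv_smul_baseCoset, coindVal_mul, map_smul, smul_comm]))
    (fun _ _ _ => coindVal_ext fun _ _ => add_smul _ _ _)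
    (fun _ _ _ => coindVal_ext fun _ _ => mul_smul _ _ _)
    (fun _ _ _ => coindVal_ext fun _ _ => smul_add _ _ _)
    (fun _ _ _ => coindVal_ext fun _ _ => smul_comm _ _ _)

lemma coindVal_act (a : G ⧸ H → k) (Ψ : (coindObj V).V) (x g : G) :
    coindVal V (coindAct V a Ψ) x g = a (g⁻¹ • baseCoset H) • coindVal V Ψ x g := rfl

variable (V) in
/-- The coinduced module. -/
noncomputable def coindMod : RightMod (cosetAlg α H) :=
  modMk (coindObj V) (coindAct V)
    (fun a x Ψ hΨ y hy g => by
      change coindVal V (coindAct V a Ψ) y g = 0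
      rw [coindVal_act, mem_coindDeg.1 hΨ y hy, smul_zero])
    (fun Ψ => coindVal_ext fun _ _ => one_smul _ _)
    (fun a b Ψ => coindVal_ext fun x g => by
      rw [coindVal_act, coindVal_act, coindVal_act, smul_smul, mul_comm]; rfl)
    (fun f a Ψ => coindVal_ext fun x g => by
      rw [coindVal_act, coindVal_ρ, coindVal_ρ, coindVal_act, smul_comm, mul_inv_rev, mul_smul])

variable (V) in
/-- Evaluation at the neutral element. -/
noncomputable def coindEval : (fibObj (coindMod V)).V →ₗ[k] V.V where
  -- The summands lie in distinct degrees `x`, so each can be recovered from the sum.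
  toFun Ψ := ∑ x, coindVal V (fibι (coindMod V) Ψ) x 1
  map_add' Φ Ψ := by
    rw [map_add, ← Finset.sum_add_distrib]; rfl
  map_smul' c Ψ := by
    rw [map_smul, Finset.smul_sum]; rfl

/-- The indicator of the trivial coset takes the value `1` at `g⁻¹ • baseCoset H` exactly when `g ∈
H`, so the idempotent truncates functions to `H`. -/
lemma mem_fib_coind {Ψ : (coindObj V).V} :
    Ψ ∈ fib (coindMod V) ↔ ∀ x, ∀ g ∉ H, coindVal V Ψ x g = 0 := by
  have key : ∀ x g, coindVal V (coindAct V (indic k (baseCoset H)) Ψ) x g =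
      if g ∈ H then coindVal V Ψ x g else 0 := fun x g => by
    rw [coindVal_act]
    split_ifs with hg
    · rw [smul_baseCoset_eq_iff.2 (H.inv_mem hg), indic_self, one_smul]
    · rw [indic_ne, zero_smul]
      rw [Ne, smul_baseCoset_eq_iff, H.inv_mem_iff]
      exact hg
  have h1 : Ψ ∈ fib (coindMod V) ↔ coindAct V (indic k (baseCoset H)) Ψ = Ψ := mem_fib
  rw [h1]
  constructor
  · intro h x g hg
    rw [← h, key, if_neg hg]
  · intro h
    refine coindVal_ext fun x g => ?_
    rw [key]
    split_ifs with hg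
    · rfl
    · exact (h x g hg).symm

lemma coindVal_one_mem (Ψ : (coindObj V).V) (x : G) : coindVal V Ψ x 1 ∈ V.deg x := by
  have := coindVal_mem Ψ x 1
  rwa [one_mul, inv_one, mul_one] at this

/-- Equivariance at `g = 1`, where `α(h,1|x) = 1`: the value at `1` determines all values on `H`. -/
lemma coindVal_sub (Ψ : (coindObj V).V) (x : G) (h : H) :
    coindVal V Ψ x h = V.ρ h (coindVal V Ψ x 1) := by
  have := coindVal_mul Ψ x 1 h
  rwa [mul_one, α.conj₂_one_mid, Units.val_one, one_smul] at this

lemma proj_coindEval (Ψ : (fibObj (coindMod V)).V) (x : G) :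
    V.proj x (coindEval V Ψ) = coindVal V (fibι (coindMod V) Ψ) x 1 := by
  change V.proj x (∑ x, coindVal V (fibι (coindMod V) Ψ) x 1) = _
  rw [map_sum, Finset.sum_eq_single x]
  · exact V.proj_same (coindVal_one_mem _ _)
  · intro y _ hy; exact V.proj_ne (coindVal_one_mem _ _) hy
  · simp

/-- An element of the fibre vanishes off `H`, and on `H` it is determined by its values at `1`,
which are the homogeneous components of the evaluation. -/
lemma coindEval_injective : Function.Injective (coindEval V) := by
  intro Φ Ψ h
  refine fibι_injective (coindVal_ext fun x g => ?_)
  by_cases hg : g ∈ H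
  · have h1 := proj_coindEval Φ x
    rw [h, proj_coindEval] at h1
    exact (coindVal_sub _ x ⟨g, hg⟩).trans ((congrArg (V.ρ ⟨g, hg⟩) h1.symm).trans
      (coindVal_sub _ x ⟨g, hg⟩).symm)
  · exact (mem_fib_coind.1 (fibι_mem Φ) x g hg).trans (mem_fib_coind.1 (fibι_mem Ψ) x g hg).symm

variable (V) in
/-- The section of the evaluation map. -/
noncomputable def coindSec (v : V.V) : (coindObj V).V :=
  coindMk V (fun x g => if hg : g ∈ H then V.ρ ⟨g, hg⟩ (V.proj x v) else 0)
    (fun x g => by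
      split_ifs with hg
      · exact sub_ρ_mem V ⟨g, hg⟩ (V.proj_mem x v)
      · exact Submodule.zero_mem _)
    (fun x g h => by
      by_cases hg : g ∈ H
      · rw [dif_pos hg, dif_pos (H.mul_mem h.2 hg)]
        exact sub_ρ_mul V h ⟨g, hg⟩ (V.proj_mem x v)
      · rw [dif_neg hg, dif_neg (fun h' => hg ((H.mul_mem_cancel_left h.2).1 h')), map_zero,
          smul_zero])

lemma coindVal_sec (v : V.V) (x g : G) : coindVal V (coindSec V v) x g =
    if hg : g ∈ H then V.ρ ⟨g, hg⟩ (V.proj x v) else 0 := rfl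

lemma coindEval_surjective : Function.Surjective (coindEval V) := by
  intro v
  have h : coindSec V v ∈ fib (coindMod V) := mem_fib_coind.2 fun x g hg => by
    rw [coindVal_sec, dif_neg hg]
  refine ⟨fibπ (coindMod V) (coindSec V v), ?_⟩
  have h1 : fibι (coindMod V) (fibπ (coindMod V) (coindSec V v)) = coindSec V v :=
    fibι_π_of_mem h
  change ∑ x, coindVal V (fibι (coindMod V) _) x 1 = v
  rw [h1]
  refine (Finset.sum_congr rfl fun x _ => ?_).trans (V.sum_proj v)
  rw [coindVal_sec, dif_pos H.one_mem]
  exact V.ρ_one _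

variable (V) in
/-- The fibre of the coinduced module. -/
noncomputable def fibCoindIso : fibObj (coindMod V) ≅ V :=
  isoMk (LinearEquiv.ofBijective (coindEval V) ⟨coindEval_injective, coindEval_surjective⟩)
    (fun x Ψ hΨ => by
      change ∑ y, coindVal V (fibι (coindMod V) Ψ) y 1 ∈ V.deg x
      rw [Finset.sum_eq_single x]
      · exact coindVal_one_mem _ _
      · intro y _ hy
        exact (mem_coindDeg (Ψ := fibι (coindMod V) Ψ)).1 hΨ y hy 1
      · simp)
    (fun h => by
      ext Ψ
      change ∑ y, coindVal V ((coindObj V).ρ (h : G) (fibι (coindMod V) Ψ)) y 1 =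
        V.ρ h (∑ y, coindVal V (fibι (coindMod V) Ψ) y 1)
      rw [map_sum]
      -- Acting by `h` conjugates degrees, so the sums over degrees match after reindexing by
      -- conjugation; the scalar left over is `α(1,h|·) = 1`.
      refine Finset.sum_nbij' (fun y => (h : G)⁻¹ * y * h) (fun y => (h : G) * y * (h : G)⁻¹)
        (fun _ _ => Finset.mem_univ _) (fun _ _ => Finset.mem_univ _)
        (fun _ _ => by group) (fun _ _ => by group) (fun y _ => ?_)
      refine (coindVal_ρ (h : G) (fibι (coindMod V) Ψ) y 1).trans ?_
      rw [one_mul, α.conj₂_one_left, inv_one, Units.val_one, one_smul]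
      exact coindVal_sub _ _ h)

instance : (fibFunctor α H).EssSurj where
  mem_essImage V := ⟨coindMod V, ⟨fibCoindIso V⟩⟩

instance : (fibFunctor α H).IsEquivalence where

end GrRep
end Coinduction

/-! ### Elements of the relative tensor product -/

section RelativeTensor

open CategoryTheory Limits MonoidalCategory TensorProduct

open scoped Classical

attribute [local instance] Fintype.ofFinite

namespace GrRep

section

variable {k F G : Type u} [Field k] [Group F] [Group G] [Finite G]
  {T : TwistDatum k F G} {X Y : GrRep T} (f g : X ⟶ Y)

/-- The comparison between the chosen coequalizer and the explicit one. -/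
noncomputable def coequalizerToCoeq : coequalizer f g ⟶ coeq f g :=
  coequalizer.desc (coeqπ f g) (coeq_condition f g)

lemma coequalizerToCoeq_π (v : Y.V) :
    Hom.toLin (coequalizerToCoeq f g) (Hom.toLin (coequalizer.π f g) v) = (coeqRel f g).mkQ v :=
  LinearMap.congr_fun (congrArg Hom.toLin
    (coequalizer.π_desc (coeqπ f g) (coeq_condition f g))) v

/-- The chosen coequalizer is known only by its universal property. Its projection factors through
the explicit quotient, and the comparison map shows that the factor is onto. -/
lemma coequalizer_π_surjective : Function.Surjective (Hom.toLin (coequalizer.π f g)) := by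
  intro w
  let e : coeq f g ⟶ coequalizer f g := coeqDesc (coequalizer.π f g) (coequalizer.condition f g)
  have h1 : coeqπ f g ≫ e = coequalizer.π f g := rfl
  have h : coequalizerToCoeq f g ≫ e = 𝟙 _ := by
    rw [← cancel_epi (coequalizer.π f g), coequalizerToCoeq, coequalizer.π_desc_assoc, h1,
      Category.comp_id]
  obtain ⟨v, hv⟩ := (coeqRel f g).mkQ_surjective (Hom.toLin (coequalizerToCoeq f g) w)
  have h2 : Hom.toLin e (Hom.toLin (coequalizerToCoeq f g) w) = w :=
    LinearMap.congr_fun (congrArg Hom.toLin h) w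
  refine ⟨v, ?_⟩
  rw [← h2, ← hv]
  rfl

variable {f g} in
lemma coeqRel_le_ker {W : Type u} [AddCommGroup W] [Module k W] {φ : Y.V →ₗ[k] W}
    (h : ∀ v, φ (f.toLin v) = φ (g.toLin v)) : coeqRel f g ≤ LinearMap.ker φ := by
  rintro _ ⟨v, rfl⟩
  rw [LinearMap.mem_ker, LinearMap.sub_apply, map_sub, h, sub_self]

variable {f g} in
/-- Linear maps out of a coequalizer. -/
noncomputable def coequalizerLift {W : Type u} [AddCommGroup W] [Module k W] (φ : Y.V →ₗ[k] W)
    (h : ∀ v, φ (f.toLin v) = φ (g.toLin v)) : (coequalizer f g).V →ₗ[k] W :=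
  -- The map `φ` is merely linear, so the universal property among graded representations does not
  -- apply; the descent takes place on the explicit quotient.
  (coeqRel f g).liftQ φ (coeqRel_le_ker h) ∘ₗ
    Hom.toLin (coequalizerToCoeq f g)

lemma coequalizerLift_π {W : Type u} [AddCommGroup W] [Module k W] (φ : Y.V →ₗ[k] W)
    (h : ∀ v, φ (f.toLin v) = φ (g.toLin v)) (v : Y.V) :
    coequalizerLift φ h (Hom.toLin (coequalizer.π f g) v) = φ v :=
  (congrArg ((coeqRel f g).liftQ φ (coeqRel_le_ker h)) (coequalizerToCoeq_π f g v)).trans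
    (Submodule.liftQ_apply _ _ _)

end

variable {k G : Type u} [Field k] [Group G] [Finite G] {α : Cocycle3 k G}
  {S : Type u} [Finite S] [MulAction G S]

section

variable (M N : RightMod (funAlg α S))

/-- The projection to the relative tensor product. -/
noncomputable def relπ : tensor M.X N.X ⟶ (M ⊗ N : RightMod (funAlg α S)).X := RightMod.π M N

variable {M N} in
/-- The class of `m ⊗ n` in the relative tensor product. -/
noncomputable def relTm (m : M.X.V) (n : N.X.V) : (M ⊗ N : RightMod (funAlg α S)).X.V :=
  (relπ M N).toLin (tm m n)

lemma relπ_surjective : Function.Surjective (relπ M N).toLin :=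
  coequalizer_π_surjective (Y := tensor M.X N.X) _ _

/-- The left action of the function algebra. -/
noncomputable def actLeftHom : tensor (funObj α S) N.X ⟶ N.X :=
  (braid (funObj α S) N.X).hom ≫ actHom N

/-- A function has degree `1`, so braiding it past `n` is the plain flip and the left action agrees
with the right one. -/
lemma actLeftHom_tm (a : S → k) (n : N.X.V) :
    (actLeftHom N).toLin (tm (toFunObj α S a) n) = actₗ N a n := by
  change (actHom N).toLin (Hom.toLin (braid (funObj α S) N.X).hom (tm (toFunObj α S a) n)) = _
  rw [braid_tm (toFunObj_mem _), ρ_one]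
  rfl

variable {M N}

lemma relTm_mem {x y : G} {m : M.X.V} (hm : m ∈ M.X.deg x) {n : N.X.V} (hn : n ∈ N.X.deg y) :
    relTm m n ∈ (M ⊗ N : RightMod (funAlg α S)).X.deg (x * y) :=
  (relπ M N).map_mem _ _ (tm_mem hm hn)

lemma relTm_ρ (g : G) {x y : G} {m : M.X.V} (hm : m ∈ M.X.deg x) {n : N.X.V}
    (hn : n ∈ N.X.deg y) : (M ⊗ N : RightMod (funAlg α S)).X.ρ g (relTm m n) =
      (α.conj₁ g x y : k) • relTm (M.X.ρ g m) (N.X.ρ g n) := by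
  rw [relTm, ← (relπ M N).comm, conj_ρ_tm g hm hn, map_smul]; rfl

/-- This is the second of the two maps coequalized in `M ⊗_A N`. No scalar appears, because
`α(x,1,y) = 1`. -/
lemma tensor_assoc_act {x : G} {m : M.X.V} (hm : m ∈ M.X.deg x) {y : G} {n : N.X.V}
    (hn : n ∈ N.X.deg y) (a : S → k) :
    Hom.toLin (tensorMap (𝟙 M.X) (actLeftHom N)) (Hom.toLin (assocIso M.X (funObj α S) N.X).hom
      (tm (tm m (toFunObj α S a)) n)) = tm m (actₗ N a n) := by
  rw [assocIso_hom_tm hm (toFunObj_mem _) hn,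
    show (α.conjDatum (MonoidHom.id G)).α x 1 y = 1 from α.one_mid _ _, inv_one, Units.val_one,
    one_smul, tensorMap_tm, actLeftHom_tm]
  rfl

/-- Linear maps out of the relative tensor product. -/
noncomputable def relLift {W : Type u} [AddCommGroup W] [Module k W]
    (φ : (tensor M.X N.X).V →ₗ[k] W)
    (h : ∀ (a : S → k) m n, φ (tm (actₗ M a m) n) = φ (tm m (actₗ N a n))) :
    (M ⊗ N : RightMod (funAlg α S)).X.V →ₗ[k] W :=
  coequalizerLift (X := tensor (tensor M.X (funObj α S)) N.X) (Y := tensor M.X N.X)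
    (f := tensorMap (actHom M) (𝟙 N.X))
    (g := (assocIso M.X (funObj α S) N.X).hom ≫ tensorMap (𝟙 M.X) (actLeftHom N)) φ
    (fun v => by
      have : φ ∘ₗ (tensorMap (actHom M) (𝟙 N.X)).toLin = φ ∘ₗ
          Hom.toLin ((assocIso M.X (funObj α S) N.X).hom ≫ tensorMap (𝟙 M.X) (actLeftHom N)) :=
        tm_ext₃ fun x m hm _ a _ y n hn =>
          (h a m n).trans (congrArg φ (tensor_assoc_act hm hn a).symm)
      exact LinearMap.congr_fun this v)

lemma relLift_relTm {W : Type u} [AddCommGroup W] [Module k W]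
    (φ : (tensor M.X N.X).V →ₗ[k] W)
    (h : ∀ (a : S → k) m n, φ (tm (actₗ M a m) n) = φ (tm m (actₗ N a n)))
    (m : M.X.V) (n : N.X.V) : relLift φ h (relTm m n) = φ (tm m n) :=
  coequalizerLift_π (X := tensor (tensor M.X (funObj α S)) N.X) (Y := tensor M.X N.X) _ _ φ _ _

/-- The coequalizer condition on elements. The associativity constraint is explicit only on
homogeneous vectors, so the general case follows by additivity in both variables. -/
lemma relTm_balanced (a : S → k) (m : M.X.V) (n : N.X.V) :
    relTm (actₗ M a m) n = relTm m (actₗ N a n) := by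
  induction m using induction with
  | h x m hm =>
    induction n using induction with
    | h y n hn =>
      have h := LinearMap.congr_fun (congrArg Hom.toLin (RightMod.π_condition M N))
        (tm (tm m (toFunObj α S a)) n : (tensor (tensor M.X (funObj α S)) N.X).V)
      exact h.trans (congrArg (relπ M N).toLin (tensor_assoc_act hm hn a))
    | h0 => rw [map_zero]; simp only [relTm, tm_zero]
    | hadd v w hv hw =>
      rw [map_add]
      exact ((congrArg (relπ M N).toLin (TensorProduct.tmul_add _ _ _)).trans
        (map_add _ _ _)).trans ((congrArg₂ (· + ·) hv hw).trans
        ((congrArg (relπ M N).toLin (TensorProduct.tmul_add _ _ _)).trans (map_add _ _ _)).symm)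
  | h0 => rw [map_zero]; simp only [relTm, zero_tm]
  | hadd v w hv hw =>
    rw [map_add]
    exact ((congrArg (relπ M N).toLin (TensorProduct.add_tmul _ _ _)).trans
      (map_add _ _ _)).trans ((congrArg₂ (· + ·) hv hw).trans
      ((congrArg (relπ M N).toLin (TensorProduct.add_tmul _ _ _)).trans (map_add _ _ _)).symm)

/-- The projection is onto, so the classes of homogeneous pure tensors span. -/
lemma rel_ext {W : Type u} [AddCommGroup W] [Module k W]
    {f g : (M ⊗ N : RightMod (funAlg α S)).X.V →ₗ[k] W}
    (h : ∀ x, ∀ m ∈ M.X.deg x, ∀ y, ∀ n ∈ N.X.deg y, f (relTm m n) = g (relTm m n)) : f = g := by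
  have : f ∘ₗ (relπ M N).toLin = g ∘ₗ (relπ M N).toLin := tm_ext h
  ext w
  obtain ⟨t, rfl⟩ := relπ_surjective M N w
  exact LinearMap.congr_fun this t

/-- Functions act through the second factor with scalar `α(x,y,1) = 1`; by `relTm_balanced` they act
equally well through the first. -/
lemma actₗ_relTm (a : S → k) (m : M.X.V) (n : N.X.V) :
    actₗ (M ⊗ N : RightMod (funAlg α S)) a (relTm m n) = relTm m (actₗ N a n) := by
  have : (actₗ (M ⊗ N : RightMod (funAlg α S)) a) ∘ₗ (relπ M N).toLin =
      (relπ M N).toLin ∘ₗ tmMap LinearMap.id (actₗ N a) := tm_ext fun x m hm y n hn => by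
    have h := LinearMap.congr_fun (congrArg Hom.toLin (RightMod.π_act M N))
        (tm (tm m n) (toFunObj α S a) : (tensor (tensor M.X N.X) (funObj α S)).V)
    have h1 : actₗ (M ⊗ N : RightMod (funAlg α S)) a (relTm m n) =
        (relπ M N).toLin ((tensorMap (𝟙 M.X) (actHom N)).toLin
          (Hom.toLin (assocIso M.X N.X (funObj α S)).hom (tm (tm m n) (toFunObj α S a)))) := h
    rw [assocIso_hom_tm hm hn (toFunObj_mem _),
      show (α.conjDatum (MonoidHom.id G)).α x y 1 = 1 from α.one_right _ _, inv_one,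
      Units.val_one, one_smul, tensorMap_tm, actHom_tm] at h1
    exact h1
  exact LinearMap.congr_fun this (tm m n)

variable {P : RightMod (funAlg α S)}

lemma whiskerLeft_relTm (M : RightMod (funAlg α S)) (f : N ⟶ P) (m : M.X.V) (n : N.X.V) :
    Hom.toLin (M ◁ f).hom (relTm m n) = relTm m (Hom.toLin f.hom n) :=
  LinearMap.congr_fun (congrArg Hom.toLin (RightMod.π_whiskerLeft M f))
    (tm m n : (tensor M.X N.X).V)

lemma whiskerRight_relTm (f : N ⟶ P) (M : RightMod (funAlg α S)) (n : N.X.V) (m : M.X.V) :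
    Hom.toLin (f ▷ M).hom (relTm n m) = relTm (Hom.toLin f.hom n) m :=
  LinearMap.congr_fun (congrArg Hom.toLin (RightMod.π_whiskerRight f M))
    (tm n m : (tensor N.X M.X).V)

/-- The scalar is inverted because the associator runs from `(M ⊗ N) ⊗ P` to `M ⊗ (N ⊗ P)`, opposite
to the direction in which `α` is prescribed. -/
lemma associator_relTm {x y z : G} {m : M.X.V} (hm : m ∈ M.X.deg x) {n : N.X.V}
    (hn : n ∈ N.X.deg y) {p : P.X.V} (hp : p ∈ P.X.deg z) :
    Hom.toLin (α_ M N P).hom.hom (relTm (relTm m n) p) =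
      (((α.toFun x y z)⁻¹ : kˣ) : k) • relTm m (relTm n p) := by
  have h := LinearMap.congr_fun (congrArg Hom.toLin (RightMod.π_associator M N P))
    (tm (tm m n) p : (tensor (tensor M.X N.X) P.X).V)
  have h1 : Hom.toLin (α_ M N P).hom.hom (relTm (relTm m n) p) =
      (relπ M (N ⊗ P)).toLin ((tensorMap (𝟙 M.X) (relπ N P)).toLin
        (Hom.toLin (assocIso M.X N.X P.X).hom (tm (tm m n) p))) := h
  rw [assocIso_hom_tm hm hn hp, map_smul, map_smul, tensorMap_tm] at h1
  exact h1

variable (α S) in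
/-- A function as an element of the unit module. -/
def unitElt (a : S → k) : (𝟙_ (RightMod (funAlg α S))).X.V := toFunObj α S a

lemma actₗ_unitElt (a b : S → k) :
    actₗ (𝟙_ (RightMod (funAlg α S))) a (unitElt α S b) = unitElt α S (b * a) :=
  funMulHom_tm α S b a

lemma leftUnitor_relTm (a : S → k) (m : M.X.V) :
    Hom.toLin (λ_ M).hom.hom (relTm (unitElt α S a) m) = actₗ M a m :=
  (LinearMap.congr_fun (congrArg Hom.toLin (RightMod.π_leftUnitor M))
    (tm (toFunObj α S a) m : (tensor (funObj α S) M.X).V)).trans (actLeftHom_tm M a m)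

lemma rightUnitor_relTm (a : S → k) (m : M.X.V) :
    Hom.toLin (ρ_ M).hom.hom (relTm m (unitElt α S a)) = actₗ M a m :=
  LinearMap.congr_fun (congrArg Hom.toLin (RightMod.π_rightUnitor M))
    (tm m (toFunObj α S a) : (tensor M.X (funObj α S)).V)

end

end GrRep
end RelativeTensor

/-! ### The monoidal structure of the fibre functor -/

section FibreMonoidal

open CategoryTheory Limits MonoidalCategory TensorProduct

open scoped Classical

attribute [local instance] Fintype.ofFinite

namespace GrRep

variable {k G : Type u} [Field k] [Group G] [Finite G] {α : Cocycle3 k G} {H : Subgroup G}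

variable (M N P : RightMod (cosetAlg α H))

/-- The tensor product of the projections to the fibres. -/
noncomputable def fibπ₂ : (tensor M.X N.X).V →ₗ[k] (tensor (fibObj M) (fibObj N)).V :=
  TensorProduct.map (fibπ M) (fibπ N)

/-- The tensor product of the inclusions of the fibres. -/
noncomputable def fibι₂ : (tensor (fibObj M) (fibObj N)).V →ₗ[k] (tensor M.X N.X).V :=
  TensorProduct.map (fibι M) (fibι N)

variable {M N P}

lemma fibπ₂_tm (m : M.X.V) (n : N.X.V) : fibπ₂ M N (tm m n) = tm (fibπ M m) (fibπ N n) := rfl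

/-- After projection to the fibre a function becomes the scalar `a (baseCoset H)`. Scalars move
freely across a tensor product, so the product of two such projections is balanced. -/
lemma fibπ_act (a : G ⧸ H → k) (m : M.X.V) : fibπ M (actₗ M a m) = a (baseCoset H) • fibπ M m :=
  fibι_injective <| by
    rw [fibι_π, map_smul, fibι_π, ← actₗ_mul, mul_indic, map_smul, LinearMap.smul_apply]

variable (M N) in
/-- The inverse of the tensor constraint of the fibre functor. -/
noncomputable def fibδLin : (M ⊗ N : RightMod (cosetAlg α H)).X.V →ₗ[k]
    (tensor (fibObj M) (fibObj N)).V :=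
  relLift (fibπ₂ M N) fun a m n => by
    rw [fibπ₂_tm, fibπ₂_tm, fibπ_act, fibπ_act, smul_tm, tm_smul]

lemma fibδLin_relTm (m : M.X.V) (n : N.X.V) :
    fibδLin M N (relTm m n) = tm (fibπ M m) (fibπ N n) := relLift_relTm _ _ m n

variable (M N) in
/-- The tensor constraint of the fibre functor. -/
noncomputable def fibμLin : (tensor (fibObj M) (fibObj N)).V →ₗ[k]
    (fibObj (M ⊗ N : RightMod (cosetAlg α H))).V :=
  fibπ _ ∘ₗ (relπ M N).toLin ∘ₗ fibι₂ M N

lemma fibμLin_tm (u : (fibObj M).V) (v : (fibObj N).V) :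
    fibμLin M N (tm u v) = fibπ _ (relTm (fibι M u) (fibι N v)) := rfl

/-- The class of a tensor of two fibre elements already lies in the fibre, since the idempotent acts
through the second factor; the projection in `fibμLin` changes nothing. -/
lemma fibι_μLin_tm (u : (fibObj M).V) (v : (fibObj N).V) :
    fibι _ (fibμLin M N (tm u v)) = relTm (fibι M u) (fibι N v) := by
  rw [fibμLin_tm, fibι_π, actₗ_relTm, actₗ_fibι, indic_self, one_smul]

/-- With `e` the idempotent of the trivial coset, balancing gives `em ⊗ en = m ⊗ een = m ⊗ en = e(m
⊗ n)`. Hence the fibre of `M ⊗_A N` is the tensor product of the fibres. -/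
lemma fibμLin_δLin (w : (M ⊗ N : RightMod (cosetAlg α H)).X.V) :
    fibμLin M N (fibδLin M N w) = fibπ _ w := by
  have : fibμLin M N ∘ₗ fibδLin M N = fibπ _ := rel_ext fun x m hm y n hn => by
    rw [LinearMap.comp_apply, fibδLin_relTm]
    apply fibι_injective
    rw [fibι_μLin_tm, fibι_π, fibι_π, fibι_π, actₗ_relTm, relTm_balanced, ← actₗ_mul, mul_indic,
      indic_self, one_smul]
  exact LinearMap.congr_fun this w

variable (M N) in
/-- The tensor constraint of the fibre functor, as a linear equivalence. -/
noncomputable def fibμEquiv : (tensor (fibObj M) (fibObj N)).V ≃ₗ[k]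
    (fibObj (M ⊗ N : RightMod (cosetAlg α H))).V :=
  LinearEquiv.ofLinearMap (fibμLin M N) (fibδLin M N ∘ₗ fibι _)
    (by
      ext w
      rw [LinearMap.comp_apply, LinearMap.comp_apply, fibμLin_δLin, fibπ_ι]
      rfl)
    (tm_ext fun x u hu y v hv => by
      rw [LinearMap.comp_apply, LinearMap.comp_apply, fibι_μLin_tm, fibδLin_relTm, fibπ_ι, fibπ_ι]
      rfl)

variable (M N) in
/-- The tensor constraint of the fibre functor. -/
noncomputable def fibμIso : tensor (fibObj M) (fibObj N) ≅
    fibObj (M ⊗ N : RightMod (cosetAlg α H)) :=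
  isoMk (fibμEquiv M N)
    (tm_le (f := fibμLin M N) fun x u hu y v hv =>
      fibπ_mem_deg (relTm_mem (fibι_mem_deg.2 hu) (fibι_mem_deg.2 hv)))
    (fun h => tm_ext fun x u hu y v hv => by
      change fibμLin M N ((tensor (fibObj M) (fibObj N)).ρ h (tm u v)) =
        (fibObj (M ⊗ N : RightMod (cosetAlg α H))).ρ h (fibμLin M N (tm u v))
      apply fibι_injective
      rw [ρ_tm h hu hv, map_smul, map_smul, fibι_μLin_tm, fibι_ρ, fibι_ρ, fibι_ρ, fibι_μLin_tm,
        relTm_ρ (h : G) (fibι_mem_deg.2 hu) (fibι_mem_deg.2 hv)]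
      rfl)

lemma fibι_μIso_tm (u : (fibObj M).V) (v : (fibObj N).V) :
    fibι _ (Hom.toLin (fibμIso M N).hom (tm u v)) = relTm (fibι M u) (fibι N v) :=
  fibι_μLin_tm u v

lemma unitElt_indic_mem : unitElt α (G ⧸ H) (indic k (baseCoset H)) ∈
    fib (𝟙_ (RightMod (cosetAlg α H))) := by
  rw [mem_fib]
  refine (actₗ_unitElt _ _).trans ?_
  rw [mul_indic, indic_self, one_smul]

variable (α H) in
/-- The unit constraint of the fibre functor, as a linear map. -/
noncomputable def fibεLin : (unit (α.conjDatum H.subtype)).V →ₗ[k]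
    (fibObj (𝟙_ (RightMod (cosetAlg α H)))).V :=
  LinearMap.toSpanSingleton k _
    (fibπ _ (unitElt α (G ⧸ H) (indic k (baseCoset H))))

lemma fibεLin_one_mem : fibεLin α H (one _) ∈ (fibObj (𝟙_ (RightMod (cosetAlg α H)))).deg 1 :=
  have h : unitElt α (G ⧸ H) (indic k (baseCoset H)) ∈
    (𝟙_ (RightMod (cosetAlg α H))).X.deg 1 := toFunObj_mem (α := α) (S := G ⧸ H) _
  Submodule.smul_mem _ (1 : k) (fibπ_mem_deg h)

lemma fibι_εLin_one : fibι _ (fibεLin α H (one _)) =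
    unitElt α (G ⧸ H) (indic k (baseCoset H)) :=
  (congrArg (fibι _) (one_smul k _)).trans (fibι_π_of_mem unitElt_indic_mem)

variable (α H) in
/-- The value of a function at the trivial coset. -/
noncomputable def evalBase : (𝟙_ (RightMod (cosetAlg α H))).X.V →ₗ[k]
    (unit (α.conjDatum H.subtype)).V :=
  (LinearMap.proj (baseCoset H) : (G ⧸ H → k) →ₗ[k] k)

lemma evalBase_unitElt (a : G ⧸ H → k) :
    evalBase α H (unitElt α (G ⧸ H) a) = a (baseCoset H) • one _ :=
  (mul_one (a (baseCoset H))).symm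

/-- A function in the fibre is fixed by multiplication with the indicator of the trivial coset, so
it is its value there times that indicator. -/
lemma fibεLin_evalBase (v : (fibObj (𝟙_ (RightMod (cosetAlg α H)))).V) :
    fibεLin α H (evalBase α H (fibι _ v)) = v := by
  apply fibι_injective
  obtain ⟨a, ha⟩ : ∃ a, unitElt α (G ⧸ H) a = fibι _ v := ⟨fibι _ v, rfl⟩
  have h := mem_fib.1 (fibι_mem v)
  rw [← ha, evalBase_unitElt, map_smul, map_smul, fibι_εLin_one]
  rw [← ha] at h
  refine Eq.trans ?_ ((actₗ_unitElt _ _).symm.trans h)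
  rw [mul_indic]
  rfl

variable (α H) in
/-- The unit constraint of the fibre functor. -/
noncomputable def fibεIso : unit (α.conjDatum H.subtype) ≅
    fibObj (𝟙_ (RightMod (cosetAlg α H))) :=
  isoMk
    (LinearEquiv.ofLinearMap (fibεLin α H) (evalBase α H ∘ₗ fibι _)
      (LinearMap.ext fun v => fibεLin_evalBase v)
      (LinearMap.ext fun c => by
        obtain ⟨a, rfl⟩ : ∃ a : k, c = a • one _ := ⟨c, (mul_one (M := k) c).symm⟩
        rw [map_smul, map_smul, LinearMap.comp_apply, LinearMap.comp_apply, fibι_εLin_one,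
          evalBase_unitElt, indic_self, one_smul]
        rfl))
    (fun x v hv => by
      obtain ⟨a, rfl, h⟩ := mem_unit hv
      rw [map_smul]
      rcases h with rfl | rfl
      · exact Submodule.smul_mem _ _ fibεLin_one_mem
      · rw [zero_smul]; exact Submodule.zero_mem _)
    (fun h => LinearMap.ext fun c => by
      obtain ⟨a, rfl⟩ : ∃ a : k, c = a • one _ := ⟨c, (mul_one (M := k) c).symm⟩
      rw [map_smul, map_smul]
      congr 1
      change fibεLin α H (one _) = (fibObj (𝟙_ (RightMod (cosetAlg α H)))).ρ h
        (fibεLin α H (one _))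
      apply fibι_injective
      rw [fibι_ρ, fibι_εLin_one]
      refine Eq.trans ?_ (funObj_ρ (h : G) (indic k (baseCoset H))).symm
      -- The subgroup `H` fixes the trivial coset, so its indicator is `H`-invariant, in accordance
      -- with the trivial action on the unit object.
      rw [indic_smul, coe_smul_baseCoset]
      rfl)

lemma fibι_εIso_one : fibι _ (Hom.toLin (fibεIso α H).hom (one _)) =
    unitElt α (G ⧸ H) (indic k (baseCoset H)) := fibι_εLin_one

variable (α H) in
/-- The monoidal structure of the fibre functor. -/
noncomputable def fibCore : (fibFunctor α H).CoreMonoidal where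
  εIso := fibεIso α H
  μIso := fibμIso
  μIso_hom_natural_left {M N} f P := hom_ext _ _ <|
    tm_ext (X := fibObj M) (Y := fibObj P) fun x u hu y v hv => fibι_injective <| by
    change fibι _ (Hom.toLin (fibμIso N P).hom (tm ((fibMap f).toLin u) v)) =
      fibι _ ((fibMap (f ▷ P)).toLin (Hom.toLin (fibμIso M P).hom (tm u v)))
    rw [fibι_map, fibι_μIso_tm, fibι_μIso_tm, fibι_map]
    exact (whiskerRight_relTm f P _ _).symm
  μIso_hom_natural_right {M N} P f := hom_ext _ _ <|
    tm_ext (X := fibObj P) (Y := fibObj M) fun x u hu y v hv => fibι_injective <| by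
    change fibι _ (Hom.toLin (fibμIso P N).hom (tm u ((fibMap f).toLin v))) =
      fibι _ ((fibMap (P ◁ f)).toLin (Hom.toLin (fibμIso P M).hom (tm u v)))
    rw [fibι_map, fibι_μIso_tm, fibι_μIso_tm, fibι_map]
    exact (whiskerLeft_relTm P f _ _).symm
  associativity M N P := hom_ext _ _ <|
    tm_ext₃ (X := fibObj M) (Y := fibObj N) (Z := fibObj P) fun x u hu y v hv z w hw => fibι_injective <| by
    change fibι _ ((fibMap (α_ M N P).hom).toLin (Hom.toLin (fibμIso (M ⊗ N) P).hom
        (tm (Hom.toLin (fibμIso M N).hom (tm u v)) w))) =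
      fibι _ (Hom.toLin (fibμIso M (N ⊗ P)).hom
        ((tensorMap (𝟙 (fibObj M)) (fibμIso N P).hom).toLin
          (Hom.toLin (assocIso (fibObj M) (fibObj N) (fibObj P)).hom (tm (tm u v) w))))
    rw [fibι_map, fibι_μIso_tm, fibι_μIso_tm, assocIso_hom_tm hu hv hw, map_smul, map_smul,
      map_smul, tensorMap_tm, fibι_μIso_tm, fibι_μIso_tm]
    -- The inclusion of a fibre preserves degrees, so both associators carry the same scalar
    -- `α(x,y,z)⁻¹`.
    exact associator_relTm (fibι_mem_deg.2 hu) (fibι_mem_deg.2 hv) (fibι_mem_deg.2 hw)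
  left_unitality M := hom_ext _ _ <| unit_tm_ext (X := fibObj M) fun x u hu => fibι_injective <| by
    change fibι _ (Hom.toLin (leftUnitorIso (fibObj M)).hom (tm (one _) u)) =
      fibι _ ((fibMap (λ_ M).hom).toLin (Hom.toLin (fibμIso (𝟙_ _) M).hom
        (tm (Hom.toLin (fibεIso α H).hom (one _)) u)))
    rw [leftUnitorIso_tm, fibι_map, fibι_μIso_tm, fibι_εIso_one]
    refine Eq.trans ?_ (leftUnitor_relTm _ _).symm
    -- The unit constraint of `D` picks the indicator of the trivial coset, which acts as the
    -- identity on the fibre.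
    rw [actₗ_fibι, indic_self, one_smul]
  right_unitality M := hom_ext _ _ <| tm_unit_ext (X := fibObj M) fun x u hu => fibι_injective <| by
    change fibι _ (Hom.toLin (rightUnitorIso (fibObj M)).hom (tm u (one _))) =
      fibι _ ((fibMap (ρ_ M).hom).toLin (Hom.toLin (fibμIso M (𝟙_ _)).hom
        (tm u (Hom.toLin (fibεIso α H).hom (one _)))))
    rw [rightUnitorIso_tm, fibι_map, fibι_μIso_tm, fibι_εIso_one]
    refine Eq.trans ?_ (rightUnitor_relTm _ _).symm
    rw [actₗ_fibι, indic_self, one_smul]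

noncomputable instance : (fibFunctor α H).Monoidal := (fibCore α H).toMonoidal

end GrRep
end FibreMonoidal

/-! ### Lifting monoidal structures along fully faithful monoidal functors -/

section MonoidalLift

open CategoryTheory MonoidalCategory Functor.LaxMonoidal Functor.OplaxMonoidal

namespace CategoryTheory.Functor

variable {A B E : Type*} [Category* A] [Category* B] [Category* E]
  [MonoidalCategory A] [MonoidalCategory B] [MonoidalCategory E]
  {L : A ⥤ B} {I : B ⥤ E} [I.Monoidal] (hI : I.FullyFaithful)

/-- A functor whose composite with a fully faithful monoidal functor is monoidal is monoidal. -/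
noncomputable def FullyFaithful.coreMonoidalOfComp (J : (L ⋙ I).Monoidal) : L.CoreMonoidal :=
  let e := hI.preimageIso ((Monoidal.εIso I).symm ≪≫ Monoidal.εIso (L ⋙ I))
  let m := fun X Y => hI.preimageIso ((Monoidal.μIso I (L.obj X) (L.obj Y)).symm ≪≫
    Monoidal.μIso (L ⋙ I) X Y)
  -- These two identities characterise the lifted constraints: combined with those of `I`, they give
  -- back the constraints of `L ⋙ I`.
  have he : ε I ≫ I.map e.hom = ε (L ⋙ I) := by simp [e]
  have hm : ∀ X Y, μ I _ _ ≫ I.map (m X Y).hom = μ (L ⋙ I) X Y := fun X Y => by simp [m]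
  { εIso := e
    μIso := m
    μIso_hom_natural_left := fun {X Y} f Z => hI.map_injective <| by
      -- This axiom and the following ones are checked after applying the faithful `I` and composing
      -- with its invertible constraints, where they become the axioms for `L ⋙ I`.
      rw [← cancel_epi (μ I _ _), I.map_comp, I.map_comp, ← μ_natural_left_assoc, hm,
        reassoc_of% (hm X Z)]
      exact μ_natural_left (L ⋙ I) f Z
    μIso_hom_natural_right := fun {X Y} Z f => hI.map_injective <| by
      rw [← cancel_epi (μ I _ _), I.map_comp, I.map_comp, ← μ_natural_right_assoc, hm,
        reassoc_of% (hm Z X)]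
      exact μ_natural_right (L ⋙ I) Z f
    associativity := fun X Y Z => hI.map_injective <| by
      rw [← cancel_epi (μ I _ _), ← cancel_epi (μ I _ _ ▷ _), I.map_comp, I.map_comp,
        I.map_comp, I.map_comp, ← μ_natural_left_assoc, reassoc_of% (hm (X ⊗ Y) Z),
        LaxMonoidal.associativity_assoc, ← μ_natural_right_assoc, hm,
        ← comp_whiskerRight_assoc, hm, ← MonoidalCategory.whiskerLeft_comp_assoc, hm]
      exact LaxMonoidal.associativity (L ⋙ I) X Y Z
    left_unitality := fun X => hI.map_injective <| by
      rw [← cancel_epi (μ I _ _), ← cancel_epi (ε I ▷ _), ← LaxMonoidal.left_unitality,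
        I.map_comp, I.map_comp, ← μ_natural_left_assoc, reassoc_of% (hm (𝟙_ A) X),
        ← comp_whiskerRight_assoc, he]
      exact LaxMonoidal.left_unitality (L ⋙ I) X
    right_unitality := fun X => hI.map_injective <| by
      rw [← cancel_epi (μ I _ _), ← cancel_epi (_ ◁ ε I), ← LaxMonoidal.right_unitality,
        I.map_comp, I.map_comp, ← μ_natural_right_assoc, reassoc_of% (hm X (𝟙_ A)),
        ← MonoidalCategory.whiskerLeft_comp_assoc, he]
      exact LaxMonoidal.right_unitality (L ⋙ I) X }

variable {K : A ⥤ E} [K.Monoidal] (e : L ⋙ I ≅ K)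

/-- A lift of a monoidal functor along a fully faithful monoidal functor is monoidal. -/
@[reducible]
noncomputable def FullyFaithful.monoidalLift : L.Monoidal :=
  (hI.coreMonoidalOfComp (Monoidal.transport e.symm)).toMonoidal

lemma FullyFaithful.map_μ_monoidalLift (X Y : A) :
    letI := hI.monoidalLift e
    I.map (μ L X Y) = δ I _ _ ≫ (e.hom.app X ⊗ₘ e.hom.app Y) ≫ μ K X Y ≫ e.inv.app _ :=
  hI.map_preimage _

lemma FullyFaithful.map_ε_monoidalLift :
    letI := hI.monoidalLift e
    I.map (ε L) = η I ≫ ε K ≫ e.inv.app _ :=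
  hI.map_preimage _

/-- The constraints of `L` are the preimages under `I` of those of `K` conjugated by `e`, so
composing with the constraints of `I` cancels everything but the compatibility of `e`. -/
lemma FullyFaithful.isMonoidal_monoidalLift :
    letI := hI.monoidalLift e
    NatTrans.IsMonoidal e.hom :=
  letI := hI.monoidalLift e
  { unit := by
      rw [comp_ε, hI.map_ε_monoidalLift]
      simp
    tensor := fun X Y => by
      rw [comp_μ, hI.map_μ_monoidalLift]
      simp }

end CategoryTheory.Functor

end MonoidalLift

/-! ### Local modules and objects graded by the subgroup -/

section LocalModules

open CategoryTheory Limits MonoidalCategory TensorProduct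

open scoped Classical

attribute [local instance] Fintype.ofFinite

namespace GrRep

variable {k G : Type u} [Field k] [Group G] [Finite G] {α : Cocycle3 k G} {H : Subgroup G}

/-- The first braiding turns `m ⊗ a` into `x.a ⊗ m`; the second is the plain flip, because functions
have degree `1`. So locality says that `x.a` and `a` act alike on degree `x`. -/
lemma isLocal_iff {S : Type u} [Finite S] [MulAction G S] {M : RightMod (funAlg α S)} :
    RightMod.isLocal (funAlg α S) M ↔ ∀ x, ∀ m ∈ M.X.deg x, ∀ a : S → k,
      actₗ M (fun s => a (x⁻¹ • s)) m = actₗ M a m := by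
  have key : ∀ x, ∀ m ∈ M.X.deg x, ∀ a : S → k,
      Hom.toLin ((braid M.X (funObj α S)).hom ≫ actLeftHom M) (tm m (toFunObj α S a)) =
        actₗ M (fun s => a (x⁻¹ • s)) m := fun x m hm a => by
    change (actLeftHom M).toLin (Hom.toLin (braid M.X (funObj α S)).hom (tm m (toFunObj α S a))) = _
    rw [braid_tm hm, funObj_ρ, actLeftHom_tm]
  constructor
  · intro h x m hm a
    rw [← key x m hm a]
    exact LinearMap.congr_fun (congrArg Hom.toLin h)
      (tm m (toFunObj α S a) : (tensor M.X (funObj α S)).V)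
  · intro h
    exact hom_ext _ _ <| tm_ext (X := M.X) (Y := funObj α S) fun x m hm y a ha =>
      (key x m hm a).trans (h x m hm a)

/-- The objects whose grading is supported on the subgroup. -/
def Supported (V : CCat α H) : Prop := ∀ x ∉ H, ∀ v ∈ V.deg x, v = 0

lemma supported_of_iso {V W : CCat α H} (e : V ≅ W) (hV : Supported V) : Supported W :=
  fun x hx w hw => by
    have h1 : Hom.toLin e.inv w = 0 := hV x hx _ (Hom.map_mem e.inv x w hw)
    have h2 : Hom.toLin e.hom (Hom.toLin e.inv w) = w :=
      LinearMap.congr_fun (congrArg Hom.toLin e.inv_hom_id) w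
    rw [← h2, h1, map_zero]

lemma supported_incl (X : ZCat (α.res H)) : Supported (inclObj X) := fun x hx v hv => by
  rcases incl_cases hv with rfl | ⟨h, rfl, -⟩
  · rfl
  · exact absurd h.2 hx

/-- On a fibre vector of degree `x`, the indicator of the trivial coset acts by `1` and its
translate by `x` acts by `0` unless `x ∈ H`. Conversely, if `y ∈ H`, the degree `t y t⁻¹` of `t.v`
fixes the coset `t • baseCoset H` over which `t.v` lies. -/
lemma isLocal_iff_supported {M : RightMod (cosetAlg α H)} :
    RightMod.isLocal (cosetAlg α H) M ↔ Supported (fibObj M) := by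
  rw [isLocal_iff]
  constructor
  · intro h x hx v hv
    apply fibι_injective
    have h1 := h x _ (fibι_mem_deg.2 hv) (indic k (baseCoset H))
    rw [indic_smul, actₗ_fibι, actₗ_fibι, indic_self, one_smul, indic_ne, zero_smul] at h1
    · rw [← h1, map_zero]
    · intro e
      exact hx (smul_baseCoset_eq_iff.1 e.symm)
  · intro h x m hm a
    -- The condition over all degrees is packed into one equality of linear maps, so that `fib_ext`
    -- reduces it to translates of the fibre.
    have : ∑ y, actₗ M (fun s => a (y⁻¹ • s)) ∘ₗ M.X.proj y = actₗ M a :=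
      fib_ext fun t y v hv => by
        rw [LinearMap.sum_apply, Finset.sum_eq_single (t * y * t⁻¹)]
        · rw [LinearMap.comp_apply, M.X.proj_same (conj_mem (fibι_mem_deg.2 hv)),
            act_ρ_fib _ _ (fibι_mem v), act_ρ_fib _ _ (fibι_mem v)]
          by_cases hy : y ∈ H
          · have hy' : (t * y * t⁻¹)⁻¹ • t • baseCoset H = t • baseCoset H := by
              rw [← mul_smul, show (t * y * t⁻¹)⁻¹ * t = t * y⁻¹ by group, mul_smul,
                smul_baseCoset_eq_iff.2 (H.inv_mem hy)]
            rw [hy']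
          -- Degrees outside `H` do not occur in the fibre.
          · rw [h y hy v hv, map_zero, map_zero, smul_zero, smul_zero]
        · intro z _ hz
          rw [LinearMap.comp_apply, M.X.proj_ne (conj_mem (fibι_mem_deg.2 hv)) hz.symm, map_zero]
        · simp
    rw [← this, LinearMap.sum_apply, Finset.sum_eq_single x]
    · rw [LinearMap.comp_apply, M.X.proj_same hm]
    · intro z _ hz
      rw [LinearMap.comp_apply, M.X.proj_ne hm hz.symm, map_zero]
    · simp

/-- The restriction of the grading to the subgroup. -/
noncomputable def resObj (V : CCat α H) (hV : Supported V) : ZCat (α.res H) where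
  V := V.V
  deg h := V.deg (h : G)
  isInternal := isInternal_of_proj _ (fun h => V.proj (h : G))
    (fun h v => V.proj_mem _ v)
    (fun h v hv => V.proj_same hv)
    (fun h h' hh v hv => V.proj_ne hv fun e => hh (Subtype.ext e))
    (fun v => by
      let : Fintype H := Fintype.ofFinite H
      refine Eq.trans ?_ (V.sum_proj v)
      refine Finset.sum_of_injOn (fun h : H => (h : G)) (Subtype.val_injective.injOn)
        (fun _ _ => Finset.mem_coe.2 (Finset.mem_univ _)) ?_ (fun _ _ => rfl)
      -- Components in degrees outside `H` vanish, so the sum over `H` already recovers the vector.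
      intro g _ hg
      exact hV g (fun h => hg ⟨⟨g, h⟩, Finset.mem_coe.2 (Finset.mem_univ _), rfl⟩) _
        (V.proj_mem g v))
  ρ := V.ρ
  map_deg f h := V.map_deg f (h : G)
  ρ_mul f g h v hv := V.ρ_mul f g (h : G) v hv

/-- Restricting the grading and extending it by zero gives back the original object. -/
noncomputable def inclResIso (V : CCat α H) (hV : Supported V) : inclObj (resObj V hV) ≅ V :=
  isoMk (LinearEquiv.refl k V.V)
    (fun x v hv => by
      rcases incl_cases hv with rfl | ⟨h, rfl, w, hw, rfl⟩
      · exact Submodule.zero_mem _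
      · exact hw)
    (fun _ => rfl)

variable (α H) in
/-- The inclusion of `Z(H, α|_H)` in `C(G, H, α)` is fully faithful. -/
noncomputable def inclFullyFaithful : (incl α H).FullyFaithful where
  preimage {X Y} f :=
    { toLin := Hom.toLin (X := inclObj X) (Y := inclObj Y) f
      map_mem := fun h v hv => by
        have h1 := Hom.map_mem (X := inclObj X) (Y := inclObj Y) f (h : G) _ (inclV_mem hv)
        rcases incl_cases h1 with h0 | ⟨h', hh, w, hw, hw'⟩
        · exact h0 ▸ Submodule.zero_mem _
        · obtain rfl := Subtype.ext hh
          exact hw' ▸ hw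
      comm := Hom.comm (X := inclObj X) (Y := inclObj Y) f }

variable (α H) in
/-- The functor sending a local module to its fibre at the trivial coset. -/
noncomputable def locFunctor :
    (RightMod.isLocal (cosetAlg α H)).FullSubcategory ⥤ ZCat (α.res H) where
  obj M := resObj (fibObj M.1) (isLocal_iff_supported.1 M.2)
  map f :=
    { toLin := (fibMap f.hom).toLin
      map_mem := fun h v hv => (fibMap f.hom).map_mem (h : G) v hv
      comm := (fibMap f.hom).comm }

variable (α H) in
/-- The fibre functor on local modules factors through `Z(H, α|_H)`. -/
noncomputable def locInclIso : locFunctor α H ⋙ incl α H ≅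
    (RightMod.isLocal (cosetAlg α H)).ι ⋙ fibFunctor α H :=
  NatIso.ofComponents (fun M => inclResIso (fibObj M.1) (isLocal_iff_supported.1 M.2))
    (fun _ => rfl)

instance : (incl α H).Full := (inclFullyFaithful α H).full

instance : (incl α H).Faithful := (inclFullyFaithful α H).faithful

instance : (locFunctor α H).Faithful :=
  have : (locFunctor α H ⋙ incl α H).Faithful := Functor.Faithful.of_iso (locInclIso α H).symm
  Functor.Faithful.of_comp _ (incl α H)

/-- The composite with the faithful inclusion is isomorphic to the full functor `ι ⋙ D`, where `ι`
embeds local modules in all modules. -/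
instance : (locFunctor α H).Full :=
  have : (locFunctor α H ⋙ incl α H).Full := Functor.Full.of_iso (locInclIso α H).symm
  Functor.Full.of_comp_faithful _ (incl α H)

/-- The object `inclObj X` is the fibre of some module since `D` is essentially surjective. Its
support lies in `H`, so that module is local, and the isomorphism of fibres is reflected along the
fully faithful inclusion. -/
instance : (locFunctor α H).EssSurj where
  mem_essImage X := by
    let e := (fibFunctor α H).objObjPreimageIso (inclObj X)
    have hM : RightMod.isLocal (cosetAlg α H) ((fibFunctor α H).objPreimage (inclObj X)) :=
      isLocal_iff_supported.2 (supported_of_iso e.symm (supported_incl X))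
    exact ⟨⟨_, hM⟩, ⟨(inclFullyFaithful α H).preimageIso
      ((locInclIso α H).app ⟨_, hM⟩ ≪≫ e)⟩⟩

instance : (locFunctor α H).IsEquivalence where

noncomputable instance : (locFunctor α H).Monoidal :=
  (inclFullyFaithful α H).monoidalLift (locInclIso α H)

instance : NatTrans.IsMonoidal (locInclIso α H).hom :=
  (inclFullyFaithful α H).isMonoidal_monoidalLift (locInclIso α H)

end GrRep
end LocalModules

/-! ### Compatibility with the braidings -/

section LocalBraiding

open CategoryTheory Limits MonoidalCategory TensorProduct

open scoped Classical

attribute [local instance] Fintype.ofFinite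

namespace GrRep

variable {k G : Type u} [Field k] [Group G] [Finite G] {α : Cocycle3 k G} {H : Subgroup G}

lemma braidIso_relTm {S : Type u} [Finite S] [MulAction G S] {M N : RightMod (funAlg α S)}
    (hM : RightMod.isLocal (funAlg α S) M) {x : G} {m : M.X.V} (hm : m ∈ M.X.deg x)
    (n : N.X.V) : Hom.toLin (RightMod.braidIso M N hM).hom.hom (relTm m n) =
      relTm (N.X.ρ x n) m := by
  have h := LinearMap.congr_fun (congrArg Hom.toLin (RightMod.π_braidIso_hom M N hM))
    (tm m n : (tensor M.X N.X).V)
  exact h.trans (congrArg (relπ N M).toLin (braid_tm hm n))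

variable (M N : (RightMod.isLocal (cosetAlg α H)).FullSubcategory)

/-- The identity map from the fibre of a local module to its restriction. -/
noncomputable def locV : ((locFunctor α H).obj M).V ≃ₗ[k] (fibObj M.1).V :=
  LinearEquiv.refl k (fibObj M.1).V

variable {M N}

lemma locV_mem {h : H} {u : ((locFunctor α H).obj M).V}
    (hu : u ∈ ((locFunctor α H).obj M).deg h) : locV M u ∈ (fibObj M.1).deg (h : G) := hu

lemma locV_ρ (h : H) (u : ((locFunctor α H).obj M).V) :
    locV M (((locFunctor α H).obj M).ρ h u) = (fibObj M.1).ρ h (locV M u) := rfl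

lemma locV_map (f : M ⟶ N) (u : ((locFunctor α H).obj M).V) :
    locV N (Hom.toLin ((locFunctor α H).map f) u) = (fibMap f.hom).toLin (locV M u) := rfl

/-- This holds by definition: the monoidal constraints of the inclusion and the isomorphism
`locInclIso` are identity maps on underlying spaces, so the lifted constraint is that of the fibre
functor. -/
lemma locV_μ (u : ((locFunctor α H).obj M).V) (v : ((locFunctor α H).obj N).V) :
    locV (M ⊗ N) (Hom.toLin (Functor.LaxMonoidal.μ (locFunctor α H) M N) (tm u v)) =
      Hom.toLin (fibμIso M.1 N.1).hom (tm (locV M u) (locV N v)) := rfl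

/-- Both braidings are `u ⊗ v ↦ x.v ⊗ u` for `u` of degree `x`. Here `x ∈ H`, so `x` acts on the
fibre and on the module by the same operator. -/
noncomputable instance : (locFunctor α H).Braided where
  braided M N := hom_ext _ _ <|
    tm_ext (X := (locFunctor α H).obj M) (Y := (locFunctor α H).obj N) fun x u hu y v hv => by
      apply (locV (N ⊗ M)).injective
      apply fibι_injective
      change fibι _ (locV (N ⊗ M) (Hom.toLin ((locFunctor α H).map (β_ M N).hom)
          (Hom.toLin (Functor.LaxMonoidal.μ (locFunctor α H) M N) (tm u v)))) =
        fibι _ (locV (N ⊗ M) (Hom.toLin (Functor.LaxMonoidal.μ (locFunctor α H) N M)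
          (Hom.toLin (braid ((locFunctor α H).obj M) ((locFunctor α H).obj N)).hom (tm u v))))
      rw [braid_tm hu, locV_map, locV_μ, locV_μ, locV_ρ]
      refine (fibι_map (β_ M N).hom.hom _).trans ?_
      refine Eq.trans ?_ (fibι_μIso_tm _ _).symm
      refine (congrArg _ (fibι_μIso_tm _ _)).trans ?_
      exact braidIso_relTm M.2 (fibι_mem_deg.2 (locV_mem hu)) _

end GrRep
end LocalBraiding

/-- Right `k(G/H)`-modules in `Z(G, α)` are monoidally equivalent to `C(G, H, α)`; local modules are
equivalent to `Z(H, α|_H)` as a braided monoidal category, compatibly with the inclusion of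
`Z(H, α|_H)` in `C(G, H, α)`. -/
theorem mainTheorem4 {k G : Type u} [Field k] [Group G] [Finite G] (H : Subgroup G)
    (α : Cocycle3 k G) :
    ∃ (D : RightMod (cosetAlg α H) ⥤ CCat α H) (_ : D.Monoidal),
      D.IsEquivalence ∧
      ∃ (L : (RightMod.isLocal (cosetAlg α H)).FullSubcategory ⥤ ZCat (α.res H)) (_ : L.Braided),
        L.IsEquivalence ∧
        ∃ e : L ⋙ GrRep.incl α H ≅ (RightMod.isLocal (cosetAlg α H)).ι ⋙ D,
          NatTrans.IsMonoidal e.hom :=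
  ⟨GrRep.fibFunctor α H, inferInstance, inferInstance, GrRep.locFunctor α H, inferInstance,
    inferInstance, GrRep.locInclIso α H, inferInstance⟩
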